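/- Notation. Let $q=e^{i\pi\tau}$ with $\Im\tau>0$, $\frac{\eta_1}{\pi}=\frac1{12}-2\sum_{k\ge1}\frac{q^{2k}}{(1-q^{2k})^2}$, $G=\prod_{k\ge1}(1-q^{2k})$, $\theta_1(x)=G\sin x\prod_{k\ge1}(1-2q^{2k}\cos2x+q^{4k})$, $\theta_4(x)=G\prod_{k\ge1}(1-2q^{2k-1}\cos2x+q^{4k-2})$, and let $\wp$ be the Weierstrass function with periods $\pi,\pi\tau$. For real $x$ write $(\theta_1(x)^2)^{s/2}=(\sin^2x)^{s/2}\,(\theta_1(x)/\sin x)^s$; here $(\theta_1(x)/\sin x)^s$ and $\theta_4(x)^s$ are the branches analytic in $q$, $|q|<1$, that equal $1$ at $q=0$. Let $C_n^{(g)}(z)=\sum_{k=0}^{\lfloor n/2\rfloor}\frac{(-1)^k(g)_{n-k}}{k!\,(n-2k)!}(2z)^{n-2k}$ for $g\neq0$, where $(a)_n=a(a+1)\cdots(a+n-1)$, and $C_n^{(0)}=T_n$, so that $C_n^{(0)}(\cos x)=\cos nx$. A function $\psi(x,\tau)$, $x\in[-\pi,\pi]$, $\Im\tau>0$, has the *Gegenbauer-led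 form of degree $n\in\mathbb N_0$ and coupling $g$* if $\psi(x,\tau)=(\theta_1(x)^2)^{g/2}P(\cos x,q)$, where $P(z,q)$ is holomorphic on an open neighbourhood of $[-1,1]\times\{|q|<1\}$ and $P(z,q)=C_n^{(g)}(z)+\sum_{\ell\ge1}P^{(\ell)}(z)q^{2\ell}$ (convergent for $z\in[-1,1]$, $|q|<1$) with polynomials $P^{(\ell)}$ of degree at most $n+2\ell$. The *non-stationary Lamé equation for $(\kappa,g)$ with energy $E$* is $$\Bigl(\tfrac{2i}{\pi}\kappa\,\partial_\tau-\partial_x^2+g(g-1)\wp(x)\Bigr)\psi=E(\tau)\psi\qquad(x\in(-\pi,\pi)\setminus\{0\},\ \Im\tau>0),$$ and $E_{n,g}=(n+g)^2-4g(g-1)\frac{\eta_1}{\pi}+6g^2\bigl(\frac{\eta_1}{\pi}-\frac1{12}\bigr)$. A pair of integers $m\ge0$, $\ell\ge1$ is *resonant* if $(m-n)(m+n+2g)=4\kappa\ell$. Theorem 2. Let $\kappa\in\mathbb R$, $g\ge0$ with $2g+\kappa>0$, and $n\in\mathbb N_0$. Assume that there is no resonant pair $(m,\ell)$ with $m\le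 n-2\ell$ and $m\equiv n\pmod 2$ (this is automatic if $g+\kappa>-1$). Let $\psi_{n,g}$ be of the Gegenbauer-led form of degree $n$ and coupling $g$ and a solution of the non-stationary Lamé equation for $(\kappa,g)$ with energy $E_{n,g}$. If there is a resonant pair $(m,\ell)$ with $m\le n+2\ell$ and $m\not\equiv n\pmod2$, assume moreover that $\psi_{n,g}(\pi-x)=(-1)^n\psi_{n,g}(x)$ for $x\in[0,\pi]$. Put $$(\mathfrak K_{g+\kappa,g}\psi_{n,g})(x)=q^{-n}M_{n,g,\kappa}\int_{-\pi}^{\pi}\frac{dy}{2\pi}\,\frac{(\theta_1(x)^2)^{(g+\kappa)/2}(\theta_1(y)^2)^{g/2}}{\bigl(\theta_4(\frac{x+y}2)\,\theta_4(\frac{x-y}2)\bigr)^{2g+\kappa}}\,\psi_{n,g}(y),$$ $$M_{n,g,\kappa}=\frac{(g)_n(g+\kappa)_n}{n!\,(2g+\kappa)_n\,\mathfrak h_n},\qquad \mathfrak h_n=\frac{2^{1-2g}\,\Gamma(n+2g)}{n!\,(n+g)\,\Gamma(g)^2}\qquad(g\ne0,\ g+\kappa\neq0);$$ in the limiting cases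 $M_{n,0,\kappa}=1$, and, for $g>0$, $M_{n,g,-g}=1/(2\mathfrak h_n)$ if $n\ge1$ and $M_{0,g,-g}=1/\mathfrak h_0$. Then the integrand is integrable, and $\mathfrak K_{g+\kappa,g}\psi_{n,g}$ is a solution of the non-stationary Lamé equation for $(\kappa,g+\kappa)$ with energy $E_{n,g+\kappa}$. Moreover it is an analytic function of $(x,\tau)$: for $x\in(-\pi,\pi)\setminus\{0\}$ and $\Im\tau>0$ it is the restriction to real $x$ of a holomorphic function of two variables. It is of the Gegenbauer-led form of degree $n$ and coupling $g+\kappa$, with leading term $C_n^{(g+\kappa)}$, and it satisfies $(\mathfrak K_{g+\kappa,g}\psi_{n,g})(\pi-x)=(-1)^n(\mathfrak K_{g+\kappa,g}\psi_{n,g})(x)$ for $x\in[0,\pi]$. -/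

import Mathlib

open Polynomial

noncomputable section

namespace Lame

/-! ### Nome, infinite products and powers of theta functions

Throughout `q = exp(iπτ)` with `0 < Im τ`, and
* `G = ∏_{k ≥ 1} (1 - q^{2k})`,
* `θ₁(x) = G sin x ∏_{k ≥ 1} (1 - 2 q^{2k} cos 2x + q^{4k})`,
* `θ₄(x) = G ∏_{k ≥ 1} (1 - 2 q^{2k-1} cos 2x + q^{4k-2})`.

For real `x` none of the factors, apart from `sin x`, lies on the half-line `(-∞, 0]`.
Real powers of the products are therefore the products of the principal powers of the factors,
that is, the branches which are analytic in `q` and equal to `1` at `q = 0`. -/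

/-- The elliptic nome `q = exp(iπτ)`. -/
def nome (τ : ℂ) : ℂ := Complex.exp (Complex.I * Real.pi * τ)

/-- The constant `η₁/π = 1/12 - 2 ∑_{k ≥ 1} q^{2k} / (1 - q^{2k})²`. -/
def etaOverPi (τ : ℂ) : ℂ :=
  1 / 12 - 2 * ∑' k : ℕ, nome τ ^ (2 * (k + 1)) / (1 - nome τ ^ (2 * (k + 1))) ^ 2

/-- Logarithm of `θ₁(x) / sin x = ∏_{k ≥ 1} (1 - q^{2k}) (1 - 2 q^{2k} cos 2x + q^{4k})`. -/
def logTheta1DivSin (x : ℝ) (τ : ℂ) : ℂ :=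
  ∑' k : ℕ, (Complex.log (1 - nome τ ^ (2 * (k + 1))) +
    Complex.log (1 - 2 * nome τ ^ (2 * (k + 1)) * Complex.cos (2 * x) +
      nome τ ^ (4 * (k + 1))))

/-- Logarithm of `θ₄(x) = ∏_{k ≥ 1} (1 - q^{2k}) (1 - 2 q^{2k-1} cos 2x + q^{4k-2})`. -/
def logTheta4 (x : ℝ) (τ : ℂ) : ℂ :=
  ∑' k : ℕ, (Complex.log (1 - nome τ ^ (2 * (k + 1))) +
    Complex.log (1 - 2 * nome τ ^ (2 * k + 1) * Complex.cos (2 * x) +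
      nome τ ^ (4 * k + 2)))

/-- The power `(θ₁(x)²)^{s/2} = (sin² x)^{s/2} (θ₁(x)/sin x)^s` for real `x`. -/
def theta1SqHalfPow (s : ℝ) (x : ℝ) (τ : ℂ) : ℂ :=
  (((Real.sin x ^ 2) ^ (s / 2) : ℝ) : ℂ) * Complex.exp (s * logTheta1DivSin x τ)

/-- The power `θ₄(x)^s` for real `x`. -/
def theta4Pow (s : ℝ) (x : ℝ) (τ : ℂ) : ℂ :=
  Complex.exp (s * logTheta4 x τ)

/-! ### The non-stationary Lamé equation -/

/-- The periods `π` and `πτ`. -/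
def periods (τ : ℂ) (hτ : 0 < τ.im) : PeriodPair where
  ω₁ := Real.pi
  ω₂ := Real.pi * τ
  indep := by
    rw [LinearIndependent.pair_iff]
    intro s t h
    have him := congrArg Complex.im h
    have hre := congrArg Complex.re h
    simp [Real.pi_ne_zero, hτ.ne'] at him
    subst him
    simp [Real.pi_ne_zero] at hre
    exact ⟨hre, rfl⟩

/-- The energy `E_{n,g} = (n+g)² - 4g(g-1) η₁/π + 6g² (η₁/π - 1/12)`. -/
def energy (n : ℕ) (g : ℝ) (τ : ℂ) : ℂ :=
  ((n : ℂ) + g) ^ 2 - 4 * g * (g - 1) * etaOverPi τ + 6 * (g : ℂ) ^ 2 * (etaOverPi τ - 1 / 12)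

/-- `ψ(x, τ)` is (differentiable and) a solution of the non-stationary Lamé equation
`(2i/π) κ ∂ψ/∂τ - ∂²ψ/∂x² + g(g-1) ℘(x) ψ = E(τ) ψ`, where `℘` has the periods `π` and `πτ`,
for `0 < Im τ` and `x` in `(-π, π)` away from the pole `x = 0` of `℘`. -/
def IsSolution (κ g : ℝ) (E : ℂ → ℂ) (ψ : ℝ → ℂ → ℂ) : Prop :=
  ∀ (τ : ℂ) (hτ : 0 < τ.im), ∀ x ∈ Set.Ioo (-Real.pi) Real.pi, x ≠ 0 →
    DifferentiableAt ℂ (fun t => ψ x t) τ ∧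
    ContDiffAt ℝ 2 (fun s => ψ s τ) x ∧
    2 * Complex.I / Real.pi * κ * deriv (fun t => ψ x t) τ
      - iteratedDeriv 2 (fun s => ψ s τ) x
      + g * (g - 1) * (periods τ hτ).weierstrassP x * ψ x τ = E τ * ψ x τ

/-- `ψ` is an analytic function of `x` and `τ`: away from the branch points `x = 0, ±π` it is the
restriction to real `x` of a function which is holomorphic in two complex variables. -/
def IsJointlyAnalytic (ψ : ℝ → ℂ → ℂ) : Prop :=
  ∃ (U : Set (ℂ × ℂ)) (F : ℂ × ℂ → ℂ), IsOpen U ∧ DifferentiableOn ℂ F U ∧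
    ∀ x ∈ Set.Ioo (-Real.pi) Real.pi, x ≠ 0 → ∀ τ : ℂ, 0 < τ.im →
      ((x : ℂ), τ) ∈ U ∧ F ((x : ℂ), τ) = ψ x τ

/-! ### Gegenbauer polynomials and the form of the solutions -/

/-- The Pochhammer symbol `(a)_n = a (a+1) ⋯ (a+n-1)`. -/
def poch (a : ℝ) (n : ℕ) : ℝ := (ascPochhammer ℝ n).eval a

/-- The Gegenbauer polynomial
`C_n^{(g)}(z) = ∑_{k ≤ n/2} (-1)^k (g)_{n-k} / (k! (n-2k)!) (2z)^{n-2k}` for `g ≠ 0`.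
At `g = 0`, where this sum degenerates to `0` for `n ≥ 1`, the polynomial is renormalized as usual:
`C_n^{(0)}` is the Chebyshev polynomial `T_n`, i.e. `C_n^{(0)}(cos x) = cos(nx)`. -/
def gegenbauer (g : ℝ) (n : ℕ) : ℂ[X] :=
  if g = 0 then Chebyshev.T ℂ n
  else ∑ k ∈ Finset.range (n / 2 + 1),
    C (((-1) ^ k * poch g (n - k) / (k.factorial * (n - 2 * k).factorial) : ℝ) : ℂ) *
      (2 * X) ^ (n - 2 * k)

/-- `ψ(x, τ) = (θ₁(x)²)^{g/2} P(cos x, q)` for `x ∈ [-π, π]`, with `P` holomorphic in two variables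
on a neighbourhood of `[-1, 1] × {|q| < 1}` and
`P(z, q) = C_n^{(g)}(z) + ∑_{ℓ ≥ 1} P^{(ℓ)}(z) q^{2ℓ}`, where `P^{(ℓ)}` is a polynomial of degree at
most `n + 2ℓ`. -/
def HasGegenbauerForm (n : ℕ) (g : ℝ) (ψ : ℝ → ℂ → ℂ) : Prop :=
  ∃ (P : ℂ × ℂ → ℂ) (Ω : Set (ℂ × ℂ)) (p : ℕ → ℂ[X]),
    IsOpen Ω ∧ DifferentiableOn ℂ P Ω ∧
    p 0 = gegenbauer g n ∧ (∀ ℓ, (p ℓ).natDegree ≤ n + 2 * ℓ) ∧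
    (∀ z ∈ Set.Icc (-1 : ℝ) 1, ∀ q : ℂ, ‖q‖ < 1 →
      ((z : ℂ), q) ∈ Ω ∧
      HasSum (fun ℓ : ℕ => (p ℓ).eval (z : ℂ) * q ^ (2 * ℓ)) (P ((z : ℂ), q))) ∧
    ∀ x ∈ Set.Icc (-Real.pi) Real.pi, ∀ τ : ℂ, 0 < τ.im →
      ψ x τ = theta1SqHalfPow g x τ * P (Complex.cos x, nome τ)

/-- `ψ` has the parity of `n` under `x ↦ π - x`, i.e. under `cos x ↦ - cos x`. -/
def HasParity (n : ℕ) (ψ : ℝ → ℂ → ℂ) : Prop :=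
  ∀ x ∈ Set.Icc (0 : ℝ) Real.pi, ∀ τ : ℂ, 0 < τ.im →
    ψ (Real.pi - x) τ = (-1) ^ n * ψ x τ

/-- The pair `(m, ℓ)` is a resonance: the generalized energy difference
`(m+g)² - (n+g)² - 4κℓ = (m-n)(m+n+2g) - 4κℓ` vanishes, `ℓ ≥ 1`. -/
def IsResonance (κ g : ℝ) (n m ℓ : ℕ) : Prop :=
  1 ≤ ℓ ∧ ((m : ℝ) - n) * (m + n + 2 * g) - 4 * κ * ℓ = 0

/-! ### The integral transform -/

/-- `𝔥_n = ∫_{-π}^{π} (sin² y)^g C_n^{(g)}(cos y)² dy/(2π)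
= 2^{1-2g} Γ(n+2g) / (n! (n+g) Γ(g)²)` for `0 < g`. -/
def gegenbauerNorm (n : ℕ) (g : ℝ) : ℝ :=
  (2 : ℝ) ^ (1 - 2 * g) * Real.Gamma (n + 2 * g) / (n.factorial * (n + g) * Real.Gamma g ^ 2)

/-- The normalization `M_{n,g,κ} = (g)_n (g+κ)_n / (n! (2g+κ)_n 𝔥_n)`. When `g = 0` or `g + κ = 0`
the value is the limit which fits the renormalization of the Gegenbauer polynomials at
coupling `0`: these are multiplied by `n / (2g)` for `n ≥ 1` before the limit `g → 0`. -/
def normConst (n : ℕ) (g κ : ℝ) : ℝ :=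
  if g = 0 then 1
  else if g + κ = 0 then (if n = 0 then 1 else 1 / 2) / gegenbauerNorm n g
  else poch g n * poch (g + κ) n / (n.factorial * poch (2 * g + κ) n * gegenbauerNorm n g)

/-- The integrand of the integral transform of `ψ`. -/
def integrand (g κ : ℝ) (ψ : ℝ → ℂ → ℂ) (x : ℝ) (τ : ℂ) (y : ℝ) : ℂ :=
  theta1SqHalfPow (g + κ) x τ * theta1SqHalfPow g y τ /
    (theta4Pow (2 * g + κ) ((x + y) / 2) τ * theta4Pow (2 * g + κ) ((x - y) / 2) τ) * ψ y τ

/-- The integral transform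
`q^{-n} M_{n,g,κ} ∫_{-π}^{π} (dy/2π) (θ₁(x)²)^{(g+κ)/2} (θ₁(y)²)^{g/2} /
(θ₄((x+y)/2) θ₄((x-y)/2))^{2g+κ} ψ(y)`. -/
def transform (n : ℕ) (g κ : ℝ) (ψ : ℝ → ℂ → ℂ) (x : ℝ) (τ : ℂ) : ℂ :=
  (nome τ ^ n)⁻¹ * normConst n g κ *
    ((1 / (2 * Real.pi)) * ∫ y in (-Real.pi)..Real.pi, integrand g κ ψ x τ y)

end Lame

end

/-! Put a = g + κ and b = g, so that κ = a - b and the exponent of the kernel is a + b. Once the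
theta factor is split off, ψ = (θ₁²)^{b/2} P(cos x, q), the Lamé equation says that P is an
eigenfunction of the operator `reducedOp` (`lame_eq_reducedOp`). The function ℘ drops out because it
equals -(log θ₁)'' - 4η₁/π (`weierstrassP_eq`) and because θ₁ satisfies the heat equation, here in
the form `riccati`. The transform is q^{-n} M (θ₁²)^{a/2} R(cos x, q), where R is the `coreIntegral`
of P.

The differential equation for R comes from a kernel function identity: applying the operator for a
in x under the integral and subtracting the expected multiple of the integrand leaves a total
y-derivative (`hasDerivAt_boundary`). Behind this is a single three-term theta identity,
`lambert_three_term`, proved by multiplying Laurent series and comparing coefficients, which are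
related by partial fractions. Integration over a period gives R the eigenvalue (n+b)² + a² - b².
Division by q^n adds 2κn, and the total is (n+a)².

For the form of the transform, expand R in powers of q. The coefficient of q^j is a polynomial in z
of degree at most j. The lowest nonzero coefficient is annihilated by a Gegenbauer operator, which
determines its degree (`gegenbauerOp_taylorCoeff`). An order below n, or a polynomial other than a
multiple of C_n^{(a)} at order n, would produce an excluded resonance (`leading_coefficients`). The
multiple is found by orthogonality: only the coefficient 4^n (a+b)_n / n! of (cos x cos y)^n in the
q^n term of the kernel contributes (`normConst_mul`).

Only the powers q^{n+2ℓ} occur, because the kernel is invariant under (cos x, q) ↦ (-cos x, -q) and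
P has the parity of n. If this parity is not assumed, it follows from the lowest-coefficient
argument applied to the part of P of the wrong parity.

The analysis rests on writing the logarithms of the theta functions as Lambert series in q. They
converge where |q| ρ(z) < 1, with ρ(z) the sum of the semi-axes of the confocal ellipse through z =
cos x; this gives the required neighbourhood of [-1,1] times the disc. -/

open Set Filter Topology

namespace Lame

/-! ### Holomorphic dependence of integrals on parameters -/

section Parametric

/-- Joint continuity means that f(·, y) → f(·, y₀) locally uniformly as y → y₀. By Weierstrass'
theorem the derivatives then converge locally uniformly as well. -/
theorem continuousOn_deriv_of_continuousOn_prod {Y : Type*} [TopologicalSpace Y] {f : ℂ → Y → ℂ}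
    {D : Set ℂ} {K : Set Y} (hD : IsOpen D) (hf : ContinuousOn (fun p : ℂ × Y => f p.1 p.2) (D ×ˢ K))
    (hd : ∀ y ∈ K, DifferentiableOn ℂ (fun q => f q y) D) :
    ContinuousOn (fun p : ℂ × Y => deriv (fun q => f q p.2) p.1) (D ×ˢ K) := by
  rintro ⟨q₀, y₀⟩ ⟨hq₀, hy₀⟩
  have hlim : TendstoLocallyUniformlyOn (fun y q => f q y) (fun q => f q y₀) (𝓝[K] y₀) D := by
    rw [Metric.tendstoLocallyUniformlyOn_iff]
    intro ε hε q hq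
    have h1 := Metric.tendsto_nhds.1 (hf (q, y₀) ⟨hq, hy₀⟩) (ε / 2) (half_pos hε)
    rw [nhdsWithin_prod_eq, eventually_prod_iff] at h1
    obtain ⟨pa, ha, pb, hb, hab⟩ := h1
    refine ⟨{x | pa x}, ha, ?_⟩
    filter_upwards [hb] with y hy q' hq'
    have e1 := hab hq' hy
    have e2 := hab hq' (hb.self_of_nhdsWithin hy₀)
    simp only at e1 e2
    calc dist (f q' y₀) (f q' y) ≤ dist (f q' y₀) (f q y₀) + dist (f q' y) (f q y₀) :=
          dist_triangle_right _ _ _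
      _ < ε := by linarith
  have hder := hlim.deriv (eventually_mem_nhdsWithin.mono fun y hy => hd y hy) hD
  rw [Metric.tendstoLocallyUniformlyOn_iff] at hder
  have hc : ContinuousAt (deriv fun q => f q y₀) q₀ :=
    (((hd y₀ hy₀).deriv hD).differentiableAt (hD.mem_nhds hq₀)).continuousAt
  rw [ContinuousWithinAt, nhdsWithin_prod_eq, Metric.tendsto_nhds]
  intro ε hε
  obtain ⟨t, ht, hty⟩ := hder (ε / 2) (half_pos hε) q₀ hq₀
  have h2 : ∀ᶠ q in 𝓝[D] q₀, dist (deriv (fun q => f q y₀) q) (deriv (fun q => f q y₀) q₀) < ε / 2 :=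
    (Metric.tendsto_nhds.1 hc _ (half_pos hε)).filter_mono nhdsWithin_le_nhds
  have h3 : ∀ᶠ q in 𝓝[D] q₀, q ∈ t := ht
  filter_upwards [(h2.and h3).prod_mk hty] with p hp
  obtain ⟨⟨e1, e2⟩, e3⟩ := hp
  have := e3 p.1 e2
  simp only [Function.comp_apply] at this
  calc _ ≤ dist (deriv (fun q => f q p.2) p.1) (deriv (fun q => f q y₀) p.1)
      + dist (deriv (fun q => f q y₀) p.1) (deriv (fun q => f q y₀) q₀) := dist_triangle _ _ _
    _ < ε := by rw [dist_comm] at this; linarith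

/-- Osgood's lemma: a continuous, separately holomorphic function of two variables is holomorphic. -/
theorem differentiableOn_of_separately {f : ℂ × ℂ → ℂ} {U : Set (ℂ × ℂ)} (hU : IsOpen U)
    (hf : ContinuousOn f U) (h1 : ∀ p ∈ U, DifferentiableAt ℂ (fun z => f (z, p.2)) p.1)
    (h2 : ∀ p ∈ U, DifferentiableAt ℂ (fun q => f (p.1, q)) p.2) : DifferentiableOn ℂ f U := by
  rintro ⟨z₀, q₀⟩ hp
  obtain ⟨A, hA, B, hB, hAB⟩ := mem_nhds_prod_iff.1 (hU.mem_nhds hp)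
  obtain ⟨A', hA', hAo, hzA⟩ := mem_nhds_iff.1 hA
  obtain ⟨B', hB', hBo, hqB⟩ := mem_nhds_iff.1 hB
  have hsub : A' ×ˢ B' ⊆ U := (Set.prod_mono hA' hB').trans hAB
  have hn : A' ×ˢ B' ∈ 𝓝 (z₀, q₀) := (hAo.prod hBo).mem_nhds ⟨hzA, hqB⟩
  have c1 := continuousOn_deriv_of_continuousOn_prod (f := fun z q => f (z, q)) (K := B') hAo
    (hf.mono hsub) (fun q hq z hz => (h1 (z, q) (hsub ⟨hz, hq⟩)).differentiableWithinAt)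
  have c2 := continuousOn_deriv_of_continuousOn_prod (f := fun q z => f (z, q)) (K := A') hBo
    ((hf.mono hsub).comp (by fun_prop : ContinuousOn Prod.swap _) (fun p hp => ⟨hp.2, hp.1⟩))
    (fun z hz q hq => (h2 (z, q) (hsub ⟨hz, hq⟩)).differentiableWithinAt)
  have c2' : ContinuousAt (fun p : ℂ × ℂ => deriv (fun q => f (p.1, q)) p.2) (z₀, q₀) :=
    (c2.comp (by fun_prop : ContinuousOn Prod.swap (A' ×ˢ B'))
      (fun p hp => ⟨hp.2, hp.1⟩)).continuousAt hn
  have c1' := c1.continuousAt hn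
  -- Both partial derivatives are jointly continuous at the point, which gives a total derivative.
  have key := hasStrictFDerivAt_uncurry_coprod (𝕜 := ℂ) (u := (z₀, q₀)) (f := fun z q => f (z, q))
    (f₁ := fun z q => ContinuousLinearMap.toSpanSingleton ℂ (deriv (fun z => f (z, q)) z))
    (f₂ := fun z q => ContinuousLinearMap.toSpanSingleton ℂ (deriv (fun q => f (z, q)) q))
    (by
      filter_upwards [hn] with p hp
      exact (h1 p (hsub hp)).hasDerivAt.hasFDerivAt)
    (by
      filter_upwards [hn] with p hp
      exact (h2 p (hsub hp)).hasDerivAt.hasFDerivAt)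
    ((ContinuousLinearMap.toSpanSingletonCLE (𝕜 := ℂ) (E := ℂ)).continuous.continuousAt.comp c1')
    ((ContinuousLinearMap.toSpanSingletonCLE (𝕜 := ℂ) (E := ℂ)).continuous.continuousAt.comp c2')
  exact key.hasFDerivAt.differentiableAt.differentiableWithinAt

/-- Compactness of [a, b] turns local bounds into one bound near x₀, which serves as the constant
majorant in dominated convergence. -/
theorem eventually_forall_norm_le {X : Type*} [TopologicalSpace X] {f : X → ℝ → ℂ} {U : Set X}
    {a b : ℝ} (hf : ContinuousOn (fun p : X × ℝ => f p.1 p.2) (U ×ˢ Icc a b)) {x₀ : X}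
    (hx₀ : x₀ ∈ U) : ∃ M : ℝ, ∀ᶠ x in 𝓝[U] x₀, ∀ y ∈ Icc a b, ‖f x y‖ ≤ M := by
  have hcx : ContinuousOn (fun y => f x₀ y) (Icc a b) :=
    hf.comp (by fun_prop : ContinuousOn (fun y : ℝ => (x₀, y)) _) (fun y hy => ⟨hx₀, hy⟩)
  obtain ⟨M, hM⟩ := isCompact_Icc.exists_bound_of_continuousOn hcx
  refine ⟨M + 1, ?_⟩
  have : ∀ y ∈ Icc a b, ∃ t ∈ 𝓝[Icc a b] y, ∀ᶠ x in 𝓝[U] x₀, ∀ y' ∈ t, ‖f x y'‖ ≤ M + 1 := by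
    intro y hy
    have h1 := (hf (x₀, y) ⟨hx₀, hy⟩).norm.eventually (gt_mem_nhds (lt_of_le_of_lt (hM y hy)
      (lt_add_one M)))
    rw [nhdsWithin_prod_eq, eventually_prod_iff] at h1
    obtain ⟨pa, ha, pb, hb, hab⟩ := h1
    exact ⟨{y | pb y}, hb, ha.mono fun x hx y' hy' => (hab hx hy').le⟩
  refine isCompact_Icc.induction_on (p := fun t => ∀ᶠ x in 𝓝[U] x₀, ∀ y ∈ t, ‖f x y‖ ≤ M + 1)
    (by simp) (fun s t hst h => h.mono fun x hx y hy => hx y (hst hy))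
    (fun s t hs ht => (hs.and ht).mono fun x hx y hy => hy.elim (hx.1 y) (hx.2 y)) this

theorem continuousOn_intervalIntegral {X : Type*} [TopologicalSpace X] [FirstCountableTopology X]
    {f : X → ℝ → ℂ} {U : Set X} {a b : ℝ} (hab : a ≤ b)
    (hf : ContinuousOn (fun p : X × ℝ => f p.1 p.2) (U ×ˢ Icc a b)) :
    ContinuousOn (fun x => ∫ y in a..b, f x y) U := by
  intro x₀ hx₀
  obtain ⟨M, hM⟩ := eventually_forall_norm_le hf hx₀
  have hsub : Set.uIoc a b ⊆ Icc a b := by rw [uIoc_of_le hab]; exact Ioc_subset_Icc_self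
  refine intervalIntegral.continuousWithinAt_of_dominated_interval (bound := fun _ => M) ?_ ?_
    (by simp) ?_
  · filter_upwards [self_mem_nhdsWithin] with x hx
    have : ContinuousOn (fun y => f x y) (Icc a b) :=
      hf.comp (by fun_prop : ContinuousOn (fun y : ℝ => (x, y)) _) (fun y hy => ⟨hx, hy⟩)
    exact (this.mono hsub).aestronglyMeasurable measurableSet_uIoc
  · filter_upwards [hM] with x hx
    exact Eventually.of_forall fun y hy => hx y (hsub hy)
  · refine Eventually.of_forall fun y hy => ?_
    exact (hf (x₀, y) ⟨hx₀, hsub hy⟩).comp (f := fun x => (x, y))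
      (by fun_prop : ContinuousWithinAt (fun x : X => (x, y)) U x₀) (fun x hx => ⟨hx, hsub hy⟩)

theorem intervalIntegrable_of_continuousOn_prod {X : Type*} [TopologicalSpace X] 
    {f : X → ℝ → ℂ} {U : Set X} {a b : ℝ} (hab : a ≤ b)
    (hf : ContinuousOn (fun p : X × ℝ => f p.1 p.2) (U ×ˢ Icc a b)) {x : X} (hx : x ∈ U) :
    IntervalIntegrable (f x) MeasureTheory.volume a b := by
  have : ContinuousOn (fun y => f x y) (Icc a b) :=
    hf.comp (by fun_prop : ContinuousOn (fun y : ℝ => (x, y)) _) (fun y hy => ⟨hx, hy⟩)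
  exact (this.mono (by rw [uIcc_of_le hab])).intervalIntegrable

theorem hasDerivAt_intervalIntegral {𝕜 : Type*} [RCLike 𝕜] [NormedSpace 𝕜 ℂ]
    {f f' : 𝕜 → ℝ → ℂ} {U : Set 𝕜} {a b : ℝ} (hab : a ≤ b) (hU : IsOpen U)
    (hf : ContinuousOn (fun p : 𝕜 × ℝ => f p.1 p.2) (U ×ˢ Icc a b))
    (hf' : ContinuousOn (fun p : 𝕜 × ℝ => f' p.1 p.2) (U ×ˢ Icc a b))
    (hd : ∀ x ∈ U, ∀ y ∈ Icc a b, HasDerivAt (fun x => f x y) (f' x y) x) {x₀ : 𝕜} (hx₀ : x₀ ∈ U) :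
    HasDerivAt (fun x => ∫ y in a..b, f x y) (∫ y in a..b, f' x₀ y) x₀ := by
  obtain ⟨M, hM⟩ := eventually_forall_norm_le hf' hx₀
  rw [hU.nhdsWithin_eq hx₀] at hM
  have hsub : Set.uIoc a b ⊆ Icc a b := by rw [uIoc_of_le hab]; exact Ioc_subset_Icc_self
  have hs : {x | x ∈ U ∧ ∀ y ∈ Icc a b, ‖f' x y‖ ≤ M} ∈ 𝓝 x₀ := Filter.inter_mem (hU.mem_nhds hx₀) hM
  refine (intervalIntegral.hasDerivAt_integral_of_dominated_loc_of_deriv_le (𝕜 := 𝕜)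
    (bound := fun _ => M) hs ?_ (intervalIntegrable_of_continuousOn_prod hab hf hx₀) ?_ ?_
    (by simp) ?_).2
  · filter_upwards [hU.mem_nhds hx₀] with x hx
    exact (uIoc_of_le hab ▸ (intervalIntegrable_of_continuousOn_prod hab hf hx).1.1 : )
  · exact (uIoc_of_le hab ▸ (intervalIntegrable_of_continuousOn_prod hab hf' hx₀).1.1 : )
  · exact Eventually.of_forall fun y hy _ hx => hx.2 y (hsub hy)
  · exact Eventually.of_forall fun y hy x hx => hd x hx.1 y (hsub hy)

theorem hasDerivAt_intervalIntegral_deriv {f : ℂ → ℝ → ℂ} {U : Set ℂ} {a b : ℝ} (hab : a ≤ b)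
    (hU : IsOpen U) (hf : ContinuousOn (fun p : ℂ × ℝ => f p.1 p.2) (U ×ˢ Icc a b))
    (hd : ∀ y ∈ Icc a b, DifferentiableOn ℂ (fun x => f x y) U) {x₀ : ℂ} (hx₀ : x₀ ∈ U) :
    HasDerivAt (fun x => ∫ y in a..b, f x y) (∫ y in a..b, deriv (fun x => f x y) x₀) x₀ :=
  hasDerivAt_intervalIntegral hab hU hf (continuousOn_deriv_of_continuousOn_prod hU hf hd)
    (fun _ hx y hy => ((hd y hy).differentiableAt (hU.mem_nhds hx)).hasDerivAt) hx₀

/-- By Osgood's lemma it suffices to differentiate under the integral in each complex variable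
separately. -/
theorem differentiableOn_intervalIntegral {f : ℂ × ℂ → ℝ → ℂ} {U : Set (ℂ × ℂ)} {a b : ℝ}
    (hab : a ≤ b) (hU : IsOpen U)
    (hf : ContinuousOn (fun p : (ℂ × ℂ) × ℝ => f p.1 p.2) (U ×ˢ Icc a b))
    (hd : ∀ y ∈ Icc a b, DifferentiableOn ℂ (fun x => f x y) U) :
    DifferentiableOn ℂ (fun p => ∫ y in a..b, f p y) U := by
  refine differentiableOn_of_separately hU (continuousOn_intervalIntegral hab hf) ?_ ?_
  · rintro ⟨z, q⟩ hp
    have hU' : IsOpen ((fun z : ℂ => (z, q)) ⁻¹' U) := hU.preimage (by fun_prop)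
    exact (hasDerivAt_intervalIntegral_deriv (f := fun z y => f (z, q) y) hab hU'
      (hf.comp (by fun_prop : ContinuousOn (fun p : ℂ × ℝ => ((p.1, q), p.2)) _)
        (fun p hp => ⟨hp.1, hp.2⟩))
      (fun y hy => (hd y hy).comp (by fun_prop : DifferentiableOn ℂ (fun z : ℂ => (z, q)) _)
        (fun z hz => hz)) hp).differentiableAt
  · rintro ⟨z, q⟩ hp
    have hU' : IsOpen ((fun q : ℂ => (z, q)) ⁻¹' U) := hU.preimage (by fun_prop)
    exact (hasDerivAt_intervalIntegral_deriv (f := fun q y => f (z, q) y) hab hU'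
      (hf.comp (by fun_prop : ContinuousOn (fun p : ℂ × ℝ => ((z, p.1), p.2)) _)
        (fun p hp => ⟨hp.1, hp.2⟩))
      (fun y hy => (hd y hy).comp (by fun_prop : DifferentiableOn ℂ (fun q : ℂ => (z, q)) _)
        (fun z hz => hz)) hp).differentiableAt

end Parametric

/-! ### Taylor coefficients in the nome -/

section Taylor

/-- The `j`-th Taylor coefficient at `0`. -/
noncomputable def taylorCoeff (f : ℂ → ℂ) (j : ℕ) : ℂ := iteratedDeriv j f 0 / j.factorial

theorem hasSum_taylorCoeff {f : ℂ → ℂ} {r : ℝ} (hf : DifferentiableOn ℂ f (Metric.ball 0 r)) {q : ℂ}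
    (hq : q ∈ Metric.ball 0 r) : HasSum (fun j => taylorCoeff f j * q ^ j) (f q) := by
  refine (Complex.hasSum_taylorSeries_on_ball hf hq).congr_fun fun j => ?_
  simp [taylorCoeff]
  ring

theorem hasFPowerSeriesAt_taylorCoeff {f : ℂ → ℂ} (hf : AnalyticAt ℂ f 0) :
    HasFPowerSeriesAt f (FormalMultilinearSeries.ofScalars ℂ (taylorCoeff f)) 0 :=
  hf.hasFPowerSeriesAt

theorem taylorCoeff_eq_coeff {f : ℂ → ℂ} {p : FormalMultilinearSeries ℂ ℂ ℂ}
    (hp : HasFPowerSeriesAt f p 0) (j : ℕ) : taylorCoeff f j = p.coeff j := by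
  rw [hp.eq_formalMultilinearSeries (hasFPowerSeriesAt_taylorCoeff hp.analyticAt)]
  simp

theorem taylorCoeff_eq_of_hasSum {f : ℂ → ℂ} {a : ℕ → ℂ} {r : ℝ} (hr : 0 < r)
    (h : ∀ q ∈ Metric.ball (0 : ℂ) r, HasSum (fun j => a j * q ^ j) (f q)) (j : ℕ) :
    taylorCoeff f j = a j := by
  have : HasFPowerSeriesAt f (FormalMultilinearSeries.ofScalars ℂ a) 0 := by
    rw [hasFPowerSeriesAt_iff]
    filter_upwards [Metric.ball_mem_nhds (0 : ℂ) hr] with q hq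
    simpa [mul_comm] using h q hq
  simpa using taylorCoeff_eq_coeff this j

theorem taylorCoeff_zero (f : ℂ → ℂ) : taylorCoeff f 0 = f 0 := by simp [taylorCoeff]

theorem taylorCoeff_dslope {f : ℂ → ℂ} (hf : AnalyticAt ℂ f 0) (j : ℕ) :
    taylorCoeff (dslope f 0) j = taylorCoeff f (j + 1) := by
  rw [taylorCoeff_eq_coeff (hasFPowerSeriesAt_taylorCoeff hf).has_fpower_series_dslope_fslope]
  simp

/-- Each vanishing coefficient allows one division by q, carried out with `dslope`. Since `dslope`
is defined everywhere, the factorization holds for all q and not only near 0. -/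
theorem exists_eq_pow_mul_of_taylorCoeff_eq_zero {f : ℂ → ℂ} (hf : AnalyticAt ℂ f 0) {j : ℕ}
    (h : ∀ i < j, taylorCoeff f i = 0) :
    ∃ g : ℂ → ℂ, AnalyticAt ℂ g 0 ∧ (∀ q, f q = q ^ j * g q) ∧ g 0 = taylorCoeff f j := by
  induction j generalizing f with
  | zero => exact ⟨f, hf, by simp, by simp [taylorCoeff_zero]⟩
  | succ j ih =>
    have hd : AnalyticAt ℂ (dslope f 0) 0 :=
      (hasFPowerSeriesAt_taylorCoeff hf).has_fpower_series_dslope_fslope.analyticAt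
    obtain ⟨g, hg, hfg, hg0⟩ := ih hd fun i hi => by
      rw [taylorCoeff_dslope hf]; exact h _ (by omega)
    refine ⟨g, hg, fun q => ?_, by rw [hg0, taylorCoeff_dslope hf]⟩
    have h0 : f 0 = 0 := by rw [← taylorCoeff_zero f]; exact h 0 (by omega)
    have := sub_smul_dslope f 0 q
    rw [h0, sub_zero, sub_zero, hfg, smul_eq_mul] at this
    rw [← this]; ring

/-- Joint continuity and holomorphy of the iterated derivatives are carried through the induction,
since they are what the next differentiation under the integral needs. -/
theorem iteratedDeriv_intervalIntegral {f : ℂ → ℝ → ℂ} {U : Set ℂ} {a b : ℝ} (hab : a ≤ b)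
    (hU : IsOpen U) (hf : ContinuousOn (fun p : ℂ × ℝ => f p.1 p.2) (U ×ˢ Icc a b))
    (hd : ∀ y ∈ Icc a b, DifferentiableOn ℂ (fun x => f x y) U) (n : ℕ) :
    ContinuousOn (fun p : ℂ × ℝ => iteratedDeriv n (fun x => f x p.2) p.1) (U ×ˢ Icc a b) ∧
    (∀ y ∈ Icc a b, DifferentiableOn ℂ (iteratedDeriv n (fun x => f x y)) U) ∧
    ∀ x ∈ U, iteratedDeriv n (fun x => ∫ y in a..b, f x y) x =
      ∫ y in a..b, iteratedDeriv n (fun x => f x y) x := by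
  induction n with
  | zero => exact ⟨by simpa using hf, fun y hy => by simpa using hd y hy, fun x _ => by simp⟩
  | succ n ih =>
    obtain ⟨h1, h2, h3⟩ := ih
    simp only [iteratedDeriv_succ]
    refine ⟨continuousOn_deriv_of_continuousOn_prod hU h1 h2, fun y hy => (h2 y hy).deriv hU,
      fun x hx => ?_⟩
    have : iteratedDeriv n (fun x => ∫ y in a..b, f x y) =ᶠ[𝓝 x]
        fun x => ∫ y in a..b, iteratedDeriv n (fun x => f x y) x := by
      filter_upwards [hU.mem_nhds hx] with x hx using h3 x hx
    rw [this.deriv_eq]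
    exact (hasDerivAt_intervalIntegral_deriv hab hU h1 h2 hx).deriv

theorem taylorCoeff_intervalIntegral {f : ℂ → ℝ → ℂ} {U : Set ℂ} {a b : ℝ} (hab : a ≤ b)
    (hU : IsOpen U) (h0 : (0 : ℂ) ∈ U)
    (hf : ContinuousOn (fun p : ℂ × ℝ => f p.1 p.2) (U ×ˢ Icc a b))
    (hd : ∀ y ∈ Icc a b, DifferentiableOn ℂ (fun x => f x y) U) (n : ℕ) :
    taylorCoeff (fun x => ∫ y in a..b, f x y) n = ∫ y in a..b, taylorCoeff (fun x => f x y) n := by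
  simp only [taylorCoeff]
  rw [(iteratedDeriv_intervalIntegral hab hU hf hd n).2.2 0 h0, intervalIntegral.integral_div]

theorem taylorCoeff_mul {f g : ℂ → ℂ} (hf : AnalyticAt ℂ f 0) (hg : AnalyticAt ℂ g 0) (n : ℕ) :
    taylorCoeff (fun q => f q * g q) n =
      ∑ i ∈ Finset.range (n + 1), taylorCoeff f i * taylorCoeff g (n - i) := by
  simp only [taylorCoeff]
  rw [iteratedDeriv_fun_mul hf.contDiffAt hg.contDiffAt, Finset.sum_div]
  refine Finset.sum_congr rfl fun i hi => ?_
  have hi : i ≤ n := by simpa [Nat.lt_succ_iff] using hi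
  rw [Nat.cast_choose ℂ hi]
  have h1 : (n.factorial : ℂ) ≠ 0 := by exact_mod_cast n.factorial_ne_zero
  field_simp

theorem taylorCoeff_deriv (f : ℂ → ℂ) (n : ℕ) :
    taylorCoeff (deriv f) n = (n + 1) * taylorCoeff f (n + 1) := by
  simp only [taylorCoeff]
  rw [iteratedDeriv_succ', Nat.factorial_succ]
  have h1 : (n.factorial : ℂ) ≠ 0 := by exact_mod_cast n.factorial_ne_zero
  have h2 : ((n : ℂ) + 1) ≠ 0 := by exact_mod_cast n.succ_ne_zero
  push_cast
  field_simp

/-- The recursion for the Taylor coefficients of an exponential. -/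
theorem taylorCoeff_exp_succ {f : ℂ → ℂ} (hf : AnalyticAt ℂ f 0) (n : ℕ) :
    (n + 1) * taylorCoeff (fun q => Complex.exp (f q)) (n + 1) =
      ∑ i ∈ Finset.range (n + 1), (i + 1) * taylorCoeff f (i + 1) *
        taylorCoeff (fun q => Complex.exp (f q)) (n - i) := by
  have he : AnalyticAt ℂ (fun q => Complex.exp (f q)) 0 := hf.cexp
  rw [← taylorCoeff_deriv]
  have : deriv (fun q => Complex.exp (f q)) =ᶠ[𝓝 0] fun q => deriv f q * Complex.exp (f q) := by
    filter_upwards [hf.eventually_analyticAt] with q hq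
    rw [hq.differentiableAt.hasDerivAt.cexp.deriv, mul_comm]
  rw [taylorCoeff, this.iteratedDeriv_eq, ← taylorCoeff, taylorCoeff_mul hf.deriv he]
  exact Finset.sum_congr rfl fun i _ => by rw [taylorCoeff_deriv]

end Taylor

/-! ### Lambert series -/

section Lambert

/-- Coefficients `c m q` holomorphic for `|q| < 1` and of size `O(m^k |q|^m)`. -/
structure IsLambert (c : ℕ → ℂ → ℂ) : Prop where
  differentiableOn : ∀ m, DifferentiableOn ℂ (c m) (Metric.ball 0 1)
  bound : ∀ r < (1 : ℝ), ∃ (C : ℝ) (k : ℕ), 0 ≤ C ∧ ∀ m q, ‖q‖ ≤ r →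
    ‖c m q‖ ≤ C * ((m : ℝ) + 1) ^ k * ‖q‖ ^ m

namespace IsLambert

variable {c d : ℕ → ℂ → ℂ}

theorem add (hc : IsLambert c) (hd : IsLambert d) : IsLambert (fun m q => c m q + d m q) where
  differentiableOn m := (hc.differentiableOn m).add (hd.differentiableOn m)
  bound r hr := by
    obtain ⟨C, k, hC, h⟩ := hc.bound r hr
    obtain ⟨C', k', hC', h'⟩ := hd.bound r hr
    refine ⟨C + C', k + k', by positivity, fun m q hq => (norm_add_le _ _).trans ?_⟩
    have hm : (1 : ℝ) ≤ (m : ℝ) + 1 := by simp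
    calc _ ≤ C * ((m : ℝ) + 1) ^ k * ‖q‖ ^ m + C' * ((m : ℝ) + 1) ^ k' * ‖q‖ ^ m :=
          add_le_add (h m q hq) (h' m q hq)
      _ ≤ C * ((m : ℝ) + 1) ^ (k + k') * ‖q‖ ^ m + C' * ((m : ℝ) + 1) ^ (k + k') * ‖q‖ ^ m := by
          gcongr <;> first | exact hm | omega
      _ = _ := by ring

theorem mul (hc : IsLambert c) (hd : IsLambert d) : IsLambert (fun m q => c m q * d m q) where
  differentiableOn m := (hc.differentiableOn m).mul (hd.differentiableOn m)
  bound r hr := by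
    obtain ⟨C, k, hC, h⟩ := hc.bound r hr
    obtain ⟨C', k', hC', h'⟩ := hd.bound r hr
    refine ⟨C * C', k + k', by positivity, fun m q hq => ?_⟩
    have hq1 : ‖q‖ ^ m ≤ 1 := pow_le_one₀ (norm_nonneg _) (hq.trans hr.le)
    rw [norm_mul]
    calc _ ≤ (C * ((m : ℝ) + 1) ^ k * ‖q‖ ^ m) * (C' * ((m : ℝ) + 1) ^ k' * ‖q‖ ^ m) := by
          gcongr
          · exact h m q hq
          · exact h' m q hq
      _ ≤ (C * ((m : ℝ) + 1) ^ k * ‖q‖ ^ m) * (C' * ((m : ℝ) + 1) ^ k' * 1) := by gcongr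
      _ = _ := by ring

theorem weight (hc : IsLambert c) {w : ℕ → ℂ} {k : ℕ} (hw : ∀ m, ‖w m‖ ≤ ((m : ℝ) + 1) ^ k) :
    IsLambert (fun m q => w m * c m q) where
  differentiableOn m := (hc.differentiableOn m).const_mul _
  bound r hr := by
    obtain ⟨C, k', hC, h⟩ := hc.bound r hr
    refine ⟨C, k + k', hC, fun m q hq => ?_⟩
    rw [norm_mul]
    calc _ ≤ ((m : ℝ) + 1) ^ k * (C * ((m : ℝ) + 1) ^ k' * ‖q‖ ^ m) := by
          gcongr
          · exact hw m
          · exact h m q hq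
      _ = _ := by ring

theorem natCast_mul (hc : IsLambert c) : IsLambert (fun m q => m * c m q) :=
  hc.weight (k := 1) fun m => by simp

theorem div_natCast (hc : IsLambert c) : IsLambert (fun m q => c m q / m) := by
  have := hc.weight (w := fun m => (m : ℂ)⁻¹) (k := 0) fun m => by
    rcases m with _ | m
    · simp
    · simp only [norm_inv, pow_zero, Complex.norm_natCast]
      exact inv_le_one_of_one_le₀ (by simp)
  simpa only [div_eq_inv_mul] using this

theorem const_mul (hc : IsLambert c) (a : ℂ) : IsLambert (fun m q => a * c m q) where
  differentiableOn m := (hc.differentiableOn m).const_mul _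
  bound r hr := by
    obtain ⟨C, k', hC, h⟩ := hc.bound r hr
    refine ⟨‖a‖ * C, k', by positivity, fun m q hq => ?_⟩
    rw [norm_mul, mul_assoc, mul_assoc, ← mul_assoc C]
    gcongr
    exact h m q hq

/-- One majorant for the whole region |q| ≤ r, |q|ρ ≤ R. All termwise limits and derivatives below
are justified by it. -/
theorem exists_summable_bound (hc : IsLambert c) {R r : ℝ} (hr : r < 1) (hR0 : 0 ≤ R) (hR : R < 1) :
    ∃ u : ℕ → ℝ, Summable u ∧ ∀ m (q : ℂ) (ρ : ℝ) (e : ℂ), ‖q‖ ≤ r → 0 ≤ ρ → ‖q‖ * ρ ≤ R →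
      ‖e‖ ≤ ρ ^ m → ‖c m q * e‖ ≤ u m := by
  obtain ⟨C, k, hC, h⟩ := hc.bound r hr
  refine ⟨fun m => C * (((m : ℝ) + 1) ^ k * R ^ m), Summable.mul_left _ ?_, ?_⟩
  -- The majorant comes from (m+1)^k R^{m+1} after division by R, so R = 0 is treated apart.
  · rcases hR0.eq_or_lt with rfl | hR0
    · refine summable_of_ne_finset_zero (s := {0}) fun m hm => ?_
      have : m ≠ 0 := by simpa using hm
      simp [this]
    have := (summable_nat_add_iff 1).2 (summable_pow_mul_geometric_of_norm_lt_one (R := ℝ) k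
      (r := R) (by rwa [Real.norm_of_nonneg hR0.le]))
    refine (this.mul_left R⁻¹).congr fun m => ?_
    push_cast
    field_simp
    ring
  · intro m q ρ e hq hρ hqR he
    rw [norm_mul]
    calc _ ≤ (C * ((m : ℝ) + 1) ^ k * ‖q‖ ^ m) * ρ ^ m := by
          gcongr
          exact h m q hq
      _ = C * ((m : ℝ) + 1) ^ k * (‖q‖ * ρ) ^ m := by rw [mul_pow]; ring
      _ ≤ C * ((m : ℝ) + 1) ^ k * R ^ m := by gcongr
      _ = _ := by ring

theorem summable (hc : IsLambert c) {q : ℂ} {ρ : ℝ} {e : ℕ → ℂ} (hq : ‖q‖ < 1) (hρ : 0 ≤ ρ)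
    (hqρ : ‖q‖ * ρ < 1) (he : ∀ m, ‖e m‖ ≤ ρ ^ m) : Summable (fun m => c m q * e m) := by
  obtain ⟨u, hu, h⟩ := hc.exists_summable_bound hq (by positivity : 0 ≤ ‖q‖ * ρ) hqρ
  exact Summable.of_norm_bounded hu fun m => h m q ρ (e m) le_rfl hρ le_rfl (he m)

theorem summable_one (hc : IsLambert c) {q : ℂ} (hq : ‖q‖ < 1) : Summable (fun m => c m q) := by
  simpa using hc.summable (ρ := 1) (e := fun _ => 1) hq zero_le_one (by simpa using hq) (by simp)

theorem continuousOn {Z : Type*} [TopologicalSpace Z] (hc : IsLambert c) {e : ℕ → Z → ℂ} {ρ : Z → ℝ}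
    (he : ∀ m, Continuous (e m)) (hρ : Continuous ρ) (hρ0 : ∀ ζ, 0 ≤ ρ ζ)
    (hb : ∀ m ζ, ‖e m ζ‖ ≤ ρ ζ ^ m) :
    ContinuousOn (fun p : ℂ × Z => ∑' m, c m p.1 * e m p.2) {p | ‖p.1‖ < 1 ∧ ‖p.1‖ * ρ p.2 < 1} := by
  rintro ⟨q₀, ζ₀⟩ ⟨h1, h2⟩
  obtain ⟨r, hr, hr1⟩ := exists_between h1
  obtain ⟨R, hR, hR1⟩ := exists_between h2
  have hR0 : 0 ≤ R := (mul_nonneg (norm_nonneg _) (hρ0 _)).trans hR.le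
  obtain ⟨u, hu, h⟩ := hc.exists_summable_bound hr1 hR0 hR1
  have ho : IsOpen {p : ℂ × Z | ‖p.1‖ < r ∧ ‖p.1‖ * ρ p.2 < R} :=
    IsOpen.and (isOpen_lt (by fun_prop) (by fun_prop)) (isOpen_lt (by fun_prop) (by fun_prop))
  have : ContinuousOn (fun p : ℂ × Z => ∑' m, c m p.1 * e m p.2)
      {p | ‖p.1‖ < r ∧ ‖p.1‖ * ρ p.2 < R} := by
    refine continuousOn_tsum (fun m => ?_) hu fun m p hp => h m p.1 (ρ p.2) _ hp.1.le (hρ0 _) hp.2.le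
      (hb m _)
    refine ContinuousOn.mul ?_ (by fun_prop)
    refine (hc.differentiableOn m).continuousOn.comp continuousOn_fst fun p hp => ?_
    simpa using hp.1.trans hr1
  exact (this.continuousAt (ho.mem_nhds ⟨hr, hR⟩)).continuousWithinAt

theorem hasDerivAt_nome (hc : IsLambert c) {q : ℂ} {ρ : ℝ} {e : ℕ → ℂ} (hq : ‖q‖ < 1)
    (hρ : 0 ≤ ρ) (hqρ : ‖q‖ * ρ < 1) (he : ∀ m, ‖e m‖ ≤ ρ ^ m) :
    HasDerivAt (fun q => ∑' m, c m q * e m) (∑' m, deriv (c m) q * e m) q := by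
  obtain ⟨r, hr, hr1⟩ := exists_between hq
  obtain ⟨R, hR, hR1⟩ := exists_between hqρ
  have hR0 : 0 ≤ R := (mul_nonneg (norm_nonneg _) hρ).trans hR.le
  obtain ⟨u, hu, h⟩ := hc.exists_summable_bound hr1 hR0 hR1
  have ho : IsOpen {p : ℂ | ‖p‖ < r ∧ ‖p‖ * ρ < R} :=
    IsOpen.and (isOpen_lt (by fun_prop) (by fun_prop)) (isOpen_lt (by fun_prop) (by fun_prop))
  have hd : ∀ m, DifferentiableOn ℂ (fun q => c m q * e m) {p : ℂ | ‖p‖ < r ∧ ‖p‖ * ρ < R} :=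
    fun m => ((hc.differentiableOn m).mono fun p hp => by simpa using hp.1.trans hr1).mul_const _
  have hb := fun m (p : ℂ) (hp : p ∈ {p : ℂ | ‖p‖ < r ∧ ‖p‖ * ρ < R}) =>
    h m p ρ (e m) hp.1.le hρ hp.2.le (he m)
  have h1 := (Complex.differentiableOn_tsum_of_summable_norm hu hd ho hb).differentiableAt
    (ho.mem_nhds ⟨hr, hR⟩)
  have h2 := Complex.hasSum_deriv_of_summable_norm hu hd ho hb
    (show q ∈ {p : ℂ | ‖p‖ < r ∧ ‖p‖ * ρ < R} from ⟨hr, hR⟩)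
  have h3 : ∀ m, deriv (fun q => c m q * e m) q = deriv (c m) q * e m := fun m =>
    deriv_mul_const (((hc.differentiableOn m).differentiableAt
      (Metric.isOpen_ball.mem_nhds (by simpa using hq)))) _
  simp only [h3] at h2
  rw [h2.tsum_eq]
  exact h1.hasDerivAt

/-- Meant for cos(mζ) and sin(mζ): the factor m of the derivative is moved into the coefficient, so
that the result is a Lambert series again. -/
theorem hasDerivAt_param (hc : IsLambert c) {q : ℂ} {e e' : ℕ → ℂ → ℂ} {ρ : ℂ → ℝ}
    (hρ : Continuous ρ) (hρ0 : ∀ ζ, 0 ≤ ρ ζ) (hb : ∀ m ζ, ‖e m ζ‖ ≤ ρ ζ ^ m)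
    (hd : ∀ m ζ, HasDerivAt (e m) (m * e' m ζ) ζ) {z : ℂ} (hq : ‖q‖ < 1) (hz : ‖q‖ * ρ z < 1) :
    HasDerivAt (fun ζ => ∑' m, c m q * e m ζ) (∑' m, m * c m q * e' m z) z := by
  obtain ⟨R, hR, hR1⟩ := exists_between hz
  have hR0 : 0 ≤ R := (mul_nonneg (norm_nonneg _) (hρ0 _)).trans hR.le
  obtain ⟨u, hu, h⟩ := hc.exists_summable_bound hq hR0 hR1
  have ho : IsOpen {ζ : ℂ | ‖q‖ * ρ ζ < R} := isOpen_lt (by fun_prop) (by fun_prop)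
  have hd' : ∀ m, DifferentiableOn ℂ (fun ζ => c m q * e m ζ) {ζ : ℂ | ‖q‖ * ρ ζ < R} :=
    fun m ζ _ => ((hd m ζ).differentiableAt.const_mul _).differentiableWithinAt
  have hb' := fun m (ζ : ℂ) (hζ : ζ ∈ {ζ : ℂ | ‖q‖ * ρ ζ < R}) =>
    h m q (ρ ζ) (e m ζ) le_rfl (hρ0 _) (le_of_lt hζ) (hb m ζ)
  have h1 := (Complex.differentiableOn_tsum_of_summable_norm hu hd' ho hb').differentiableAt
    (ho.mem_nhds hR)
  have h2 := Complex.hasSum_deriv_of_summable_norm hu hd' ho hb'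
    (show z ∈ {ζ : ℂ | ‖q‖ * ρ ζ < R} from hR)
  have h3 : ∀ m, deriv (fun ζ => c m q * e m ζ) z = m * c m q * e' m z := fun m => by
    rw [((hd m z).const_mul _).deriv]; ring
  simp only [h3] at h2
  rw [h2.tsum_eq]
  exact h1.hasDerivAt

end IsLambert

/-- `q^m / (1 - q^{2m})`, which is `0` for `m = 0`. -/
noncomputable def lamS (m : ℕ) (q : ℂ) : ℂ := q ^ m / (1 - q ^ (2 * m))

/-- `q^{2m} / (1 - q^{2m})`, which is `0` for `m = 0`. -/
noncomputable def lamT (m : ℕ) (q : ℂ) : ℂ := q ^ (2 * m) / (1 - q ^ (2 * m))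

theorem one_sub_pow_ne_zero {q : ℂ} (hq : ‖q‖ < 1) {m : ℕ} (hm : m ≠ 0) : 1 - q ^ m ≠ 0 := by
  intro h
  have : ‖q ^ m‖ = 1 := by rw [← sub_eq_zero.1 h]; simp
  rw [norm_pow] at this
  exact (pow_lt_one₀ (norm_nonneg _) hq hm).ne this

theorem isLambert_lamS : IsLambert lamS where
  differentiableOn m := by
    rcases eq_or_ne m 0 with rfl | hm
    · have : lamS 0 = fun _ => 0 := by funext; simp [lamS]
      rw [this]
      exact differentiableOn_const _
    · intro q hq
      have hq : ‖q‖ < 1 := by simpa using hq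
      have := one_sub_pow_ne_zero hq (by omega : 2 * m ≠ 0)
      exact DifferentiableAt.differentiableWithinAt (by unfold lamS; fun_prop (disch := assumption))
  bound r hr := by
    rcases lt_or_ge r 0 with h0 | h0
    · exact ⟨0, 0, le_rfl, fun m q hq => absurd ((norm_nonneg q).trans hq) (not_le.2 h0)⟩
    refine ⟨(1 - r)⁻¹, 0, by simpa using hr.le, fun m q hq => ?_⟩
    have h1r : 0 < 1 - r := by linarith
    rcases eq_or_ne m 0 with rfl | hm
    · simpa [lamS] using hr.le
    have h2 : 1 - r ≤ ‖1 - q ^ (2 * m)‖ := by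
      have h3 := norm_sub_norm_le (1 : ℂ) (q ^ (2 * m))
      rw [norm_one, norm_pow] at h3
      have h4 : ‖q‖ ^ (2 * m) ≤ r := (pow_le_of_le_one (norm_nonneg _) (hq.trans hr.le)
        (by omega)).trans hq
      linarith
    simp only [lamS, norm_div, norm_pow, pow_zero, mul_one]
    rw [div_eq_inv_mul]
    gcongr

theorem isLambert_pow : IsLambert (fun m q => q ^ m) where
  differentiableOn m := by fun_prop
  bound r _ := ⟨1, 0, zero_le_one, fun m q _ => by simp⟩

theorem lamT_eq (m : ℕ) (q : ℂ) : lamT m q = q ^ m * lamS m q := by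
  simp only [lamT, lamS]; ring

theorem isLambert_lamT : IsLambert lamT := by
  simpa only [← lamT_eq] using isLambert_pow.mul isLambert_lamS

/-- The factor m cancels the 1/m in the series of log θ₄, so that q ∂_q of the logarithm has
coefficients without denominators. `mul_deriv_lamT` does the same for θ₁. -/
theorem mul_deriv_lamS {m : ℕ} {q : ℂ} (hq : ‖q‖ < 1) :
    q * deriv (lamS m) q = m * (lamS m q * (1 + 2 * lamT m q)) := by
  rcases eq_or_ne m 0 with rfl | hm
  · have : lamS 0 = fun _ => 0 := by funext; simp [lamS]
    simp [this]
  have h := one_sub_pow_ne_zero hq (by omega : 2 * m ≠ 0)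
  obtain ⟨k, rfl⟩ := Nat.exists_eq_succ_of_ne_zero hm
  have h1 : HasDerivAt (lamS (k + 1)) _ q := (hasDerivAt_pow (k + 1) q).div
    ((hasDerivAt_pow (2 * (k + 1)) q).const_sub 1) h
  rw [Nat.succ_eq_add_one, h1.deriv]
  simp only [lamS, lamT]
  field_simp
  rw [show 2 * (k + 1) - 1 = 2 * k + 1 by omega, show k + 1 - 1 = k by omega]
  push_cast
  ring

theorem mul_deriv_lamT {m : ℕ} {q : ℂ} (hq : ‖q‖ < 1) :
    q * deriv (lamT m) q = 2 * m * lamS m q ^ 2 := by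
  rcases eq_or_ne m 0 with rfl | hm
  · have : lamT 0 = fun _ => 0 := by funext; simp [lamT]
    simp [this]
  have h := one_sub_pow_ne_zero hq (by omega : 2 * m ≠ 0)
  obtain ⟨k, rfl⟩ := Nat.exists_eq_succ_of_ne_zero hm
  have h1 : HasDerivAt (lamT (k + 1)) _ q := (hasDerivAt_pow (2 * (k + 1)) q).div
    ((hasDerivAt_pow (2 * (k + 1)) q).const_sub 1) h
  rw [Nat.succ_eq_add_one, h1.deriv]
  simp only [lamS]
  field_simp
  rw [show 2 * (k + 1) - 1 = 2 * k + 1 by omega]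
  push_cast
  ring

theorem lamS_neg (m : ℕ) (q : ℂ) : lamS m (-q) = (-1) ^ m * lamS m q := by
  simp only [lamS, (even_two_mul m).neg_pow]
  rw [neg_pow]; ring

theorem lamT_neg (m : ℕ) (q : ℂ) : lamT m (-q) = lamT m q := by
  simp only [lamT, (even_two_mul m).neg_pow]

theorem norm_cos_le (z : ℂ) : ‖Complex.cos z‖ ≤ Real.exp |z.im| := by
  rw [Complex.cos, norm_div, Complex.norm_two, div_le_iff₀ two_pos]
  refine (norm_add_le _ _).trans ?_
  rw [Complex.norm_exp, Complex.norm_exp]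
  have h1 : (z * Complex.I).re ≤ |z.im| := by simpa using neg_le_abs z.im
  have h2 : (-z * Complex.I).re ≤ |z.im| := by simpa using le_abs_self z.im
  linarith [Real.exp_le_exp.2 h1, Real.exp_le_exp.2 h2]

theorem norm_sin_le (z : ℂ) : ‖Complex.sin z‖ ≤ Real.exp |z.im| := by
  rw [Complex.sin, norm_div, norm_mul, Complex.norm_two, div_le_iff₀ two_pos, Complex.norm_I, mul_one]
  refine (norm_sub_le _ _).trans ?_
  rw [Complex.norm_exp, Complex.norm_exp]
  have h1 : (z * Complex.I).re ≤ |z.im| := by simpa using neg_le_abs z.im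
  have h2 : (-z * Complex.I).re ≤ |z.im| := by simpa using le_abs_self z.im
  linarith [Real.exp_le_exp.2 h1, Real.exp_le_exp.2 h2]

theorem norm_cos_nat_mul_le (m : ℕ) (z : ℂ) : ‖Complex.cos (m * z)‖ ≤ Real.exp |z.im| ^ m := by
  rw [← Real.exp_nat_mul]
  refine (norm_cos_le _).trans (le_of_eq ?_)
  simp [abs_mul]

theorem norm_sin_nat_mul_le (m : ℕ) (z : ℂ) : ‖Complex.sin (m * z)‖ ≤ Real.exp |z.im| ^ m := by
  rw [← Real.exp_nat_mul]
  refine (norm_sin_le _).trans (le_of_eq ?_)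
  simp [abs_mul]

end Lambert

/-! ### The three-term identity -/

section LambertIdentities

/-- `∑ c_m(q) cos (m α)`. -/
noncomputable def lamCos (c : ℕ → ℂ → ℂ) (α q : ℂ) : ℂ := ∑' m : ℕ, c m q * Complex.cos (m * α)

/-- `∑ c_m(q) sin (m α)`. -/
noncomputable def lamSin (c : ℕ → ℂ → ℂ) (α q : ℂ) : ℂ := ∑' m : ℕ, c m q * Complex.sin (m * α)

variable {c : ℕ → ℂ → ℂ} {q α β : ℂ}

theorem IsLambert.hasSum_lamCos (hc : IsLambert c) (hq : ‖q‖ < 1)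
    (hα : ‖q‖ * Real.exp |α.im| < 1) :
    HasSum (fun m : ℕ => c m q * Complex.cos (m * α)) (lamCos c α q) :=
  (hc.summable hq (Real.exp_pos _).le hα fun m => norm_cos_nat_mul_le m α).hasSum

theorem IsLambert.hasSum_lamSin (hc : IsLambert c) (hq : ‖q‖ < 1)
    (hα : ‖q‖ * Real.exp |α.im| < 1) :
    HasSum (fun m : ℕ => c m q * Complex.sin (m * α)) (lamSin c α q) :=
  (hc.summable hq (Real.exp_pos _).le hα fun m => norm_sin_nat_mul_le m α).hasSum

theorem IsLambert.summable_exp (hc : IsLambert c) (hq : ‖q‖ < 1)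
    (hα : ‖q‖ * Real.exp |α.im| < 1) :
    Summable (fun m : ℕ => c m q * Complex.exp (Complex.I * α) ^ m) := by
  refine hc.summable hq (Real.exp_pos _).le hα fun m => ?_
  rw [norm_pow, Complex.norm_exp]
  gcongr
  simpa using neg_le_abs α.im

theorem IsLambert.summable_exp_inv (hc : IsLambert c) (hq : ‖q‖ < 1)
    (hα : ‖q‖ * Real.exp |α.im| < 1) :
    Summable (fun m : ℕ => c m q * (Complex.exp (Complex.I * α))⁻¹ ^ m) := by
  have := hc.summable_exp (α := -α) hq (by simpa using hα)
  rwa [mul_neg, Complex.exp_neg] at this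

theorem two_mul_cos_nat_mul (m : ℕ) (α : ℂ) : 2 * Complex.cos (m * α) =
    Complex.exp (Complex.I * α) ^ m + (Complex.exp (Complex.I * α))⁻¹ ^ m := by
  rw [← Complex.exp_neg, ← Complex.exp_nat_mul, ← Complex.exp_nat_mul, Complex.cos]
  ring_nf

theorem two_I_mul_sin_nat_mul (m : ℕ) (α : ℂ) : 2 * Complex.I * Complex.sin (m * α) =
    Complex.exp (Complex.I * α) ^ m - (Complex.exp (Complex.I * α))⁻¹ ^ m := by
  rw [← Complex.exp_neg, ← Complex.exp_nat_mul, ← Complex.exp_nat_mul, Complex.sin]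
  have : ∀ z : ℂ, 2 * Complex.I * (z * Complex.I / 2) = -z := fun z => by
    linear_combination z * Complex.I_mul_I
  rw [this]
  ring_nf

/-- A one-sided trigonometric series becomes a Laurent series in e^{iα}, with ε = 1 for cosines and
ε = -1 for sines. The index 0 would be counted twice, hence the condition that its coefficient
vanishes. -/
theorem IsLambert.hasSum_int (hc : IsLambert c) (hq : ‖q‖ < 1)
    (hα : ‖q‖ * Real.exp |α.im| < 1) {f : ℤ → ℂ} {ε : ℂ} (h0 : c 0 q = 0)
    (hf : ∀ n : ℕ, f n = c n q) (hf' : ∀ n : ℕ, f (-n) = ε * c n q) :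
    HasSum (fun j : ℤ => f j * Complex.exp (Complex.I * α) ^ j)
      (∑' m : ℕ, (c m q * Complex.exp (Complex.I * α) ^ m +
        ε * (c m q * (Complex.exp (Complex.I * α))⁻¹ ^ m))) := by
  have h1 := (hc.summable_exp hq hα).hasSum
  have h2 := ((hc.summable_exp_inv hq hα).hasSum.mul_left ε)
  rw [(h1.add h2).tsum_eq]
  refine HasSum.of_nat_of_neg_add_one (by simpa [hf] using h1) ?_
  replace h2 := (hasSum_nat_add_iff' 1).2 h2
  simp only [Finset.range_one, Finset.sum_singleton, h0, zero_mul, mul_zero, sub_zero] at h2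
  refine h2.congr_fun fun n => ?_
  have h := hf' (n + 1)
  push_cast at h
  rw [h, zpow_neg, inv_pow]
  norm_cast
  ring

theorem IsLambert.hasSum_int_even (hc : IsLambert c) (hq : ‖q‖ < 1)
    (hα : ‖q‖ * Real.exp |α.im| < 1) {f : ℤ → ℂ} (h0 : c 0 q = 0)
    (hf : ∀ n : ℕ, f n = c n q) (hf' : ∀ n : ℕ, f (-n) = c n q) :
    HasSum (fun j : ℤ => f j * Complex.exp (Complex.I * α) ^ j) (2 * lamCos c α q) := by
  convert! hc.hasSum_int (ε := 1) hq hα h0 hf (by simpa using hf') using 1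
  rw [← ((hc.hasSum_lamCos hq hα).mul_left 2).tsum_eq]
  exact tsum_congr fun m => by linear_combination c m q * two_mul_cos_nat_mul m α

theorem IsLambert.hasSum_int_odd (hc : IsLambert c) (hq : ‖q‖ < 1)
    (hα : ‖q‖ * Real.exp |α.im| < 1) {f : ℤ → ℂ} (h0 : c 0 q = 0)
    (hf : ∀ n : ℕ, f n = c n q) (hf' : ∀ n : ℕ, f (-n) = -c n q) :
    HasSum (fun j : ℤ => f j * Complex.exp (Complex.I * α) ^ j)
      (2 * Complex.I * lamSin c α q) := by
  convert! hc.hasSum_int (ε := -1) hq hα h0 hf (by simpa using hf') using 1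
  rw [← ((hc.hasSum_lamSin hq hα).mul_left (2 * Complex.I)).tsum_eq]
  exact tsum_congr fun m => by linear_combination c m q * two_I_mul_sin_nat_mul m α

/-- `q^j / (1 - q^{2j})` for integral `j`, which is `0` for `j = 0`. -/
noncomputable def zS (q : ℂ) (j : ℤ) : ℂ := q ^ j / (1 - (q ^ j) ^ 2)

/-- `1 / (1 - q^{2j})` for integral `j`, which is `0` for `j = 0`. -/
noncomputable def zR (q : ℂ) (j : ℤ) : ℂ := 1 / (1 - (q ^ j) ^ 2)

theorem zS_zero : zS q 0 = 0 := by simp [zS]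
theorem zR_zero : zR q 0 = 0 := by simp [zR]

theorem one_sub_zpow_sq_ne_zero (hq : ‖q‖ < 1) (hq0 : q ≠ 0) {j : ℤ} (hj : j ≠ 0) :
    1 - (q ^ j) ^ 2 ≠ 0 := by
  have key : ∀ n : ℕ, n ≠ 0 → 1 - (q ^ (n : ℤ)) ^ 2 ≠ 0 := fun n hn => by
    rw [zpow_natCast, ← pow_mul]
    exact one_sub_pow_ne_zero hq (by omega)
  rcases Int.eq_nat_or_neg j with ⟨n, rfl | rfl⟩
  · exact key n (by simpa using hj)
  · have h := key n (by simpa using hj)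
    have h1 : q ^ (n : ℤ) ≠ 0 := zpow_ne_zero _ hq0
    rw [zpow_neg]
    intro h2
    apply h
    field_simp at h2
    linear_combination -h2

theorem zS_natCast (n : ℕ) : zS q n = lamS n q := by
  simp [zS, lamS, ← pow_mul, mul_comm]

theorem zS_neg (hq : ‖q‖ < 1) (hq0 : q ≠ 0) (j : ℤ) : zS q (-j) = -zS q j := by
  rcases eq_or_ne j 0 with rfl | hj
  · simp [zS]
  have h1 := one_sub_zpow_sq_ne_zero hq hq0 hj
  have h2 := one_sub_zpow_sq_ne_zero hq hq0 (neg_ne_zero.2 hj)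
  have h3 : q ^ j ≠ 0 := zpow_ne_zero _ hq0
  simp only [zS, zpow_neg] at *
  rw [div_eq_iff h2]
  field_simp
  ring

theorem zR_neg (hq : ‖q‖ < 1) (hq0 : q ≠ 0) {j : ℤ} (hj : j ≠ 0) : zR q (-j) = 1 - zR q j := by
  have h1 := one_sub_zpow_sq_ne_zero hq hq0 hj
  have h2 := one_sub_zpow_sq_ne_zero hq hq0 (neg_ne_zero.2 hj)
  have h3 : q ^ j ≠ 0 := zpow_ne_zero _ hq0
  simp only [zR, zpow_neg] at *
  rw [div_eq_iff h2]
  field_simp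
  ring

theorem zR_natCast (hq : ‖q‖ < 1) {n : ℕ} (hn : n ≠ 0) : zR q n = 1 + lamT n q := by
  have := one_sub_pow_ne_zero hq (by omega : 2 * n ≠ 0)
  simp only [zR, lamT, zpow_natCast, ← pow_mul, mul_comm n 2]
  field_simp
  ring

theorem zR_mul_one_sub (hq : ‖q‖ < 1) (hq0 : q ≠ 0) (j : ℤ) :
    zR q j * (1 - zR q j) = -zS q j ^ 2 := by
  rcases eq_or_ne j 0 with rfl | hj
  · simp [zS, zR]
  have h1 := one_sub_zpow_sq_ne_zero hq hq0 hj
  simp only [zR, zS]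
  field_simp
  ring

/-- A partial fraction identity in q^j and q^k. It is the algebraic core of the three-term identity.
-/
theorem zS_mul_zS (hq : ‖q‖ < 1) (hq0 : q ≠ 0) {j k : ℤ} (hj : j ≠ 0) (hk : k ≠ 0) (hjk : j ≠ k) :
    zS q j * zS q k = zR q k * zS q (j - k) + zR q j * zS q (k - j) := by
  rw [← neg_sub j k, zS_neg hq hq0]
  have h1 := one_sub_zpow_sq_ne_zero hq hq0 hj
  have h2 := one_sub_zpow_sq_ne_zero hq hq0 hk
  have h3 := one_sub_zpow_sq_ne_zero hq hq0 (sub_ne_zero.2 hjk)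
  have hj0 : q ^ j ≠ 0 := zpow_ne_zero _ hq0
  have hk0 : q ^ k ≠ 0 := zpow_ne_zero _ hq0
  simp only [zR, zS, zpow_sub₀ hq0] at *
  generalize q ^ j = a at *
  generalize q ^ k = b at *
  have h4 : b ^ 2 - a ^ 2 ≠ 0 := by
    intro h
    apply h3
    field_simp
    linear_combination h
  have h5 : 1 - (a / b) ^ 2 = (b ^ 2 - a ^ 2) / b ^ 2 := by field_simp
  rw [h5]
  field_simp
  ring

/-- The analogous partial fractions for the Riccati identity: the product becomes a difference,
whose sum over l telescopes. -/
theorem zR_mul_zR (hq : ‖q‖ < 1) (hq0 : q ≠ 0) {j l : ℤ} (hj : j ≠ 0) (hl : l ≠ 0) (hjl : l ≠ j) :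
    zR q l * zR q (j - l) = zR q j * (zR q l - zR q (l - j)) := by
  have h1 := one_sub_zpow_sq_ne_zero hq hq0 hj
  have h2 := one_sub_zpow_sq_ne_zero hq hq0 hl
  have h3 := one_sub_zpow_sq_ne_zero hq hq0 (sub_ne_zero.2 hjl)
  rw [← neg_sub l j, zR_neg hq hq0 (sub_ne_zero.2 hjl)]
  have hj0 : q ^ j ≠ 0 := zpow_ne_zero _ hq0
  have hk0 : q ^ l ≠ 0 := zpow_ne_zero _ hq0
  simp only [zR, zpow_sub₀ hq0] at *
  generalize q ^ j = a at *
  generalize q ^ l = b at *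
  have h4 : a ^ 2 - b ^ 2 ≠ 0 := by
    intro h
    apply h3
    field_simp
    linear_combination h
  have h5 : 1 - (b / a) ^ 2 = (a ^ 2 - b ^ 2) / a ^ 2 := by field_simp
  rw [h5]
  field_simp
  ring

theorem hasSum_zS (hq : ‖q‖ < 1) (hq0 : q ≠ 0) (hα : ‖q‖ * Real.exp |α.im| < 1) :
    HasSum (fun j : ℤ => zS q j * Complex.exp (Complex.I * α) ^ j)
      (2 * Complex.I * lamSin lamS α q) :=
  isLambert_lamS.hasSum_int_odd hq hα (by simp [lamS]) zS_natCast
    fun n => by rw [zS_neg hq hq0, zS_natCast]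

theorem hasSum_zS_sq (hq : ‖q‖ < 1) (hq0 : q ≠ 0) (hα : ‖q‖ * Real.exp |α.im| < 1) :
    HasSum (fun j : ℤ => zS q j ^ 2 * Complex.exp (Complex.I * α) ^ j)
      (2 * lamCos (fun m q => lamS m q * lamS m q) α q) :=
  (isLambert_lamS.mul isLambert_lamS).hasSum_int_even hq hα (by simp [lamS])
    (fun n => by rw [zS_natCast, sq]) fun n => by rw [zS_neg hq hq0, zS_natCast]; ring

theorem isLambert_lamS_mul : IsLambert (fun m q => lamS m q * (1 + 2 * lamT m q)) := by
  have := isLambert_lamS.add ((isLambert_lamS.mul isLambert_lamT).const_mul 2)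
  convert! this using 3
  ring

theorem norm_exp_lt_one (hα : 0 < α.im) : ‖Complex.exp (Complex.I * α)‖ < 1 := by
  rw [Complex.norm_exp]
  simpa using hα

theorem hasSum_int_of_hasSum_nat {f : ℤ → ℂ} {S : ℂ} (h : HasSum (fun n : ℕ => f n) S)
    (hf : ∀ n : ℕ, f (-(n + 1)) = 0) : HasSum f S := by
  have := HasSum.of_nat_of_neg_add_one h (m' := 0) (by simpa only [hf] using hasSum_zero (α := ℂ) (β := ℕ))
  rwa [add_zero] at this

theorem hasSum_indicator_geometric {ξ : ℂ} (hξ : ‖ξ‖ < 1) :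
    HasSum (fun j : ℤ => (if 1 ≤ j then (1 : ℂ) else 0) * ξ ^ j) (ξ / (1 - ξ)) := by
  have h := (hasSum_geometric_of_norm_lt_one hξ).mul_left ξ
  rw [← div_eq_mul_inv] at h
  refine hasSum_int_of_hasSum_nat ?_ fun n => by rw [if_neg (by omega), zero_mul]
  rw [← hasSum_nat_add_iff' 1]
  simp only [Finset.range_one, Finset.sum_singleton]
  refine (h.congr_fun fun n => ?_).trans_eq ?_
  · rw [if_pos (by push_cast; omega), one_mul, zpow_natCast, pow_succ']
  · simp

theorem hasSum_mul_indicator_geometric {ξ : ℂ} (hξ : ‖ξ‖ < 1) :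
    HasSum (fun j : ℤ => (j : ℂ) * (if 1 ≤ j then (1 : ℂ) else 0) * ξ ^ j) (ξ / (1 - ξ) ^ 2) := by
  have h := hasSum_coe_mul_geometric_of_norm_lt_one hξ
  refine hasSum_int_of_hasSum_nat (h.congr_fun fun n => ?_) fun n => by
    rw [if_neg (by omega), mul_zero, zero_mul]
  rcases n with _ | n
  · simp
  · rw [if_pos (by push_cast; omega), zpow_natCast]
    simp

/-- The summable part of `zR`. -/
noncomputable def zU (q : ℂ) (j : ℤ) : ℂ := zR q j - if 1 ≤ j then 1 else 0

theorem zU_natCast (hq : ‖q‖ < 1) (n : ℕ) : zU q n = lamT n q := by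
  rcases n with _ | n
  · simp [zU, zR, lamT]
  · rw [zU, zR_natCast hq n.succ_ne_zero, if_pos (by push_cast; omega)]; ring

theorem zU_neg (hq : ‖q‖ < 1) (hq0 : q ≠ 0) (n : ℕ) : zU q (-n) = -lamT n q := by
  rcases n with _ | n
  · simp [zU, zR, lamT]
  · rw [zU, zR_neg hq hq0 (by push_cast; omega), zR_natCast hq n.succ_ne_zero,
      if_neg (by push_cast; omega)]; ring

theorem hasSum_zU (hq : ‖q‖ < 1) (hq0 : q ≠ 0) (hα : ‖q‖ * Real.exp |α.im| < 1) :
    HasSum (fun j : ℤ => zU q j * Complex.exp (Complex.I * α) ^ j)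
      (2 * Complex.I * lamSin lamT α q) :=
  isLambert_lamT.hasSum_int_odd hq hα (by simp [lamT]) (zU_natCast hq) (zU_neg hq hq0)

/-- The coefficients tend to 1 as j → ∞, so the series needs Im α > 0. Subtracting the geometric
series leaves the convergent Lambert part `zU`. -/
theorem hasSum_zR (hq : ‖q‖ < 1) (hq0 : q ≠ 0) (hα : ‖q‖ * Real.exp |α.im| < 1) (hα0 : 0 < α.im) :
    HasSum (fun j : ℤ => zR q j * Complex.exp (Complex.I * α) ^ j)
      (2 * Complex.I * lamSin lamT α q +
        Complex.exp (Complex.I * α) / (1 - Complex.exp (Complex.I * α))) := by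
  refine ((hasSum_zU hq hq0 hα).add (hasSum_indicator_geometric (norm_exp_lt_one hα0))).congr_fun fun j => ?_
  rw [zU]; ring

theorem hasSum_mul_zR (hq : ‖q‖ < 1) (hq0 : q ≠ 0) (hα : ‖q‖ * Real.exp |α.im| < 1)
    (hα0 : 0 < α.im) :
    HasSum (fun j : ℤ => j * zR q j * Complex.exp (Complex.I * α) ^ j)
      (2 * lamCos (fun m q => m * lamT m q) α q +
        Complex.exp (Complex.I * α) / (1 - Complex.exp (Complex.I * α)) ^ 2) := by
  have h := isLambert_lamT.natCast_mul.hasSum_int_even (f := fun j => j * zU q j) hq hα (by simp)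
    (fun n => by simp [zU_natCast hq]) (fun n => by simp [zU_neg hq hq0])
  refine (h.add (hasSum_mul_indicator_geometric (norm_exp_lt_one hα0))).congr_fun fun j => ?_
  rw [zU]; ring

/-- Split 2 zR zS = (2 zR - 1) zS + zS: the first summand is even in j, the second odd. -/
theorem hasSum_zR_mul_zS (hq : ‖q‖ < 1) (hq0 : q ≠ 0) (hα : ‖q‖ * Real.exp |α.im| < 1) :
    HasSum (fun j : ℤ => zR q j * zS q j * Complex.exp (Complex.I * α) ^ j)
      (lamCos (fun m q => lamS m q * (1 + 2 * lamT m q)) α q + Complex.I * lamSin lamS α q) := by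
  have h := isLambert_lamS_mul.hasSum_int_even (f := fun j => (2 * zR q j - 1) * zS q j) hq hα
    (by simp [lamS])
    (fun n => by
      rcases n with _ | n
      · simp [lamS, zS]
      · rw [zR_natCast hq n.succ_ne_zero, zS_natCast]; ring)
    (fun n => by
      rcases n with _ | n
      · simp [lamS, zS]
      · rw [zR_neg hq hq0 (by push_cast; omega), zR_natCast hq n.succ_ne_zero, zS_neg hq hq0,
          zS_natCast]; ring)
  convert! (h.add (hasSum_zS hq hq0 hα)).mul_left (1 / 2) using 1
  · ext j; ring
  · ring

theorem hasSum_prod_mul {f g : ℤ → ℂ} {a b : ℂ} (hf : HasSum f a) (hg : HasSum g b) :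
    HasSum (fun p : ℤ × ℤ => f p.1 * g p.2) (a * b) :=
  hf.mul hg (summable_mul_of_summable_norm hf.summable.norm hg.summable.norm)

/-- The bijection `(j, k) ↦ (k, j - k)`. -/
def prodShear₁ : ℤ × ℤ ≃ ℤ × ℤ where
  toFun p := (p.2, p.1 - p.2)
  invFun p := (p.1 + p.2, p.1)
  left_inv p := by simp
  right_inv p := by simp

/-- The bijection `(j, k) ↦ (j, k - j)`. -/
def prodShear₂ : ℤ × ℤ ≃ ℤ × ℤ where
  toFun p := (p.1, p.2 - p.1)
  invFun p := (p.1, p.1 + p.2)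
  left_inv p := by simp
  right_inv p := by simp

/-- Compare coefficients of ξ^j η^k. For generic (j, k) they cancel by `zS_mul_zS`; the lines j = k,
k = 0 and j = 0 contribute the right-hand side. The two shears bring the products with the series in
ξη to the monomials ξ^j η^k. -/
theorem lambert_three_term_aux (hq : ‖q‖ < 1) (hq0 : q ≠ 0) {ξ η : ℂ} (hξ : ξ ≠ 0) (hη : η ≠ 0)
    {SA SB SR DA DB DC : ℂ}
    (hA : HasSum (fun j : ℤ => zS q j * ξ ^ j) SA) (hB : HasSum (fun j : ℤ => zS q j * η ^ j) SB)
    (hR : HasSum (fun j : ℤ => zR q j * (ξ * η) ^ j) SR)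
    (hDA : HasSum (fun j : ℤ => zR q j * zS q j * ξ ^ j) DA)
    (hDB : HasSum (fun j : ℤ => zR q j * zS q j * η ^ j) DB)
    (hDC : HasSum (fun j : ℤ => zS q j ^ 2 * (ξ * η) ^ j) DC) :
    SA * SB - SR * SA - SR * SB = DC + DB + DA := by
  have h1 : HasSum (fun p : ℤ × ℤ => zS q p.1 * zS q p.2 * (ξ ^ p.1 * η ^ p.2)) (SA * SB) :=
    (hasSum_prod_mul hA hB).congr_fun fun p => by ring
  have h2 : HasSum (fun p : ℤ × ℤ => zR q p.2 * zS q (p.1 - p.2) * (ξ ^ p.1 * η ^ p.2))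
      (SR * SA) := by
    have := (prodShear₁.hasSum_iff).2 (hasSum_prod_mul hR hA)
    refine this.congr_fun ?_
    rintro ⟨j, k⟩
    simp only [prodShear₁, Function.comp, Equiv.coe_fn_mk]
    rw [mul_zpow, zpow_sub₀ hξ]
    field_simp
  have h3 : HasSum (fun p : ℤ × ℤ => zR q p.1 * zS q (p.2 - p.1) * (ξ ^ p.1 * η ^ p.2))
      (SR * SB) := by
    have := (prodShear₂.hasSum_iff).2 (hasSum_prod_mul hR hB)
    refine this.congr_fun ?_
    rintro ⟨j, k⟩
    simp only [prodShear₂, Function.comp, Equiv.coe_fn_mk]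
    rw [mul_zpow, zpow_sub₀ hη]
    field_simp
  have d1 : HasSum (fun p : ℤ × ℤ => if p.1 = p.2 then zS q p.1 ^ 2 * (ξ ^ p.1 * η ^ p.2) else 0)
      DC := by
    rw [← Function.Injective.hasSum_iff (g := fun j : ℤ => (j, j)) (fun a b h => (Prod.ext_iff.1 h).1)]
    · refine hDC.congr_fun fun j => ?_
      simp [mul_zpow]
    · rintro ⟨j, k⟩ h
      exact if_neg fun h' => h ⟨j, by rw [show j = k from h']⟩
  have d2 : HasSum (fun p : ℤ × ℤ => if p.1 = 0 then zR q p.2 * zS q p.2 * (ξ ^ p.1 * η ^ p.2) else 0)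
      DB := by
    rw [← Function.Injective.hasSum_iff (g := fun j : ℤ => ((0 : ℤ), j))
      (fun a b h => (Prod.ext_iff.1 h).2)]
    · refine hDB.congr_fun fun j => ?_
      simp
    · rintro ⟨j, k⟩ h
      exact if_neg fun h' => h ⟨k, by rw [show j = 0 from h']⟩
  have d3 : HasSum (fun p : ℤ × ℤ => if p.2 = 0 then zR q p.1 * zS q p.1 * (ξ ^ p.1 * η ^ p.2) else 0)
      DA := by
    rw [← Function.Injective.hasSum_iff (g := fun j : ℤ => (j, (0 : ℤ)))
      (fun a b h => (Prod.ext_iff.1 h).1)]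
    · refine hDA.congr_fun fun j => ?_
      simp
    · rintro ⟨j, k⟩ h
      exact if_neg fun h' => h ⟨j, by rw [show k = 0 from h']⟩
  -- On the exceptional lines the convention 1/0 = 0 gives zS(0) = zR(0) = 0, so each case reduces
  -- to the term of the corresponding diagonal series.
  refine ((h1.sub h2).sub h3).unique (((d1.add d2).add d3).congr_fun ?_)
  rintro ⟨j, k⟩
  simp only
  rcases eq_or_ne j 0 with rfl | hj
  · rcases eq_or_ne k 0 with rfl | hk
    · simp [zS, zR]
    · rw [if_neg hk.symm, if_pos rfl, if_neg hk, zero_sub, zS_neg hq hq0, zS_zero, zR_zero]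
      ring
  · rcases eq_or_ne k 0 with rfl | hk
    · rw [if_neg hj, if_neg hj, if_pos rfl, zero_sub, zS_neg hq hq0, zS_zero, zR_zero]
      ring
    · rcases eq_or_ne j k with rfl | hjk
      · rw [if_neg hj, if_pos rfl, sub_self, zS_zero]
        ring
      · rw [if_neg hj, if_neg hk, if_neg hjk]
        linear_combination (ξ ^ j * η ^ k) * zS_mul_zS hq hq0 hj hk hjk

theorem cot_half_eq {γ : ℂ} (hγ : 0 < γ.im) : Complex.cot (γ / 2) = -Complex.I - 2 * Complex.I *
    (Complex.exp (Complex.I * γ) / (1 - Complex.exp (Complex.I * γ))) := by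
  have h : 1 - Complex.exp (Complex.I * γ) ≠ 0 := fun h => by
    have := norm_exp_lt_one hγ
    rw [← sub_eq_zero.1 h] at this
    simp at this
  rw [Complex.cot_eq_exp_ratio, show 2 * Complex.I * (γ / 2) = Complex.I * γ by ring]
  field_simp
  rw [Complex.I_sq]
  ring

/-- The logarithmic derivative of `θ₁` at `γ / 2`. -/
noncomputable def dlogTheta1 (γ q : ℂ) : ℂ := Complex.cot (γ / 2) + 4 * lamSin lamT γ q

theorem dlogTheta1_eq {γ SR : ℂ} (hq : ‖q‖ < 1) (hq0 : q ≠ 0)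
    (hγ : ‖q‖ * Real.exp |γ.im| < 1) (hγ0 : 0 < γ.im)
    (hR : HasSum (fun j : ℤ => zR q j * Complex.exp (Complex.I * γ) ^ j) SR) :
    dlogTheta1 γ q = -Complex.I - 2 * Complex.I * SR := by
  rw [dlogTheta1, cot_half_eq hγ0, hR.unique (hasSum_zR hq hq0 hγ hγ0)]
  linear_combination 4 * lamSin lamT γ q * Complex.I_mul_I

theorem lambert_three_term_of_im_pos (hq : ‖q‖ < 1) (hq0 : q ≠ 0) (hα : ‖q‖ * Real.exp |α.im| < 1)
    (hβ : ‖q‖ * Real.exp |β.im| < 1) (hγ : ‖q‖ * Real.exp |(α + β).im| < 1)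
    (hγ0 : 0 < (α + β).im) :
    16 * lamSin lamS α q * lamSin lamS β q
      - 4 * dlogTheta1 (α + β) q * (lamSin lamS α q + lamSin lamS β q) =
    -8 * lamCos (fun m q => lamS m q * lamS m q) (α + β) q
      - 4 * lamCos (fun m q => lamS m q * (1 + 2 * lamT m q)) α q
      - 4 * lamCos (fun m q => lamS m q * (1 + 2 * lamT m q)) β q := by
  have hR := hasSum_zR hq hq0 hγ hγ0
  have hexp : Complex.exp (Complex.I * (α + β)) =
      Complex.exp (Complex.I * α) * Complex.exp (Complex.I * β) := by rw [mul_add, Complex.exp_add]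
  have hDC := hasSum_zS_sq hq hq0 hγ
  have hR' := hR
  rw [hexp] at hR hDC
  have key := lambert_three_term_aux hq hq0 (Complex.exp_ne_zero _) (Complex.exp_ne_zero _)
    (hasSum_zS hq hq0 hα) (hasSum_zS hq hq0 hβ) hR (hasSum_zR_mul_zS hq hq0 hα)
    (hasSum_zR_mul_zS hq hq0 hβ) hDC
  rw [dlogTheta1_eq hq hq0 hγ hγ0 hR', hexp]
  generalize 2 * Complex.I * lamSin lamT (α + β) q +
        Complex.exp (Complex.I * α) * Complex.exp (Complex.I * β) /
          (1 - Complex.exp (Complex.I * α) * Complex.exp (Complex.I * β)) = SR at *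
  linear_combination -4 * key + (16 * lamSin lamS α q * lamSin lamS β q) * Complex.I_mul_I

end LambertIdentities

/-! ### The Riccati identity, and passage to real arguments -/

section ThetaIdentities

variable {c : ℕ → ℂ → ℂ} {q α β γ : ℂ}

theorem IsLambert.hasDerivAt_lamCos (hc : IsLambert c) (hq : ‖q‖ < 1)
    (hα : ‖q‖ * Real.exp |α.im| < 1) :
    HasDerivAt (fun α => lamCos c α q) (-lamSin (fun m q => m * c m q) α q) α := by
  have := hc.hasDerivAt_param (e := fun m z => Complex.cos (m * z))
    (e' := fun m z => -Complex.sin (m * z)) (ρ := fun z => Real.exp |z.im|)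
    (Real.continuous_exp.comp (continuous_abs.comp Complex.continuous_im))
    (fun ζ => (Real.exp_pos _).le) norm_cos_nat_mul_le
    (fun m ζ => by
      convert! (Complex.hasDerivAt_cos (m * ζ)).comp ζ ((hasDerivAt_id ζ).const_mul (m : ℂ)) using 1
      ring) hq hα
  convert! this using 1
  simp only [lamSin, mul_neg, tsum_neg]

theorem IsLambert.hasDerivAt_lamSin (hc : IsLambert c) (hq : ‖q‖ < 1)
    (hα : ‖q‖ * Real.exp |α.im| < 1) :
    HasDerivAt (fun α => lamSin c α q) (lamCos (fun m q => m * c m q) α q) α :=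
  hc.hasDerivAt_param (e := fun m z => Complex.sin (m * z))
    (e' := fun m z => Complex.cos (m * z)) (ρ := fun z => Real.exp |z.im|)
    (Real.continuous_exp.comp (continuous_abs.comp Complex.continuous_im))
    (fun ζ => (Real.exp_pos _).le) norm_sin_nat_mul_le
    (fun m ζ => by
      convert! (Complex.hasDerivAt_sin (m * ζ)).comp ζ ((hasDerivAt_id ζ).const_mul (m : ℂ)) using 1
      ring) hq hα

theorem hasSum_of_eq {ι : Type*} {f : ι → ℂ} {a b : ℂ} (h : HasSum f a) (hab : a = b) : HasSum f b :=
  hab ▸ h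

/-- The difference is supported between 0 and j and sums to the signed count j. It is the
contribution of the non-summable part of `zR` to the convolution below. -/
theorem hasSum_indicator_sub (j : ℤ) :
    HasSum (fun l : ℤ => (if 1 ≤ l then (1 : ℂ) else 0) - (if 1 ≤ l - j then 1 else 0)) j := by
  rcases le_total 0 j with hj | hj
  · convert! hasSum_sum_of_ne_finset_zero (s := Finset.Ioc 0 j)
      (f := fun l : ℤ => (if 1 ≤ l then (1 : ℂ) else 0) - (if 1 ≤ l - j then 1 else 0))
      (L := SummationFilter.unconditional ℤ) ?_ using 1
    · rw [Finset.sum_congr rfl (g := fun _ => (1 : ℂ))]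
      · simp only [Finset.sum_const, Int.card_Ioc, sub_zero, nsmul_eq_mul, mul_one]
        exact_mod_cast (Int.toNat_of_nonneg hj).symm
      · intro l hl
        rw [Finset.mem_Ioc] at hl
        rw [if_pos (by omega), if_neg (by omega), sub_zero]
    · intro l hl
      rw [Finset.mem_Ioc] at hl
      by_cases h : 1 ≤ l
      · rw [if_pos h, if_pos (by omega), sub_self]
      · rw [if_neg h, if_neg (by omega), sub_self]
  · convert! hasSum_sum_of_ne_finset_zero (s := Finset.Ioc j 0)
      (f := fun l : ℤ => (if 1 ≤ l then (1 : ℂ) else 0) - (if 1 ≤ l - j then 1 else 0))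
      (L := SummationFilter.unconditional ℤ) ?_ using 1
    · rw [Finset.sum_congr rfl (g := fun _ => (-1 : ℂ))]
      · simp only [Finset.sum_const, Int.card_Ioc, nsmul_eq_mul, mul_neg, mul_one]
        have : ((0 - j).toNat : ℤ) = 0 - j := Int.toNat_of_nonneg (by omega)
        have h2 : (((0 - j).toNat : ℤ) : ℂ) = ((0 - j : ℤ) : ℂ) := by rw [this]
        push_cast at h2
        rw [h2]; ring
      · intro l hl
        rw [Finset.mem_Ioc] at hl
        rw [if_neg (by omega), if_pos (by omega), zero_sub]
    · intro l hl
      rw [Finset.mem_Ioc] at hl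
      by_cases h : 1 ≤ l
      · rw [if_pos h, if_pos (by omega), sub_self]
      · rw [if_neg h, if_neg (by omega), sub_self]

/-- `∑ q^{2m} / (1 - q^{2m})²`. -/
noncomputable def lamSigma (q : ℂ) : ℂ := ∑' m : ℕ, lamS m q * lamS m q

theorem hasSum_zR_convolution_zero (hq : ‖q‖ < 1) (hq0 : q ≠ 0) :
    HasSum (fun l : ℤ => zR q l * zR q (0 - l)) (-2 * lamSigma q) := by
  have h := hasSum_zS_sq (α := 0) hq hq0 (by simpa using hq)
  have h1 : lamCos (fun m q => lamS m q * lamS m q) 0 q = lamSigma q := by simp [lamCos, lamSigma]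
  rw [h1] at h
  rw [neg_mul]
  refine h.neg.congr_fun fun l => ?_
  rw [mul_zero, Complex.exp_zero, one_zpow, mul_one, zero_sub]
  rcases eq_or_ne l 0 with rfl | hl
  · simp [zR, zS]
  · rw [zR_neg hq hq0 hl, zR_mul_one_sub hq hq0]

/-- By `zR_mul_zR` the sum is zR(j) times a telescoping sum. Its `zU` part cancels and its indicator
part gives j. The partial fractions fail at l = 0 and l = j, and correcting these two terms adds
zR(-j) - zR(j) = 1 - 2 zR(j). -/
theorem hasSum_zR_convolution (hq : ‖q‖ < 1) (hq0 : q ≠ 0) {j : ℤ} (hj : j ≠ 0) :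
    HasSum (fun l : ℤ => zR q l * zR q (j - l)) (zR q j * (j + 1 - 2 * zR q j)) := by
  have hU := hasSum_zU (α := 0) hq hq0 (by simpa using hq)
  simp only [mul_zero, Complex.exp_zero, one_zpow, mul_one] at hU
  have hU' := (Equiv.subRight j).hasSum_iff.2 hU
  have h := (((hU.sub hU').add (hasSum_indicator_sub j)).add
    ((hasSum_ite_eq (0 : ℤ) (zR q (-j))).sub (hasSum_ite_eq j (zR q j)))).mul_left (zR q j)
  rw [sub_self, zR_neg hq hq0 hj] at h
  have h01 : ¬ (1 : ℤ) ≤ 0 := by norm_num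
  convert! h using 1
  · ext l
    simp only [Function.comp, Equiv.subRight_apply, zU]
    rcases eq_or_ne l 0 with rfl | hl
    · rw [if_pos rfl, if_neg hj.symm, zR_zero, if_neg h01, zero_sub j, zR_neg hq hq0 hj]; ring
    · rcases eq_or_ne l j with rfl | hlj
      · rw [if_neg hl, if_pos rfl, sub_self, zR_zero]; ring
      · rw [if_neg hl, if_neg hlj, zR_mul_zR hq hq0 hj hl hlj]; ring
  · ring

/-- The derivative of the logarithmic derivative of `θ₁` at `γ / 2`. -/
noncomputable def ddlogTheta1 (γ q : ℂ) : ℂ :=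
  -1 / Complex.sin (γ / 2) ^ 2 + 8 * lamCos (fun m q => m * lamT m q) γ q

theorem neg_one_div_sin_half_sq {γ : ℂ} (hγ : 0 < γ.im) : -1 / Complex.sin (γ / 2) ^ 2 =
    4 * (Complex.exp (Complex.I * γ) / (1 - Complex.exp (Complex.I * γ)) ^ 2) := by
  have h : 1 - Complex.exp (Complex.I * γ) ≠ 0 := fun h => by
    have := norm_exp_lt_one hγ
    rw [← sub_eq_zero.1 h] at this
    simp at this
  have h1 : Complex.exp (Complex.I * γ) * Complex.sin (γ / 2) ^ 2 =
      -(1 - Complex.exp (Complex.I * γ)) ^ 2 / 4 := by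
    rw [Complex.sin]
    have e1 : Complex.exp (Complex.I * γ) = Complex.exp (γ / 2 * Complex.I) ^ 2 := by
      rw [← Complex.exp_nat_mul]; congr 1; push_cast; ring
    rw [e1, neg_mul, Complex.exp_neg]
    have e2 := Complex.exp_ne_zero (γ / 2 * Complex.I)
    generalize Complex.exp (γ / 2 * Complex.I) = w at *
    field_simp
    rw [Complex.I_sq]
    ring
  have h2 : Complex.sin (γ / 2) ^ 2 ≠ 0 := fun h2 => by
    rw [h2, mul_zero] at h1
    have : (1 - Complex.exp (Complex.I * γ)) ^ 2 = 0 := by linear_combination 4 * h1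
    exact h (by simpa using this)
  rw [mul_div_assoc', div_eq_div_iff h2 (pow_ne_zero 2 h)]
  linear_combination -4 * h1

/-- The logarithmic derivative φ of θ₁ is -i - 2i ∑ zR(j) e^{ijγ}. Squaring the series and
collecting the terms with the same exponent leads to the convolutions computed above. -/
theorem riccati_of_im_pos (hq : ‖q‖ < 1) (hq0 : q ≠ 0) (hγ : ‖q‖ * Real.exp |γ.im| < 1)
    (hγ0 : 0 < γ.im) :
    dlogTheta1 γ q ^ 2 + ddlogTheta1 γ q + 1 =
      8 * lamSigma q + 16 * lamCos (fun m q => lamS m q * lamS m q) γ q := by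
  have hR := hasSum_zR hq hq0 hγ hγ0
  have hM := hasSum_mul_zR hq hq0 hγ hγ0
  have hS := hasSum_zS_sq hq hq0 hγ
  rw [dlogTheta1_eq hq hq0 hγ hγ0 hR, ddlogTheta1, neg_one_div_sin_half_sq hγ0]
  set ξ := Complex.exp (Complex.I * γ)
  have hξ : ξ ≠ 0 := Complex.exp_ne_zero _
  have h1 := (prodShear₁.hasSum_iff).2 (hasSum_prod_mul hR hR)
  have h2 : ∀ j : ℤ, HasSum (fun l : ℤ => ((fun p : ℤ × ℤ => zR q p.1 * ξ ^ p.1 *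
      (zR q p.2 * ξ ^ p.2)) ∘ prodShear₁) (j, l)) ((if j = 0 then -2 * lamSigma q else 0) +
      (j * zR q j * ξ ^ j - zR q j * ξ ^ j - 2 * (zS q j ^ 2 * ξ ^ j))) := by
    intro j
    have h3 : HasSum (fun l : ℤ => ξ ^ j * (zR q l * zR q (j - l)))
        ((if j = 0 then -2 * lamSigma q else 0) +
        (j * zR q j * ξ ^ j - zR q j * ξ ^ j - 2 * (zS q j ^ 2 * ξ ^ j))) := by
      rcases eq_or_ne j 0 with rfl | hj
      · refine hasSum_of_eq ((hasSum_zR_convolution_zero hq hq0).mul_left (ξ ^ (0 : ℤ))) ?_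
        simp [zR_zero, zS_zero]
      · refine hasSum_of_eq ((hasSum_zR_convolution hq hq0 hj).mul_left (ξ ^ j)) ?_
        rw [if_neg hj]
        linear_combination 2 * ξ ^ j * zR_mul_one_sub hq hq0 j
    refine h3.congr_fun fun l => ?_
    simp only [prodShear₁, Function.comp, Equiv.coe_fn_mk]
    rw [zpow_sub₀ hξ]
    field_simp
  have h3 := (h1.prod_fiberwise h2).unique
    ((hasSum_ite_eq (0 : ℤ) (-2 * lamSigma q)).add ((hM.sub hR).sub (hS.mul_left 2)))
  linear_combination (-4) * h3 + (4 * (2 * Complex.I * lamSin lamT γ q + ξ / (1 - ξ)) ^ 2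
    + 4 * (2 * Complex.I * lamSin lamT γ q + ξ / (1 - ξ)) + 1) * Complex.I_mul_I

theorem norm_mul_exp_abs_im_ofReal (hq : ‖q‖ < 1) (x : ℝ) :
    ‖q‖ * Real.exp |(x : ℂ).im| < 1 := by simpa using hq

theorem continuousAt_dlogTheta1 (hq : ‖q‖ < 1) {x : ℝ} (hx : Complex.sin (x / 2) ≠ 0) :
    ContinuousAt (fun γ => dlogTheta1 γ q) x := by
  unfold dlogTheta1 Complex.cot
  refine ContinuousAt.add (ContinuousAt.div (by fun_prop) (by fun_prop) hx) ?_
  exact (isLambert_lamT.hasDerivAt_lamSin hq (norm_mul_exp_abs_im_ofReal hq x)).continuousAt.const_mul _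

theorem tendsto_add_mul_I (x : ℝ) :
    Tendsto (fun ε : ℝ => (x : ℂ) + ε * Complex.I) (𝓝[>] 0) (𝓝 (x : ℂ)) := by
  have : ContinuousAt (fun ε : ℝ => (x : ℂ) + ε * Complex.I) 0 := by fun_prop
  simpa using this.tendsto.mono_left nhdsWithin_le_nhds

theorem eventually_norm_mul_exp_lt (hq : ‖q‖ < 1) (x : ℝ) :
    ∀ᶠ ε : ℝ in 𝓝[>] 0, ‖q‖ * Real.exp |((x : ℂ) + ε * Complex.I).im| < 1 := by
  have h : ContinuousAt (fun z : ℂ => ‖q‖ * Real.exp |z.im|) x := by fun_prop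
  exact (h.tendsto.comp (tendsto_add_mul_I x)).eventually
    (gt_mem_nhds (norm_mul_exp_abs_im_ofReal hq x))

/-- This is the heat equation for θ₁ in logarithmic form: φ² + φ' = θ₁''/θ₁, and the right-hand side
is -4 q ∂_q log(θ₁/sin) by `weightLog_nome`. The Laurent series need Im γ > 0, so real arguments are
reached as a limit from above. -/
theorem riccati (hq : ‖q‖ < 1) (hq0 : q ≠ 0) {x : ℝ} (hx : Complex.sin (x / 2) ≠ 0) :
    dlogTheta1 x q ^ 2 + ddlogTheta1 x q + 1 =
      8 * lamSigma q + 16 * lamCos (fun m q => lamS m q * lamS m q) x q := by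
  have hx' := norm_mul_exp_abs_im_ofReal hq x
  have c1 := continuousAt_dlogTheta1 hq hx
  have c2 : ContinuousAt (fun γ => ddlogTheta1 γ q) x := by
    unfold ddlogTheta1
    refine ContinuousAt.add (ContinuousAt.div (by fun_prop) (by fun_prop) (pow_ne_zero 2 hx))
      ((isLambert_lamT.natCast_mul.hasDerivAt_lamCos hq hx').continuousAt.const_mul _)
  have c3 := ((isLambert_lamS.mul isLambert_lamS).hasDerivAt_lamCos hq hx').continuousAt
  have c4 := ((c1.pow 2).add c2).add_const 1
  have c5 := (c3.const_mul 16).const_add (8 * lamSigma q)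
  refine tendsto_nhds_unique_of_eventuallyEq (c4.tendsto.comp (tendsto_add_mul_I x))
    (c5.tendsto.comp (tendsto_add_mul_I x)) ?_
  filter_upwards [eventually_norm_mul_exp_lt hq x, self_mem_nhdsWithin] with ε hε hε0
  exact riccati_of_im_pos hq hq0 hε (by simpa using hε0)

theorem lambert_three_term (hq : ‖q‖ < 1) (hq0 : q ≠ 0) {x y : ℝ}
    (hx : Complex.sin (((x + y : ℝ) : ℂ) / 2) ≠ 0) :
    16 * lamSin lamS x q * lamSin lamS y q
      - 4 * dlogTheta1 ((x + y : ℝ) : ℂ) q * (lamSin lamS x q + lamSin lamS y q) =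
    -8 * lamCos (fun m q => lamS m q * lamS m q) ((x + y : ℝ) : ℂ) q
      - 4 * lamCos (fun m q => lamS m q * (1 + 2 * lamT m q)) x q
      - 4 * lamCos (fun m q => lamS m q * (1 + 2 * lamT m q)) y q := by
  have hx' := norm_mul_exp_abs_im_ofReal hq x
  have hxy' := norm_mul_exp_abs_im_ofReal hq (x + y)
  have c1 := (continuousAt_dlogTheta1 hq hx).tendsto.comp (tendsto_add_mul_I (x + y))
  have c2 := (isLambert_lamS.hasDerivAt_lamSin hq hx').continuousAt.tendsto.comp (tendsto_add_mul_I x)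
  have c3 := ((isLambert_lamS.mul isLambert_lamS).hasDerivAt_lamCos hq hxy').continuousAt.tendsto.comp
    (tendsto_add_mul_I (x + y))
  have c4 := (isLambert_lamS_mul.hasDerivAt_lamCos hq hx').continuousAt.tendsto.comp
    (tendsto_add_mul_I x)
  refine tendsto_nhds_unique_of_eventuallyEq
    (((c2.const_mul 16).mul_const (lamSin lamS y q)).sub
      ((c1.const_mul 4).mul (c2.add_const (lamSin lamS y q))))
    (((c3.const_mul (-8)).sub (c4.const_mul 4)).sub_const
      (4 * lamCos (fun m q => lamS m q * (1 + 2 * lamT m q)) y q)) ?_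
  filter_upwards [eventually_norm_mul_exp_lt hq x, eventually_norm_mul_exp_lt hq (x + y),
    self_mem_nhdsWithin] with ε hε hε' hε0
  have e : ((x + y : ℝ) : ℂ) + ε * Complex.I = (x + ε * Complex.I) + y := by push_cast; ring
  simp only [Function.comp]
  rw [e] at hε' ⊢
  exact lambert_three_term_of_im_pos hq hq0 hε (norm_mul_exp_abs_im_ofReal hq y) hε'
    (by simpa using hε0)

end ThetaIdentities

/-! ### Logarithms of theta products as Lambert series -/

section LogProducts

variable {q : ℂ}

/-- Interchange of the sums over the factors k and the powers m. For fixed m the sum over k is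
geometric with ratio q^{2m}, which creates the Lambert denominator. -/
theorem hasSum_lambert_swap (hq : ‖q‖ < 1) {j : ℕ} {w G : ℕ → ℂ} (hw : w 0 = 0)
    (hs : Summable fun m => w m * q ^ (j * m))
    (hG : ∀ k, HasSum (fun m => w m * (q ^ (2 * k + j)) ^ m) (G k)) :
    HasSum G (∑' m, w m * (q ^ (j * m) / (1 - q ^ (2 * m)))) := by
  have h1 : Summable (fun p : ℕ × ℕ => w p.1 * (q ^ (2 * p.2 + j)) ^ p.1) := by
    have hg : Summable fun k : ℕ => ‖q‖ ^ (2 * k) := by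
      simp only [pow_mul]
      exact summable_geometric_of_lt_one (by positivity)
        (pow_lt_one₀ (norm_nonneg _) hq two_ne_zero)
    refine Summable.of_norm_bounded (hs.norm.mul_of_nonneg hg (fun _ => norm_nonneg _)
      (fun _ => by positivity)) ?_
    rintro ⟨m, k⟩
    rcases m with _ | m
    · simp [hw]
    simp only [norm_mul, norm_pow]
    rw [mul_assoc, ← pow_mul, ← pow_add]
    -- For m ≥ 1 one has (2k + j)m ≥ jm + 2k, so the double series is dominated by a product of two
    -- convergent ones. At m = 0 this fails, hence the assumption w 0 = 0.
    refine mul_le_mul_of_nonneg_left (pow_le_pow_of_le_one (norm_nonneg _) hq.le ?_) (norm_nonneg _)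
    nlinarith [Nat.zero_le (k * m)]
  have h2 : ∀ m, HasSum (fun k => w m * (q ^ (2 * k + j)) ^ m)
      (w m * (q ^ (j * m) / (1 - q ^ (2 * m)))) := by
    intro m
    rcases eq_or_ne m 0 with rfl | hm
    · simp [hw]
    have h3 : ‖q ^ (2 * m)‖ < 1 := by
      rw [norm_pow]; exact pow_lt_one₀ (norm_nonneg _) hq (by omega)
    refine ((hasSum_geometric_of_norm_lt_one h3).mul_left (w m * q ^ (j * m))).congr_fun
      (fun k => ?_) |> fun h => hasSum_of_eq h (by ring)
    ring
  have h3 := h1.hasSum.prod_fiberwise h2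
  rw [h3.tsum_eq]
  have h4 := ((Equiv.prodComm ℕ ℕ).hasSum_iff).2 h1.hasSum
  exact h4.prod_fiberwise hG

theorem hasSum_log_one_sub (hq : ‖q‖ < 1) {j : ℕ} (hj : j ≠ 0) {w : ℂ} (hw : ‖w‖ = 1) :
    HasSum (fun k : ℕ => Complex.log (1 - q ^ (2 * k + j) * w))
      (-∑' m : ℕ, w ^ m / m * (q ^ (j * m) / (1 - q ^ (2 * m)))) := by
  have hlt : ∀ k : ℕ, ‖q ^ (2 * k + j) * w‖ < 1 := fun k => by
    rw [norm_mul, hw, mul_one, norm_pow]; exact pow_lt_one₀ (norm_nonneg _) hq (by omega)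
  have h := hasSum_lambert_swap (j := j) (w := fun m => w ^ m / m)
    (G := fun k => -Complex.log (1 - q ^ (2 * k + j) * w)) hq (by simp) ?_ ?_
  · simpa using h.neg
  · refine Summable.of_norm_bounded (summable_geometric_of_lt_one (norm_nonneg q) hq) fun m => ?_
    rcases m with _ | m
    · simp
    rw [norm_mul, norm_div, norm_pow, hw, one_pow, norm_pow, Complex.norm_natCast]
    calc (1 / ((m + 1 : ℕ) : ℝ)) * ‖q‖ ^ (j * (m + 1)) ≤ 1 * ‖q‖ ^ (m + 1) := by
          gcongr ?_ * ?_
          · rw [div_le_one (by positivity)]; simp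
          · exact pow_le_pow_of_le_one (norm_nonneg _) hq.le
              (Nat.le_mul_of_pos_left _ (Nat.pos_of_ne_zero hj))
      _ = _ := one_mul _
  · intro k
    refine (Complex.hasSum_taylorSeries_neg_log (hlt k)).congr_fun fun m => ?_
    rw [mul_pow]; ring

/-- Both factors 1 - Q e^{±2ix} have positive real part, so their arguments add up without leaving
(-π, π) and the principal logarithms add. -/
theorem log_one_sub_two_mul_cos {Q : ℂ} (hQ : ‖Q‖ < 1) (x : ℝ) :
    Complex.log (1 - 2 * Q * Complex.cos (2 * x) + Q ^ 2) =
      Complex.log (1 - Q * Complex.exp (Complex.I * (2 * x))) +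
      Complex.log (1 - Q * (Complex.exp (Complex.I * (2 * x)))⁻¹) := by
  have hw : ‖Complex.exp (Complex.I * (2 * x))‖ = 1 := by
    rw [Complex.norm_exp]; simp
  have hre : ∀ w : ℂ, ‖w‖ = 1 → 0 < (1 - Q * w).re := fun w hw => by
    have := (Complex.re_le_norm (Q * w)).trans_lt (by rwa [norm_mul, hw, mul_one])
    simp only [Complex.sub_re, Complex.one_re]
    linarith
  have h1 := hre _ hw
  have h2 := hre (Complex.exp (Complex.I * (2 * x)))⁻¹ (by rw [norm_inv, hw, inv_one])
  have a1 := abs_lt.1 (Complex.abs_arg_lt_pi_div_two_iff.2 (Or.inl h1))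
  have a2 := abs_lt.1 (Complex.abs_arg_lt_pi_div_two_iff.2 (Or.inl h2))
  rw [← Complex.log_mul]
  · congr 1
    have h3 := two_mul_cos_nat_mul 1 (2 * x : ℂ)
    rw [Nat.cast_one, one_mul, pow_one, pow_one] at h3
    have h4 : Complex.exp (Complex.I * (2 * x)) * (Complex.exp (Complex.I * (2 * x)))⁻¹ = 1 :=
      mul_inv_cancel₀ (Complex.exp_ne_zero _)
    linear_combination -Q * h3 - Q ^ 2 * h4
  · rintro h; rw [h] at h1; simp at h1
  · rintro h; rw [h] at h2; simp at h2
  · exact ⟨by linarith [a1.1, a2.1], by linarith [a1.2, a2.2]⟩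

theorem norm_nome (τ : ℂ) : ‖nome τ‖ = Real.exp (-(Real.pi * τ.im)) := by
  rw [nome, Complex.norm_exp]; simp

theorem norm_nome_lt_one {τ : ℂ} (hτ : 0 < τ.im) : ‖nome τ‖ < 1 := by
  rw [norm_nome, Real.exp_lt_one_iff]
  exact neg_lt_zero.2 (mul_pos Real.pi_pos hτ)

theorem nome_ne_zero (τ : ℂ) : nome τ ≠ 0 := Complex.exp_ne_zero _

/-- `-∑ log (1 - q^{2k})`. -/
noncomputable def lamZero (q : ℂ) : ℂ := ∑' m : ℕ, lamT m q / m

/-- Treats both theta functions at once: j = 2 gives θ₁/sin and j = 1 gives θ₄. -/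
theorem hasSum_log_theta (hq : ‖q‖ < 1) {j : ℕ} (hj : j ≠ 0) {c : ℕ → ℂ → ℂ} (hc : IsLambert c)
    (hcj : ∀ m, c m q = q ^ (j * m) / (1 - q ^ (2 * m))) (x : ℝ) :
    HasSum (fun k : ℕ => Complex.log (1 - q ^ (2 * (k + 1))) +
      Complex.log (1 - 2 * q ^ (2 * k + j) * Complex.cos (2 * x) + (q ^ (2 * k + j)) ^ 2))
      (-lamZero q - 2 * lamCos (fun m q => c m q / m) (2 * x) q) := by
  have hw : ‖Complex.exp (Complex.I * (2 * x))‖ = 1 := by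
    rw [Complex.norm_exp]; simp
  have h1 := hasSum_log_one_sub hq two_ne_zero (w := 1) norm_one
  have h2 := hasSum_log_one_sub hq hj hw
  have h3 := hasSum_log_one_sub hq hj (w := (Complex.exp (Complex.I * (2 * x)))⁻¹)
    (by rw [norm_inv, hw, inv_one])
  convert! h1.add (h2.add h3) using 1
  · ext k
    rw [log_one_sub_two_mul_cos (by rw [norm_pow]; exact pow_lt_one₀ (norm_nonneg _) hq (by omega)),
      mul_one, mul_add, mul_one]
  · have hq2 : ‖q‖ * Real.exp |(2 * x : ℂ).im| < 1 := by simpa using hq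
    have s1 := hc.div_natCast.summable_exp hq hq2
    have s2 := hc.div_natCast.summable_exp_inv hq hq2
    have e1 : ∀ (w : ℂ) (m : ℕ), w ^ m / m * (q ^ (j * m) / (1 - q ^ (2 * m))) = c m q / m * w ^ m :=
      fun w m => by rw [hcj]; ring
    simp only [e1]
    have e2 : ∑' m : ℕ, (1 : ℂ) ^ m / m * (q ^ (2 * m) / (1 - q ^ (2 * m))) = lamZero q :=
      tsum_congr fun m => by rw [lamT]; ring
    rw [e2, ← neg_add, ← s1.tsum_add s2, lamCos, ← tsum_mul_left, sub_eq_add_neg]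
    congr 2
    exact tsum_congr fun m => by linear_combination (c m q / m) * two_mul_cos_nat_mul m (2 * x)

theorem logTheta1DivSin_eq {τ : ℂ} (hτ : 0 < τ.im) (x : ℝ) : logTheta1DivSin x τ =
    -lamZero (nome τ) - 2 * lamCos (fun m q => lamT m q / m) (2 * x) (nome τ) := by
  rw [← (hasSum_log_theta (norm_nome_lt_one hτ) two_ne_zero isLambert_lamT (fun _ => rfl) x).tsum_eq,
    logTheta1DivSin]
  refine tsum_congr fun k => ?_
  rw [← pow_mul]
  ring_nf

theorem logTheta4_eq {τ : ℂ} (hτ : 0 < τ.im) (x : ℝ) : logTheta4 x τ =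
    -lamZero (nome τ) - 2 * lamCos (fun m q => lamS m q / m) (2 * x) (nome τ) := by
  rw [← (hasSum_log_theta (norm_nome_lt_one hτ) one_ne_zero isLambert_lamS
    (fun m => by rw [lamS, one_mul]) x).tsum_eq, logTheta4]
  refine tsum_congr fun k => ?_
  rw [← pow_mul]
  ring_nf

theorem etaOverPi_eq {τ : ℂ} (hτ : 0 < τ.im) : etaOverPi τ = 1 / 12 - 2 * lamSigma (nome τ) := by
  rw [etaOverPi, lamSigma,
    ((isLambert_lamS.mul isLambert_lamS).summable_one (norm_nome_lt_one hτ)).tsum_eq_zero_add]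
  congr 2
  rw [show lamS 0 (nome τ) = 0 by simp [lamS], zero_mul, zero_add]
  refine tsum_congr fun k => ?_
  rw [lamS, div_mul_div_comm, ← sq, ← pow_mul, ← sq, mul_comm (k + 1) 2]

end LogProducts

/-! ### The Weierstrass function as a second logarithmic derivative of θ₁ -/

section WeierstrassP

variable {q τ z : ℂ}

/-- The weight 2 case of the Lipschitz formula for w/π in the upper half-plane, after summing ∑ m
ξ^m in closed form. The lower half-plane follows by w ↦ -w. -/
theorem hasSum_int_inv_sq {w : ℂ} (hw : w.im ≠ 0) :
    HasSum (fun n : ℤ => 1 / (w - n * Real.pi) ^ 2) (1 / Complex.sin w ^ 2) := by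
  wlog hpos : 0 < w.im generalizing w
  · have h := this (w := -w) (by simpa using hw) (by
      rw [Complex.neg_im]; rcases lt_or_gt_of_ne hw with h | h <;> [linarith; exact absurd h hpos])
    rw [Complex.sin_neg, neg_sq] at h
    refine ((Equiv.neg ℤ).hasSum_iff.2 h).congr_fun fun n => ?_
    simp only [Function.comp, Equiv.neg_apply, Int.cast_neg]
    congr 1
    ring
  have hπ : (Real.pi : ℂ) ≠ 0 := by exact_mod_cast Real.pi_ne_zero
  have hz : 0 < (w / Real.pi).im := by
    rw [Complex.div_ofReal_im]; exact div_pos hpos Real.pi_pos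
  have h1 := EisensteinSeries.qExpansion_identity (k := 1) le_rfl ⟨w / Real.pi, hz⟩
  have hs : Summable fun n : ℤ => 1 / (w / Real.pi + n) ^ 2 := by
    refine (EisensteinSeries.linear_right_summable (w / Real.pi) 1 (k := 2) le_rfl).congr fun n => ?_
    rw [one_div, Int.cast_one, one_mul]
    norm_cast
  have h2 : Complex.exp (2 * Real.pi * Complex.I * (w / Real.pi)) =
      Complex.exp (Complex.I * (2 * w)) := by congr 1; field_simp
  have h3 := (hasSum_coe_mul_geometric_of_norm_lt_one
    (norm_exp_lt_one (α := 2 * w) (by simpa using hpos))).tsum_eq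
  have h4 := neg_one_div_sin_half_sq (γ := 2 * w) (by simpa using hpos)
  simp only [h2, pow_one, h3] at h1
  have h5 := hs.hasSum
  norm_num at h1 h5
  rw [h1] at h5
  have h6 := ((Equiv.neg ℤ).hasSum_iff.2 h5).mul_left ((1 : ℂ) / Real.pi ^ 2)
  convert! h6 using 1
  · ext n
    simp only [Function.comp, Equiv.neg_apply, Int.cast_neg]
    rw [show w / (Real.pi : ℂ) + -(n : ℂ) = (w - n * Real.pi) / Real.pi by field_simp; ring,
      div_pow, inv_div]
    field_simp
  · rw [mul_div_cancel_left₀ w two_ne_zero] at h4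
    have : (1 : ℂ) / Complex.sin w ^ 2 = -(-1 / Complex.sin w ^ 2) := by ring
    rw [this, h4]
    field_simp
    rw [Complex.I_sq]
    ring

/-- Twice ζ(2)/π²; the term n = 0 is 1/0 = 0. -/
theorem hasSum_int_inv_sq_zero :
    HasSum (fun n : ℤ => 1 / (n * Real.pi : ℂ) ^ 2) (1 / 3) := by
  have hπ : (Real.pi : ℂ) ≠ 0 := by exact_mod_cast Real.pi_ne_zero
  have h0 : HasSum (fun n : ℕ => 1 / ((n : ℂ)) ^ 2) ((Real.pi : ℂ) ^ 2 / 6) := by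
    have := Complex.hasSum_ofReal.2 hasSum_zeta_two
    push_cast at this
    exact this
  have h1 : HasSum (fun n : ℕ => 1 / ((n : ℂ) * Real.pi) ^ 2) (1 / 6) := by
    refine hasSum_of_eq ((h0.mul_left (1 / (Real.pi : ℂ) ^ 2)).congr_fun fun n => ?_) ?_
    · rw [mul_pow, div_mul_div_comm, one_mul, mul_comm]
    · field_simp
  have h2 := (hasSum_nat_add_iff' 1).2 h1
  have h3 := HasSum.of_nat_of_neg_add_one (f := fun n : ℤ => 1 / (n * Real.pi : ℂ) ^ 2)
    (by simpa using h1) (m' := 1 / 6) ?_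
  · convert! h3 using 1; norm_num
  · simp only [Finset.range_one, Finset.sum_singleton, Nat.cast_zero, zero_mul] at h2
    refine hasSum_of_eq (h2.congr_fun fun n => ?_) (by simp)
    push_cast
    rw [neg_mul, neg_sq]

theorem exp_I_mul_two_nat (k : ℕ) (τ : ℂ) :
    Complex.exp (Complex.I * (2 * (k * (Real.pi * τ)))) = nome τ ^ (2 * k) := by
  rw [nome, ← Complex.exp_nat_mul]; congr 1; push_cast; ring

theorem one_div_sin_sq {w : ℂ} (hw : 0 < w.im) : 1 / Complex.sin w ^ 2 =
    -4 * (Complex.exp (Complex.I * (2 * w)) / (1 - Complex.exp (Complex.I * (2 * w))) ^ 2) := by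
  have h4 := neg_one_div_sin_half_sq (γ := 2 * w) (by simpa using hw)
  rw [mul_div_cancel_left₀ w two_ne_zero] at h4
  linear_combination -h4

/-- The row sums of the lattice sum defining `℘`. -/
theorem hasSum_weierstrassP_rows (hτ : 0 < τ.im) (hz0 : 0 < z.im) (hz : z.im < Real.pi * τ.im) :
    HasSum (fun n : ℤ => 1 / Complex.sin (z - n * (Real.pi * τ)) ^ 2 -
      if n = 0 then 1 / 3 else 1 / Complex.sin (n * (Real.pi * τ)) ^ 2)
      ((periods τ hτ).weierstrassP z) := by
  have h1 := ((periods τ hτ).latticeEquivProd.symm.toEquiv.hasSum_iff).2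
    ((periods τ hτ).hasSum_weierstrassP z)
  have h2 := ((Equiv.prodComm ℤ ℤ).hasSum_iff).2 h1
  have him : ∀ n : ℤ, ((n : ℂ) * (Real.pi * τ)).im = n * (Real.pi * τ.im) := fun n => by
    have : (n : ℂ) = ((n : ℝ) : ℂ) := by push_cast; rfl
    rw [this, Complex.im_ofReal_mul, Complex.im_ofReal_mul]
  have hpos : 0 < Real.pi * τ.im := mul_pos Real.pi_pos hτ
  refine h2.prod_fiberwise fun n => ?_
  have hrow : HasSum (fun m : ℤ => 1 / (z - n * (Real.pi * τ) - m * Real.pi) ^ 2)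
      (1 / Complex.sin (z - n * (Real.pi * τ)) ^ 2) := by
    -- Since 0 < Im z < π Im τ, no translate z - nπτ is real.
    apply hasSum_int_inv_sq
    rw [Complex.sub_im, him]
    rcases le_or_gt n 0 with h | h
    · have : (n : ℝ) ≤ 0 := by exact_mod_cast h
      nlinarith
    · have : (1 : ℝ) ≤ n := by exact_mod_cast h
      nlinarith
  have hconst : HasSum (fun m : ℤ => 1 / (m * Real.pi + n * (Real.pi * τ) : ℂ) ^ 2)
      (if n = 0 then 1 / 3 else 1 / Complex.sin (n * (Real.pi * τ)) ^ 2) := by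
    split_ifs with hn
    · subst hn
      simpa using hasSum_int_inv_sq_zero
    · refine ((Equiv.neg ℤ).hasSum_iff.2 (hasSum_int_inv_sq (w := n * (Real.pi * τ)) ?_)).congr_fun
        fun m => ?_
      · rw [him]
        exact mul_ne_zero (by exact_mod_cast hn) hpos.ne'
      · simp only [Function.comp, Equiv.neg_apply, Int.cast_neg]
        congr 1
        ring
  refine (hrow.sub hconst).congr_fun fun m => ?_
  have : (((periods τ hτ).latticeEquivProd.symm.toEquiv (m, n) : (periods τ hτ).lattice) : ℂ) =
      m * Real.pi + n * (Real.pi * τ) := (periods τ hτ).latticeEquiv_symm_apply (m, n)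
  simp only [Function.comp, Equiv.prodComm_apply, Prod.swap, this]
  congr 3
  ring

theorem im_natCast_succ_mul (k : ℕ) (τ : ℂ) :
    (((k + 1 : ℕ) : ℂ) * (Real.pi * τ)).im = (k + 1) * (Real.pi * τ.im) := by
  have : (((k + 1 : ℕ)) : ℂ) = ((k + 1 : ℝ) : ℂ) := by push_cast; rfl
  rw [this, Complex.im_ofReal_mul, Complex.im_ofReal_mul]

/-- Every 1/sin² is expanded as ∑ m ξ^m and the sums are interchanged. The hypothesis on z says |q|
e^{|Im 2z|} < 1. -/
theorem hasSum_one_div_sin_sq_row (hτ : 0 < τ.im) (hz : 2 * |z.im| < Real.pi * τ.im) :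
    HasSum (fun k : ℕ => 1 / Complex.sin (z + ((k + 1 : ℕ) : ℂ) * (Real.pi * τ)) ^ 2)
      (-4 * ∑' m : ℕ, (m : ℂ) * lamT m (nome τ) * Complex.exp (Complex.I * (2 * z)) ^ m) := by
  have hq := norm_nome_lt_one hτ
  have hpos : 0 < Real.pi * τ.im := mul_pos Real.pi_pos hτ
  have hn2 : ‖nome τ‖ * Real.exp |(2 * z).im| < 1 := by
    rw [norm_nome, ← Real.exp_add, Real.exp_lt_one_iff]
    have : (2 * z).im = 2 * z.im := by simp
    rw [this, abs_mul, abs_two]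
    linarith
  have him : ∀ k : ℕ, 0 < (z + ((k + 1 : ℕ) : ℂ) * (Real.pi * τ)).im := fun k => by
    rw [Complex.add_im, im_natCast_succ_mul]
    have := neg_abs_le z.im
    have : 0 ≤ (k : ℝ) * (Real.pi * τ.im) := by positivity
    nlinarith [abs_nonneg z.im]
  have hexp : ∀ k : ℕ, Complex.exp (Complex.I * (2 * (z + ((k + 1 : ℕ) : ℂ) * (Real.pi * τ)))) =
      Complex.exp (Complex.I * (2 * z)) * nome τ ^ (2 * k + 2) := fun k => by
    rw [show nome τ ^ (2 * k + 2) = nome τ ^ (2 * (k + 1)) by ring_nf, ← exp_I_mul_two_nat,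
      ← Complex.exp_add]
    congr 1
    ring
  have h := hasSum_lambert_swap (j := 2) (w := fun m => (m : ℂ) * Complex.exp (Complex.I * (2 * z)) ^ m)
    (G := fun k => Complex.exp (Complex.I * (2 * z)) * nome τ ^ (2 * k + 2) /
      (1 - Complex.exp (Complex.I * (2 * z)) * nome τ ^ (2 * k + 2)) ^ 2) hq (by simp) ?_ ?_
  · refine hasSum_of_eq ((h.mul_left (-4)).congr_fun fun k => ?_) ?_
    · rw [one_div_sin_sq (him k), hexp]
    · congr 1
      exact tsum_congr fun m => by rw [lamT]; ring
  · refine (isLambert_pow.mul isLambert_pow).natCast_mul.summable_exp hq hn2 |>.congr fun m => ?_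
    ring
  · intro k
    have h1 := norm_exp_lt_one (α := 2 * (z + ((k + 1 : ℕ) : ℂ) * (Real.pi * τ)))
      (by simpa using him k)
    rw [hexp] at h1
    exact (hasSum_coe_mul_geometric_of_norm_lt_one h1).congr_fun fun m => by rw [mul_pow]; ring

theorem hasSum_one_div_sin_sq_const (hτ : 0 < τ.im) :
    HasSum (fun k : ℕ => 1 / Complex.sin (((k + 1 : ℕ) : ℂ) * (Real.pi * τ)) ^ 2)
      (2 * etaOverPi τ - 1 / 6) := by
  have h := hasSum_one_div_sin_sq_row (z := 0) hτ (by simpa using mul_pos Real.pi_pos hτ)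
  simp only [zero_add] at h
  refine hasSum_of_eq h ?_
  rw [← h.tsum_eq, etaOverPi]
  have : ∀ k : ℕ, 1 / Complex.sin (((k + 1 : ℕ) : ℂ) * (Real.pi * τ)) ^ 2 =
      -4 * (nome τ ^ (2 * (k + 1)) / (1 - nome τ ^ (2 * (k + 1))) ^ 2) := fun k => by
    rw [one_div_sin_sq, exp_I_mul_two_nat]
    rw [im_natCast_succ_mul]
    have := mul_pos Real.pi_pos hτ
    positivity
  rw [tsum_congr this, tsum_mul_left]
  ring

/-- The rows n ≥ 1 and n ≤ -1 give the two exponential halves of the cosine series, and the row n =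
0 gives 1/sin² z. The constants add up to -1/3 - 2(2η₁/π - 1/6) = -4η₁/π. -/
theorem weierstrassP_eq_of_im_pos (hτ : 0 < τ.im) (hz0 : 0 < z.im)
    (hz : 2 * z.im < Real.pi * τ.im) :
    (periods τ hτ).weierstrassP z = -ddlogTheta1 (2 * z) (nome τ) - 4 * etaOverPi τ := by
  have hq := norm_nome_lt_one hτ
  have hz' : 2 * |z.im| < Real.pi * τ.im := by rwa [abs_of_pos hz0]
  have hn2 : ‖nome τ‖ * Real.exp |(2 * z).im| < 1 := by
    rw [norm_nome, ← Real.exp_add, Real.exp_lt_one_iff]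
    have : (2 * z).im = 2 * z.im := by simp
    rw [this, abs_mul, abs_two]
    linarith
  have h0 := hasSum_one_div_sin_sq_const hτ
  have h1 := hasSum_one_div_sin_sq_row hτ hz'
  have h2 := hasSum_one_div_sin_sq_row (z := -z) hτ (by simpa using hz')
  have h3 := HasSum.of_add_one_of_neg_add_one (f := fun n : ℤ =>
      1 / Complex.sin (z - n * (Real.pi * τ)) ^ 2 -
      if n = 0 then 1 / 3 else 1 / Complex.sin (n * (Real.pi * τ)) ^ 2)
    ((h2.sub h0).congr_fun fun k => ?_) ((h1.sub h0).congr_fun fun k => ?_)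
  · rw [(hasSum_weierstrassP_rows hτ hz0 (by linarith)).unique h3, ddlogTheta1]
    have s1 := isLambert_lamT.natCast_mul.summable_exp hq hn2
    have s2 := isLambert_lamT.natCast_mul.summable_exp_inv hq hn2
    have e : 2 * lamCos (fun m q => m * lamT m q) (2 * z) (nome τ) =
        ∑' m : ℕ, (m : ℂ) * lamT m (nome τ) * Complex.exp (Complex.I * (2 * z)) ^ m +
        ∑' m : ℕ, (m : ℂ) * lamT m (nome τ) * (Complex.exp (Complex.I * (2 * z)))⁻¹ ^ m := by
      rw [← s1.tsum_add s2, lamCos, ← tsum_mul_left]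
      exact tsum_congr fun m => by
        linear_combination (m * lamT m (nome τ)) * two_mul_cos_nat_mul m (2 * z)
    have e2 : Complex.exp (Complex.I * (2 * -z)) = (Complex.exp (Complex.I * (2 * z)))⁻¹ := by
      rw [← Complex.exp_neg]; congr 1; ring
    rw [e2, if_pos rfl, mul_div_cancel_left₀ z two_ne_zero]
    push_cast
    rw [zero_mul, sub_zero]
    linear_combination 4 * e
  · rw [if_neg (by omega)]
    congr 2
    · rw [← neg_sq, ← Complex.sin_neg]
      push_cast
      congr 3
      ring
  · rw [if_neg (by omega)]
    push_cast
    congr 2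
    · congr 3
      ring
    · rw [neg_mul, Complex.sin_neg, neg_sq]

theorem continuousAt_ddlogTheta1 (hq : ‖q‖ < 1) {x : ℝ} (hx : Complex.sin (x / 2) ≠ 0) :
    ContinuousAt (fun γ => ddlogTheta1 γ q) x := by
  unfold ddlogTheta1
  exact ContinuousAt.add (ContinuousAt.div (by fun_prop) (by fun_prop) (pow_ne_zero 2 hx))
    ((isLambert_lamT.natCast_mul.hasDerivAt_lamCos hq
      (norm_mul_exp_abs_im_ofReal hq x)).continuousAt.const_mul _)

theorem notMem_lattice (hτ : 0 < τ.im) {x : ℝ} (hx : Real.sin x ≠ 0) :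
    (x : ℂ) ∉ (periods τ hτ).lattice := by
  intro h
  obtain ⟨m, n, h⟩ := PeriodPair.mem_lattice.1 h
  have him := congrArg Complex.im h
  have hre := congrArg Complex.re h
  simp [periods, Real.pi_ne_zero, hτ.ne'] at him
  subst him
  simp [periods] at hre
  exact hx (by rw [← hre]; exact Real.sin_int_mul_pi m)

/-- Off the lattice both sides are continuous, so real x is reached from above. -/
theorem weierstrassP_eq (hτ : 0 < τ.im) {x : ℝ} (hx : Real.sin x ≠ 0) :
    (periods τ hτ).weierstrassP x = -ddlogTheta1 (2 * x) (nome τ) - 4 * etaOverPi τ := by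
  have hq := norm_nome_lt_one hτ
  have hsin : Complex.sin ((2 * x : ℂ) / 2) ≠ 0 := by
    rw [mul_div_cancel_left₀ _ two_ne_zero]; exact_mod_cast hx
  have hc1 : ContinuousAt (periods τ hτ).weierstrassP x := by
    have ho : IsOpen ((periods τ hτ).lattice : Set ℂ)ᶜ :=
      (periods τ hτ).isClosed_lattice.isOpen_compl
    exact ((periods τ hτ).differentiableOn_weierstrassP.differentiableAt
      (ho.mem_nhds (notMem_lattice hτ hx))).continuousAt
  have hc2 : ContinuousAt (fun z : ℂ => -ddlogTheta1 (2 * z) (nome τ) - 4 * etaOverPi τ) x := by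
    have h := continuousAt_ddlogTheta1 (x := 2 * x) hq (by exact_mod_cast hsin)
    have h2 : ContinuousAt (fun z : ℂ => 2 * z) x := by fun_prop
    have h3 : ContinuousAt ((fun γ => ddlogTheta1 γ (nome τ)) ∘ fun z : ℂ => 2 * z) x :=
      ContinuousAt.comp (by simpa using h) h2
    exact (h3.neg).sub_const _
  refine tendsto_nhds_unique_of_eventuallyEq (hc1.tendsto.comp (tendsto_add_mul_I x))
    (hc2.tendsto.comp (tendsto_add_mul_I x)) ?_
  have hpos := mul_pos Real.pi_pos hτ
  have hsmall : ∀ᶠ ε : ℝ in 𝓝[>] 0, ε < Real.pi * τ.im / 2 :=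
    nhdsWithin_le_nhds (gt_mem_nhds (by positivity))
  filter_upwards [self_mem_nhdsWithin, hsmall] with ε hε0 hε
  have him : ((x : ℂ) + ε * Complex.I).im = ε := by simp
  exact weierstrassP_eq_of_im_pos hτ (by rwa [him]) (by rw [him]; linarith)

end WeierstrassP

/-! ### The domain of convergence in z = cos x and q -/

section Domain

theorem IsLambert.differentiableOn_prod {c : ℕ → ℂ → ℂ} (hc : IsLambert c) {e : ℕ → ℂ → ℂ}
    {ρ : ℂ → ℝ} (he : ∀ m, Differentiable ℂ (e m)) (hρ : Continuous ρ) (hρ0 : ∀ ζ, 0 ≤ ρ ζ)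
    (hb : ∀ m ζ, ‖e m ζ‖ ≤ ρ ζ ^ m) :
    DifferentiableOn ℂ (fun p : ℂ × ℂ => ∑' m, c m p.2 * e m p.1)
      {p | ‖p.2‖ < 1 ∧ ‖p.2‖ * ρ p.1 < 1} := by
  have ho : IsOpen {p : ℂ × ℂ | ‖p.2‖ < 1 ∧ ‖p.2‖ * ρ p.1 < 1} :=
    IsOpen.and (isOpen_lt (by fun_prop) (by fun_prop)) (isOpen_lt (by fun_prop) (by fun_prop))
  refine differentiableOn_of_separately ho ?_ ?_ ?_
  · exact (hc.continuousOn (fun m => (he m).continuous) hρ hρ0 hb).comp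
      (continuous_swap.continuousOn) fun p hp => hp
  · rintro ⟨z, q⟩ ⟨h1, h2⟩
    obtain ⟨R, hR, hR1⟩ := exists_between h2
    have hR0 : 0 ≤ R := (mul_nonneg (norm_nonneg _) (hρ0 _)).trans hR.le
    obtain ⟨u, hu, h⟩ := hc.exists_summable_bound h1 hR0 hR1
    have ho : IsOpen {ζ : ℂ | ‖q‖ * ρ ζ < R} := isOpen_lt (by fun_prop) (by fun_prop)
    exact (Complex.differentiableOn_tsum_of_summable_norm hu
      (fun m => ((he m).const_mul _).differentiableOn) ho
      fun m ζ hζ => h m q (ρ ζ) (e m ζ) le_rfl (hρ0 _) (le_of_lt hζ) (hb m ζ)).differentiableAt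
      (ho.mem_nhds hR)
  · rintro ⟨z, q⟩ ⟨h1, h2⟩
    exact (hc.hasDerivAt_nome h1 (hρ0 z) h2 (hb · z)).differentiableAt

/-- The sum `ρ` of the semi-axes of the ellipse through `z` with foci `±1`. -/
noncomputable def ellipseRho (z : ℂ) : ℝ :=
  (‖z - 1‖ + ‖z + 1‖) / 2 + √(((‖z - 1‖ + ‖z + 1‖) / 2) ^ 2 - 1)

theorem continuous_ellipseRho : Continuous ellipseRho := by unfold ellipseRho; fun_prop

theorem ellipseRho_nonneg (z : ℂ) : 0 ≤ ellipseRho z := by unfold ellipseRho; positivity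

theorem norm_sin_half_sq (α : ℂ) : 2 * ‖Complex.sin (α / 2)‖ ^ 2 =
    Real.cosh α.im - Real.cos α.re := by
  have h := Complex.sq_norm (Complex.sin (α / 2))
  rw [Complex.normSq_apply] at h
  have e : α / 2 = ((α.re / 2 : ℝ) : ℂ) + ((α.im / 2 : ℝ) : ℂ) * Complex.I := by
    conv_lhs => rw [← Complex.re_add_im α]
    push_cast; ring
  rw [e, Complex.sin_add_mul_I, ← Complex.ofReal_sin, ← Complex.ofReal_cos, ← Complex.ofReal_cosh,
    ← Complex.ofReal_sinh] at h
  simp only [Complex.add_re, Complex.mul_re, Complex.ofReal_re, Complex.ofReal_im, Complex.I_re,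
    Complex.I_im, Complex.add_im, Complex.mul_im] at h
  rw [e, Complex.sin_add_mul_I, ← Complex.ofReal_sin, ← Complex.ofReal_cos, ← Complex.ofReal_cosh,
    ← Complex.ofReal_sinh, h]
  clear h e
  have h1 := Real.cosh_sq (α.im / 2)
  have h2 := Real.cosh_two_mul (α.im / 2)
  have h3 := Real.cos_sq_add_sin_sq (α.re / 2)
  have h4 := Real.cos_two_mul (α.re / 2)
  rw [mul_div_cancel₀ _ two_ne_zero] at h2 h4
  have h5 : Real.sin (α.re / 2) ^ 2 = 1 - Real.cos (α.re / 2) ^ 2 := by linarith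
  rw [h2, h4]
  ring_nf at h1 h5 ⊢
  rw [h5, h1]
  ring

/-- The point cos α lies on the ellipse with foci ±1 and semi-axes cosh|Im α|, sinh|Im α|: the focal
distances |cos α ∓ 1| equal cosh(Im α) ∓ cos(Re α). This converts bounds in α into bounds in z that
do not depend on the choice of α. -/
theorem ellipseRho_cos (α : ℂ) : ellipseRho (Complex.cos α) = Real.exp |α.im| := by
  have h1 : ‖Complex.cos α - 1‖ = Real.cosh α.im - Real.cos α.re := by
    rw [← norm_sin_half_sq]
    have : Complex.cos α - 1 = -(2 * Complex.sin (α / 2) ^ 2) := by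
      have := Complex.cos_two_mul (α / 2)
      rw [mul_div_cancel₀ _ two_ne_zero] at this
      linear_combination this + 2 * Complex.sin_sq_add_cos_sq (α / 2)
    rw [this, norm_neg, norm_mul, norm_pow, Complex.norm_ofNat]
  have h2 : ‖Complex.cos α + 1‖ = Real.cosh α.im + Real.cos α.re := by
    have h := norm_sin_half_sq (Real.pi - α)
    have : Complex.cos α + 1 = 2 * Complex.sin ((Real.pi - α) / 2) ^ 2 := by
      have := Complex.cos_two_mul ((Real.pi - α) / 2)
      rw [mul_div_cancel₀ _ two_ne_zero, Complex.cos_pi_sub] at this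
      linear_combination -this - 2 * Complex.sin_sq_add_cos_sq ((Real.pi - α) / 2)
    rw [this, norm_mul, norm_pow, Complex.norm_ofNat, h]
    simp
  have h3 : (Real.cosh α.im - Real.cos α.re + (Real.cosh α.im + Real.cos α.re)) / 2 =
      Real.cosh α.im := by ring
  rw [ellipseRho, h1, h2, h3]
  have h4 : Real.cosh α.im ^ 2 - 1 = Real.sinh |α.im| ^ 2 := by
    rw [Real.cosh_sq, ← Real.abs_sinh, sq_abs]; ring
  rw [h4, Real.sqrt_sq (Real.sinh_nonneg_iff.2 (abs_nonneg _)), ← Real.cosh_abs,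
    Real.cosh_add_sinh]

theorem ellipseRho_cos_ofReal (x : ℝ) : ellipseRho (Complex.cos x) = 1 := by
  rw [ellipseRho_cos]; simp

theorem ellipseRho_ofReal {x : ℝ} (hx : x ∈ Icc (-1 : ℝ) 1) : ellipseRho x = 1 := by
  rw [← Real.cos_arccos hx.1 hx.2, Complex.ofReal_cos, ellipseRho_cos_ofReal]

theorem norm_chebyshevT_eval_le (m : ℕ) (z : ℂ) :
    ‖(Polynomial.Chebyshev.T ℂ m).eval z‖ ≤ ellipseRho z ^ m := by
  obtain ⟨α, rfl⟩ := Complex.cos_surjective z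
  rw [Polynomial.Chebyshev.T_complex_cos, ellipseRho_cos, Int.cast_natCast]
  exact norm_cos_nat_mul_le m α

/-- The pairs `(z, q)` for which `∑ q^m T_m(z)` converges. -/
def kernelDomain : Set (ℂ × ℂ) := {p | ‖p.2‖ < 1 ∧ ‖p.2‖ * ellipseRho p.1 < 1}

theorem isOpen_kernelDomain : IsOpen kernelDomain :=
  IsOpen.and (isOpen_lt (by fun_prop) (by fun_prop))
    (isOpen_lt (continuous_snd.norm.mul (continuous_ellipseRho.comp continuous_fst)) (by fun_prop))

theorem cos_mem_kernelDomain (x : ℝ) {q : ℂ} (hq : ‖q‖ < 1) : (Complex.cos x, q) ∈ kernelDomain :=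
  ⟨hq, by rwa [ellipseRho_cos_ofReal, mul_one]⟩

theorem ofReal_mem_kernelDomain {x : ℝ} (hx : x ∈ Icc (-1 : ℝ) 1) {q : ℂ} (hq : ‖q‖ < 1) :
    ((x : ℂ), q) ∈ kernelDomain :=
  ⟨hq, by rwa [ellipseRho_ofReal hx, mul_one]⟩

end Domain

/-! ### The kernel, the reduced transform and their symmetries -/

section Kernel

/-- `log (θ₁(y) / sin y)` as a function of the nome. -/
noncomputable def weightLog (y : ℂ) (q : ℂ) : ℂ :=
  -lamZero q - 2 * lamCos (fun m q => lamT m q / m) (2 * y) q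

/-- `-log (θ₄((x + y) / 2) θ₄((x - y) / 2))` as a function of `z = cos x`, `y` and the nome. -/
noncomputable def kernelLog (z : ℂ) (y : ℝ) (q : ℂ) : ℂ :=
  2 * lamZero q + 4 * ∑' m : ℕ, lamS m q / m *
    ((Polynomial.Chebyshev.T ℂ m).eval z * Complex.cos (m * y))

theorem logTheta1DivSin_eq_weightLog {τ : ℂ} (hτ : 0 < τ.im) (x : ℝ) :
    logTheta1DivSin x τ = weightLog x (nome τ) := logTheta1DivSin_eq hτ x

theorem norm_cos_natCast_mul_ofReal_le (m : ℕ) (y : ℝ) : ‖Complex.cos (m * y)‖ ≤ 1 := by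
  simpa using norm_cos_nat_mul_le m (y : ℂ)

theorem norm_chebyshevT_mul_cos_le (m : ℕ) (z : ℂ) (y : ℝ) :
    ‖(Polynomial.Chebyshev.T ℂ m).eval z * Complex.cos (m * y)‖ ≤ ellipseRho z ^ m := by
  rw [norm_mul]
  exact (mul_le_of_le_one_right (norm_nonneg _) (norm_cos_natCast_mul_ofReal_le m y)).trans
    (norm_chebyshevT_eval_le m z)

theorem differentiableOn_lamZero : DifferentiableOn ℂ lamZero (Metric.ball 0 1) := by
  intro q hq
  have h := (isLambert_lamT.div_natCast.hasDerivAt_nome (q := q) (ρ := 1) (e := fun _ => 1)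
    (by simpa using hq) zero_le_one (by simpa using hq) (by simp)).differentiableAt
  simp only [mul_one] at h
  exact h.differentiableWithinAt

/-- The product formula 2 cos(mx) cos(my) = cos m(x+y) + cos m(x-y). The form with T_m(z) is the one
that extends to complex z. -/
theorem kernelLog_cos {q : ℂ} (hq : ‖q‖ < 1) (x y : ℝ) : kernelLog (Complex.cos x) y q =
    2 * lamZero q + 2 * lamCos (fun m q => lamS m q / m) ((x + y : ℝ) : ℂ) q +
      2 * lamCos (fun m q => lamS m q / m) ((x - y : ℝ) : ℂ) q := by
  have h1 := isLambert_lamS.div_natCast.hasSum_lamCos hq (norm_mul_exp_abs_im_ofReal hq (x + y))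
  have h2 := isLambert_lamS.div_natCast.hasSum_lamCos hq (norm_mul_exp_abs_im_ofReal hq (x - y))
  have h3 := (h1.add h2).mul_left (1 / 2)
  rw [kernelLog, (h3.congr_fun fun m => ?_).tsum_eq]
  · ring
  · rw [Polynomial.Chebyshev.T_complex_cos, Int.cast_natCast]
    push_cast
    rw [mul_add (m : ℂ), mul_sub (m : ℂ), Complex.cos_add, Complex.cos_sub]
    ring

theorem theta4Pow_mul_theta4Pow {τ : ℂ} (hτ : 0 < τ.im) (c : ℝ) (x y : ℝ) :
    theta4Pow c ((x + y) / 2) τ * theta4Pow c ((x - y) / 2) τ =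
      (Complex.exp (c * kernelLog (Complex.cos x) y (nome τ)))⁻¹ := by
  rw [theta4Pow, theta4Pow, logTheta4_eq hτ, logTheta4_eq hτ, ← Complex.exp_add, ← Complex.exp_neg,
    kernelLog_cos (norm_nome_lt_one hτ)]
  congr 1
  have e : ∀ s : ℝ, (2 : ℂ) * ((s / 2 : ℝ) : ℂ) = (s : ℂ) := fun s => by push_cast; ring
  rw [e, e]
  ring

theorem differentiableOn_kernelLog (y : ℝ) :
    DifferentiableOn ℂ (fun p : ℂ × ℂ => kernelLog p.1 y p.2) kernelDomain := by
  unfold kernelLog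
  refine DifferentiableOn.add ?_ (DifferentiableOn.const_mul ?_ _)
  · exact (differentiableOn_lamZero.comp differentiableOn_snd fun p hp => by simpa using hp.1).const_mul _
  · exact isLambert_lamS.div_natCast.differentiableOn_prod
      (e := fun m z => (Polynomial.Chebyshev.T ℂ m).eval z * Complex.cos (m * y))
      (fun m => (Polynomial.Chebyshev.T ℂ m).differentiable.mul_const _) continuous_ellipseRho
      ellipseRho_nonneg fun m z => norm_chebyshevT_mul_cos_le m z y

theorem continuousOn_kernelLog :
    ContinuousOn (fun p : (ℂ × ℂ) × ℝ => kernelLog p.1.1 p.2 p.1.2) (kernelDomain ×ˢ univ) := by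
  unfold kernelLog
  refine ContinuousOn.add ?_ (ContinuousOn.const_mul ?_ _)
  · refine ContinuousOn.const_mul (differentiableOn_lamZero.continuousOn.comp (by fun_prop) ?_) _
    rintro p ⟨hp, -⟩
    simpa using hp.1
  · have h := isLambert_lamS.div_natCast.continuousOn (Z := ℂ × ℝ)
      (e := fun m p => (Polynomial.Chebyshev.T ℂ m).eval p.1 * Complex.cos (m * p.2))
      (ρ := fun p => ellipseRho p.1)
      (fun m => by fun_prop) (continuous_ellipseRho.comp continuous_fst)
      (fun p => ellipseRho_nonneg p.1) fun m p => norm_chebyshevT_mul_cos_le m p.1 p.2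
    exact h.comp (f := fun p : (ℂ × ℂ) × ℝ => (p.1.2, (p.1.1, p.2))) (by fun_prop)
      fun p hp => hp.1

theorem differentiableOn_weightLog :
    DifferentiableOn ℂ (fun p : ℂ × ℂ => weightLog p.1 p.2)
      {p | ‖p.2‖ < 1 ∧ ‖p.2‖ * Real.exp |(2 * p.1).im| < 1} := by
  unfold weightLog
  refine DifferentiableOn.sub ?_ (DifferentiableOn.const_mul ?_ _)
  · exact (differentiableOn_lamZero.comp differentiableOn_snd fun p hp => by simpa using hp.1).neg
  · exact isLambert_lamT.div_natCast.differentiableOn_prod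
      (e := fun m z => Complex.cos (m * (2 * z))) (ρ := fun z => Real.exp |(2 * z).im|)
      (fun m => by fun_prop) (by fun_prop) (fun _ => (Real.exp_pos _).le)
      fun m z => norm_cos_nat_mul_le m (2 * z)

theorem norm_mul_exp_abs_im_two_mul {q : ℂ} (hq : ‖q‖ < 1) (y : ℝ) :
    ‖q‖ < 1 ∧ ‖q‖ * Real.exp |(2 * (y : ℂ)).im| < 1 := ⟨hq, by simpa using hq⟩

/-- The integrand of `R`, where the transform is
`q^{-n} M (θ₁(x)²)^{(g + κ)/2} R(cos x, q)`. -/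
noncomputable def coreIntegrand (b c : ℝ) (P : ℂ × ℂ → ℂ) (p : ℂ × ℂ) (y : ℝ) : ℂ :=
  (((Real.sin y ^ 2) ^ b : ℝ) : ℂ) *
    (Complex.exp (2 * b * weightLog y p.2 + c * kernelLog p.1 y p.2) * P (Complex.cos y, p.2))

noncomputable def coreIntegral (b c : ℝ) (P : ℂ × ℂ → ℂ) (p : ℂ × ℂ) : ℂ :=
  1 / (2 * Real.pi) * ∫ y in (-Real.pi)..Real.pi, coreIntegrand b c P p y

variable {b c : ℝ} {q : ℂ} {P : ℂ × ℂ → ℂ} {Ω : Set (ℂ × ℂ)}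

theorem continuous_sin_sq_rpow (hb : 0 ≤ b) : Continuous fun y : ℝ => (Real.sin y ^ 2) ^ b :=
  (Real.continuous_sin.pow 2).rpow_const fun _ => Or.inr hb

theorem continuousOn_coreIntegrand (hb : 0 ≤ b) (hP : ContinuousOn P Ω)
    (hmem : ∀ (y : ℝ) (q : ℂ), ‖q‖ < 1 → (Complex.cos y, q) ∈ Ω) :
    ContinuousOn (fun p : (ℂ × ℂ) × ℝ => coreIntegrand b c P p.1 p.2) (kernelDomain ×ˢ univ) := by
  unfold coreIntegrand
  refine ContinuousOn.mul ?_ (ContinuousOn.mul ?_ ?_)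
  · exact (Complex.continuous_ofReal.comp
      ((continuous_sin_sq_rpow hb).comp continuous_snd)).continuousOn
  · refine ContinuousOn.cexp (ContinuousOn.add ?_ (continuousOn_kernelLog.const_mul _))
    refine ContinuousOn.const_mul (differentiableOn_weightLog.continuousOn.comp
      (f := fun p : (ℂ × ℂ) × ℝ => ((p.2 : ℂ), p.1.2)) (by fun_prop) ?_) _
    rintro p ⟨hp, -⟩
    exact norm_mul_exp_abs_im_two_mul hp.1 _
  · refine hP.comp (f := fun p : (ℂ × ℂ) × ℝ => (Complex.cos p.2, p.1.2)) (by fun_prop) ?_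
    rintro p ⟨hp, -⟩
    exact hmem _ _ hp.1

theorem differentiableOn_coreIntegrand (hP : DifferentiableOn ℂ P Ω)
    (hmem : ∀ (y : ℝ) (q : ℂ), ‖q‖ < 1 → (Complex.cos y, q) ∈ Ω) (y : ℝ) :
    DifferentiableOn ℂ (fun p => coreIntegrand b c P p y) kernelDomain := by
  unfold coreIntegrand
  refine DifferentiableOn.const_mul (DifferentiableOn.mul ?_ ?_) _
  · refine DifferentiableOn.cexp (DifferentiableOn.add ?_ ((differentiableOn_kernelLog y).const_mul _))
    refine DifferentiableOn.const_mul (differentiableOn_weightLog.comp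
      (f := fun p : ℂ × ℂ => ((y : ℂ), p.2)) (by fun_prop) ?_) _
    intro p hp
    exact norm_mul_exp_abs_im_two_mul hp.1 _
  · refine hP.comp (f := fun p : ℂ × ℂ => (Complex.cos y, p.2)) (by fun_prop) ?_
    intro p hp
    exact hmem _ _ hp.1

/-- The domain includes q = 0, so the integral has a Taylor expansion in the nome there. -/
theorem differentiableOn_coreIntegral (hb : 0 ≤ b) (hP : DifferentiableOn ℂ P Ω)
    (hmem : ∀ (y : ℝ) (q : ℂ), ‖q‖ < 1 → (Complex.cos y, q) ∈ Ω) :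
    DifferentiableOn ℂ (coreIntegral b c P) kernelDomain := by
  unfold coreIntegral
  refine DifferentiableOn.const_mul (differentiableOn_intervalIntegral
    (by linarith [Real.pi_pos]) isOpen_kernelDomain ?_ ?_) _
  · exact (continuousOn_coreIntegrand hb hP.continuousOn hmem).mono
      (prod_mono subset_rfl (subset_univ _))
  · exact fun y _ => differentiableOn_coreIntegrand hP hmem y

theorem neg_one_pow_mul_self (m : ℕ) : (-1 : ℂ) ^ m * (-1) ^ m = 1 := by
  rw [← mul_pow]; simp

theorem chebyshevT_eval_neg (m : ℕ) (z : ℂ) : (Polynomial.Chebyshev.T ℂ m).eval (-z) =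
    (-1) ^ m * (Polynomial.Chebyshev.T ℂ m).eval z := by
  rw [Polynomial.Chebyshev.T_eval_neg, ← Int.cast_negOnePow_natCast]

/-- T_m(-z) and the m-th coefficient at -q both acquire the sign (-1)^m. -/
theorem kernelLog_neg_neg (z : ℂ) (y : ℝ) (q : ℂ) : kernelLog (-z) y (-q) = kernelLog z y q := by
  simp only [kernelLog, lamZero, lamT_neg, lamS_neg]
  congr 2
  refine tsum_congr fun m => ?_
  rw [chebyshevT_eval_neg]
  linear_combination (lamS m q / m * ((Polynomial.Chebyshev.T ℂ m).eval z * Complex.cos (m * y))) *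
    neg_one_pow_mul_self m

theorem kernelLog_neg_pi_sub (z : ℂ) (y : ℝ) (q : ℂ) :
    kernelLog (-z) (Real.pi - y) q = kernelLog z y q := by
  simp only [kernelLog]
  congr 2
  refine tsum_congr fun m => ?_
  have h : Complex.cos (m * ((Real.pi - y : ℝ) : ℂ)) = (-1) ^ m * Complex.cos (m * y) := by
    have := Real.cos_nat_mul_pi_sub (m * y) m
    have e : (m : ℝ) * Real.pi - m * y = m * (Real.pi - y) := by ring
    rw [e] at this
    exact_mod_cast this
  rw [chebyshevT_eval_neg, h]
  linear_combination (lamS m q / m * ((Polynomial.Chebyshev.T ℂ m).eval z * Complex.cos (m * y))) *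
    neg_one_pow_mul_self m

theorem kernelLog_add_two_pi (z : ℂ) (y : ℝ) (q : ℂ) :
    kernelLog z (y + 2 * Real.pi) q = kernelLog z y q := by
  simp only [kernelLog]
  congr 2
  refine tsum_congr fun m => ?_
  have h : Complex.cos (m * ((y + 2 * Real.pi : ℝ) : ℂ)) = Complex.cos (m * y) := by
    push_cast
    rw [mul_add, Complex.cos_add_nat_mul_two_pi]
  rw [h]

theorem weightLog_neg_nome (y q : ℂ) : weightLog y (-q) = weightLog y q := by
  simp only [weightLog, lamZero, lamCos, lamT_neg]

theorem weightLog_pi_sub (y q : ℂ) : weightLog (Real.pi - y) q = weightLog y q := by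
  simp only [weightLog, lamCos]
  congr 2
  refine tsum_congr fun m => ?_
  have h : Complex.cos (m * (2 * (Real.pi - y))) = Complex.cos (m * (2 * y)) := by
    rw [← Complex.cos_nat_mul_two_pi_sub _ m]
    ring_nf
  rw [h]

theorem weightLog_add_pi (y q : ℂ) : weightLog (y + Real.pi) q = weightLog y q := by
  simp only [weightLog, lamCos]
  congr 2
  refine tsum_congr fun m => ?_
  have h : Complex.cos (m * (2 * (y + Real.pi))) = Complex.cos (m * (2 * y)) := by
    rw [show (m : ℂ) * (2 * (y + Real.pi)) = m * (2 * y) + m * (2 * Real.pi) by ring,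
      Complex.cos_add_nat_mul_two_pi]
  rw [h]

theorem coreIntegrand_periodic (p : ℂ × ℂ) :
    Function.Periodic (coreIntegrand b c P p) (2 * Real.pi) := by
  intro y
  simp only [coreIntegrand]
  rw [Real.sin_add_two_pi, kernelLog_add_two_pi]
  have h1 : Complex.cos ((y + 2 * Real.pi : ℝ) : ℂ) = Complex.cos y := by
    push_cast
    exact Complex.cos_add_two_pi _
  have h2 : weightLog ((y + 2 * Real.pi : ℝ) : ℂ) p.2 = weightLog y p.2 := by
    rw [show ((y + 2 * Real.pi : ℝ) : ℂ) = y + Real.pi + Real.pi by push_cast; ring,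
      weightLog_add_pi, weightLog_add_pi]
  rw [h1, h2]

theorem coreIntegral_neg_neg (hq : ∀ (y : ℝ), P (Complex.cos y, -q) = P (Complex.cos y, q)) (z : ℂ) :
    coreIntegral b c P (-z, -q) = coreIntegral b c P (z, q) := by
  simp only [coreIntegral, coreIntegrand, kernelLog_neg_neg, weightLog_neg_nome, hq]

/-- Substitute y ↦ π - y, which preserves kernel and weight. The interval becomes [0, 2π], and
periodicity moves it back. -/
theorem coreIntegral_neg {n : ℕ}
    (hq : ∀ y : ℝ, P (-Complex.cos y, q) = (-1) ^ n * P (Complex.cos y, q)) (z : ℂ) :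
    coreIntegral b c P (-z, q) = (-1) ^ n * coreIntegral b c P (z, q) := by
  have h1 : ∀ y : ℝ, coreIntegrand b c P (-z, q) (Real.pi - y) =
      (-1) ^ n * coreIntegrand b c P (z, q) y := fun y => by
    have hc : Complex.cos ((Real.pi - y : ℝ) : ℂ) = -Complex.cos y := by
      push_cast; exact Complex.cos_pi_sub _
    simp only [coreIntegrand]
    rw [hc, hq, kernelLog_neg_pi_sub, Real.sin_pi_sub, Complex.ofReal_sub, weightLog_pi_sub]
    ring
  have h2 := intervalIntegral.integral_comp_sub_left (coreIntegrand b c P (-z, q)) Real.pi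
    (a := 0) (b := 2 * Real.pi)
  have h3 := (coreIntegrand_periodic (b := b) (c := c) (P := P) (z, q)).intervalIntegral_add_eq
    (-Real.pi) 0
  rw [show Real.pi - 2 * Real.pi = -Real.pi by ring, sub_zero] at h2
  rw [show -Real.pi + 2 * Real.pi = Real.pi by ring, zero_add] at h3
  simp only [h1, intervalIntegral.integral_const_mul] at h2
  rw [coreIntegral, coreIntegral, ← h2, h3]
  ring

end Kernel

/-! ### Derivatives of the kernel and of the weight -/

section KernelDerivatives

variable {q : ℂ} {c : ℕ → ℂ → ℂ}

theorem IsLambert.hasDerivAt_lamCos_ofReal (hc : IsLambert c) (hq : ‖q‖ < 1) (x : ℝ) :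
    HasDerivAt (fun x : ℝ => lamCos c x q) (-lamSin (fun m q => m * c m q) x q) x :=
  (hc.hasDerivAt_lamCos hq (norm_mul_exp_abs_im_ofReal hq x)).comp_ofReal

theorem IsLambert.hasDerivAt_lamSin_ofReal (hc : IsLambert c) (hq : ‖q‖ < 1) (x : ℝ) :
    HasDerivAt (fun x : ℝ => lamSin c x q) (lamCos (fun m q => m * c m q) x q) x :=
  (hc.hasDerivAt_lamSin hq (norm_mul_exp_abs_im_ofReal hq x)).comp_ofReal

theorem IsLambert.continuous_lamCos (hc : IsLambert c) (hq : ‖q‖ < 1) :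
    Continuous fun x : ℝ => lamCos c x q :=
  continuous_iff_continuousAt.2 fun x => (hc.hasDerivAt_lamCos_ofReal hq x).continuousAt

theorem IsLambert.continuous_lamSin (hc : IsLambert c) (hq : ‖q‖ < 1) :
    Continuous fun x : ℝ => lamSin c x q :=
  continuous_iff_continuousAt.2 fun x => (hc.hasDerivAt_lamSin_ofReal hq x).continuousAt

theorem lamSin_natCast_mul_div (x : ℂ) :
    lamSin (fun m q => m * (c m q / m)) x q = lamSin c x q :=
  tsum_congr fun m => by
    rcases eq_or_ne m 0 with rfl | hm
    · simp
    · have : (m : ℂ) ≠ 0 := by exact_mod_cast hm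
      simp only
      field_simp

theorem lamS_zero (q : ℂ) : lamS 0 q = 0 := by simp [lamS]
theorem hasDerivAt_logTheta4Cos (hq : ‖q‖ < 1) (x : ℝ) :
    HasDerivAt (fun x : ℝ => lamCos (fun m q => lamS m q / m) x q) (-lamSin lamS x q) x := by
  have h := isLambert_lamS.div_natCast.hasDerivAt_lamCos_ofReal hq x
  rwa [lamSin_natCast_mul_div] at h

/-- The m produced by q ∂_q cancels the denominator m, except at m = 0, where the value of d has to
be 0. -/
theorem IsLambert.mul_deriv_lamCos (hc : IsLambert c) (hq : ‖q‖ < 1) {d : ℕ → ℂ → ℂ}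
    (hd : ∀ m, q * deriv (c m) q = m * d m q) (hc0 : d 0 q = 0) (x : ℝ) :
    DifferentiableAt ℂ (fun q => lamCos (fun m q => c m q / m) x q) q ∧
    q * deriv (fun q => lamCos (fun m q => c m q / m) x q) q = lamCos d x q := by
  have h := hc.div_natCast.hasDerivAt_nome (q := q) (ρ := 1)
    (e := fun m => Complex.cos (m * x)) hq zero_le_one (by simpa using hq)
    (fun m => by simpa using norm_cos_nat_mul_le m (x : ℂ))
  refine ⟨h.differentiableAt, ?_⟩
  have h2 : deriv (fun q => lamCos (fun m q => c m q / m) x q) q = _ := h.deriv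
  rw [h2, ← tsum_mul_left, lamCos]
  refine tsum_congr fun m => ?_
  rw [deriv_div_const]
  rcases eq_or_ne m 0 with rfl | hm
  · simp [hc0]
  · have : (m : ℂ) ≠ 0 := by exact_mod_cast hm
    have := hd m
    field_simp
    linear_combination Complex.cos (m * x) * this

theorem mul_deriv_logTheta4Cos (hq : ‖q‖ < 1) (x : ℝ) :
    DifferentiableAt ℂ (fun q => lamCos (fun m q => lamS m q / m) x q) q ∧
    q * deriv (fun q => lamCos (fun m q => lamS m q / m) x q) q =
      lamCos (fun m q => lamS m q * (1 + 2 * lamT m q)) x q :=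
  isLambert_lamS.mul_deriv_lamCos hq (fun _ => mul_deriv_lamS hq) (by simp [lamS_zero]) x

theorem lamCos_const_mul (a : ℂ) (x : ℂ) :
    lamCos (fun m q => a * c m q) x q = a * lamCos c x q := by
  simp only [lamCos, mul_assoc, tsum_mul_left]

theorem mul_deriv_logTheta1Cos (hq : ‖q‖ < 1) (x : ℝ) :
    DifferentiableAt ℂ (fun q => lamCos (fun m q => lamT m q / m) x q) q ∧
    q * deriv (fun q => lamCos (fun m q => lamT m q / m) x q) q =
      2 * lamCos (fun m q => lamS m q * lamS m q) x q := by
  rw [← lamCos_const_mul]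
  exact isLambert_lamT.mul_deriv_lamCos hq (fun m => by rw [mul_deriv_lamT hq]; ring)
    (by simp [lamS_zero]) x

theorem mul_deriv_lamZero (hq : ‖q‖ < 1) : DifferentiableAt ℂ lamZero q ∧
    q * deriv lamZero q = 2 * lamSigma q := by
  have h := mul_deriv_logTheta1Cos hq 0
  have e : ∀ c : ℕ → ℂ → ℂ, (fun q => lamCos c ((0 : ℝ) : ℂ) q) = fun q => ∑' m, c m q := fun c => by
    ext q; simp [lamCos]
  have e2 := congrFun (e (fun m q => lamS m q * lamS m q)) q
  rw [e, e2] at h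
  exact h

theorem kernelLog_nome (hq : ‖q‖ < 1) (x y : ℝ) :
    DifferentiableAt ℂ (fun q => kernelLog (Complex.cos x) y q) q ∧
    q * deriv (fun q => kernelLog (Complex.cos x) y q) q = 4 * lamSigma q +
      2 * lamCos (fun m q => lamS m q * (1 + 2 * lamT m q)) ((x + y : ℝ) : ℂ) q +
      2 * lamCos (fun m q => lamS m q * (1 + 2 * lamT m q)) ((x - y : ℝ) : ℂ) q := by
  have h0 := mul_deriv_lamZero hq
  have h1 := mul_deriv_logTheta4Cos hq (x + y)
  have h2 := mul_deriv_logTheta4Cos hq (x - y)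
  have h := ((h0.1.hasDerivAt.const_mul 2).add (h1.1.hasDerivAt.const_mul 2)).add
    (h2.1.hasDerivAt.const_mul 2)
  have he : (fun q => kernelLog (Complex.cos x) y q) =ᶠ[𝓝 q] fun q =>
      2 * lamZero q + 2 * lamCos (fun m q => lamS m q / m) ((x + y : ℝ) : ℂ) q +
        2 * lamCos (fun m q => lamS m q / m) ((x - y : ℝ) : ℂ) q := by
    filter_upwards [(isOpen_lt continuous_norm continuous_const).mem_nhds hq] with q' hq'
    exact kernelLog_cos hq' x y
  have h3 := h.congr_of_eventuallyEq he
  refine ⟨h3.differentiableAt, ?_⟩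
  rw [h3.deriv]
  linear_combination 2 * h0.2 + 2 * h1.2 + 2 * h2.2

theorem weightLog_nome (hq : ‖q‖ < 1) (y : ℝ) :
    DifferentiableAt ℂ (fun q => weightLog y q) q ∧
    q * deriv (fun q => weightLog y q) q = -2 * lamSigma q -
      4 * lamCos (fun m q => lamS m q * lamS m q) ((2 * y : ℝ) : ℂ) q := by
  have h0 := mul_deriv_lamZero hq
  have h1 := mul_deriv_logTheta1Cos hq (2 * y)
  have h := h0.1.hasDerivAt.neg.sub (h1.1.hasDerivAt.const_mul 2)
  have he : (fun q => weightLog y q) = fun q => -lamZero q -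
      2 * lamCos (fun m q => lamT m q / m) ((2 * y : ℝ) : ℂ) q := by
    ext q; simp [weightLog]
  rw [he]
  have h3 : HasDerivAt (fun q => -lamZero q -
      2 * lamCos (fun m q => lamT m q / m) ((2 * y : ℝ) : ℂ) q) _ q := h
  refine ⟨h3.differentiableAt, ?_⟩
  rw [h3.deriv]
  linear_combination -h0.2 - 2 * h1.2

theorem hasDerivAt_kernelLog_left (hq : ‖q‖ < 1) (x y : ℝ) :
    HasDerivAt (fun x : ℝ => kernelLog (Complex.cos x) y q)
      (-2 * (lamSin lamS ((x + y : ℝ) : ℂ) q + lamSin lamS ((x - y : ℝ) : ℂ) q)) x := by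
  simp only [kernelLog_cos hq]
  have h1 := (hasDerivAt_logTheta4Cos hq (x + y)).scomp x ((hasDerivAt_id x).add_const y)
  have h2 := (hasDerivAt_logTheta4Cos hq (x - y)).scomp x ((hasDerivAt_id x).sub_const y)
  convert! ((h1.const_mul 2).const_add (2 * lamZero q)).add (h2.const_mul 2) using 1
  simp only [one_smul]
  ring

theorem hasDerivAt_kernelLog_right (hq : ‖q‖ < 1) (x y : ℝ) :
    HasDerivAt (fun y : ℝ => kernelLog (Complex.cos x) y q)
      (-2 * (lamSin lamS ((x + y : ℝ) : ℂ) q - lamSin lamS ((x - y : ℝ) : ℂ) q)) y := by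
  simp only [kernelLog_cos hq]
  have h1 := (hasDerivAt_logTheta4Cos hq (x + y)).scomp y ((hasDerivAt_id y).const_add x)
  have h2 := (hasDerivAt_logTheta4Cos hq (x - y)).scomp y ((hasDerivAt_id y).const_sub x)
  convert! ((h1.const_mul 2).const_add (2 * lamZero q)).add (h2.const_mul 2) using 1
  simp only [one_smul, neg_smul]
  ring

theorem hasDerivAt_lamSin_add_left (hq : ‖q‖ < 1) (x y : ℝ) :
    HasDerivAt (fun x : ℝ => lamSin lamS ((x + y : ℝ) : ℂ) q + lamSin lamS ((x - y : ℝ) : ℂ) q)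
      (lamCos (fun m q => m * lamS m q) ((x + y : ℝ) : ℂ) q +
        lamCos (fun m q => m * lamS m q) ((x - y : ℝ) : ℂ) q) x := by
  have h1 := (isLambert_lamS.hasDerivAt_lamSin_ofReal hq (x + y)).scomp x
    ((hasDerivAt_id x).add_const y)
  have h2 := (isLambert_lamS.hasDerivAt_lamSin_ofReal hq (x - y)).scomp x
    ((hasDerivAt_id x).sub_const y)
  convert! h1.add h2 using 1
  simp only [one_smul]

theorem hasDerivAt_lamSin_sub_right (hq : ‖q‖ < 1) (x y : ℝ) :
    HasDerivAt (fun y : ℝ => lamSin lamS ((x + y : ℝ) : ℂ) q - lamSin lamS ((x - y : ℝ) : ℂ) q)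
      (lamCos (fun m q => m * lamS m q) ((x + y : ℝ) : ℂ) q +
        lamCos (fun m q => m * lamS m q) ((x - y : ℝ) : ℂ) q) y := by
  have h1 := (isLambert_lamS.hasDerivAt_lamSin_ofReal hq (x + y)).scomp y
    ((hasDerivAt_id y).const_add x)
  have h2 := (isLambert_lamS.hasDerivAt_lamSin_ofReal hq (x - y)).scomp y
    ((hasDerivAt_id y).const_sub x)
  convert! h1.sub h2 using 1
  simp only [one_smul, neg_smul, sub_neg_eq_add]

theorem hasDerivAt_weightLog (hq : ‖q‖ < 1) (y : ℝ) :
    HasDerivAt (fun y : ℝ => weightLog y q) (4 * lamSin lamT ((2 * y : ℝ) : ℂ) q) y := by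
  have h := isLambert_lamT.div_natCast.hasDerivAt_lamCos_ofReal hq (2 * y)
  rw [lamSin_natCast_mul_div] at h
  have h1 := h.scomp y ((hasDerivAt_id y).const_mul 2)
  have he : (fun y : ℝ => weightLog y q) = fun y : ℝ => -lamZero q -
      2 * lamCos (fun m q => lamT m q / m) ((2 * y : ℝ) : ℂ) q := by
    ext y; simp [weightLog]
  rw [he]
  convert! (h1.const_mul 2).const_sub (-lamZero q) using 1
  simp
  ring

/-- The three-term identity at α = x + y, β = x - y, so that α + β = 2x. Exchanging x and y gives
the version with 2y. -/
theorem kernel_identity_left (hq : ‖q‖ < 1) (hq0 : q ≠ 0) {x : ℝ} (hx : Real.sin x ≠ 0) (y : ℝ) :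
    16 * lamSin lamS ((x + y : ℝ) : ℂ) q * lamSin lamS ((x - y : ℝ) : ℂ) q
      - 4 * dlogTheta1 ((2 * x : ℝ) : ℂ) q *
        (lamSin lamS ((x + y : ℝ) : ℂ) q + lamSin lamS ((x - y : ℝ) : ℂ) q) =
    -8 * lamCos (fun m q => lamS m q * lamS m q) ((2 * x : ℝ) : ℂ) q
      - 4 * lamCos (fun m q => lamS m q * (1 + 2 * lamT m q)) ((x + y : ℝ) : ℂ) q
      - 4 * lamCos (fun m q => lamS m q * (1 + 2 * lamT m q)) ((x - y : ℝ) : ℂ) q := by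
  have e : x + y + (x - y) = 2 * x := by ring
  have h := lambert_three_term hq hq0 (x := x + y) (y := x - y) (by
    rw [e, show ((2 * x : ℝ) : ℂ) / 2 = (x : ℂ) by push_cast; ring]; exact_mod_cast hx)
  rwa [e] at h

theorem lamSin_neg (x : ℂ) : lamSin c (-x) q = -lamSin c x q := by
  simp only [lamSin, mul_neg, Complex.sin_neg, tsum_neg]

theorem lamCos_neg (x : ℂ) : lamCos c (-x) q = lamCos c x q := by
  simp only [lamCos, mul_neg, Complex.cos_neg]

theorem kernel_identity_right (hq : ‖q‖ < 1) (hq0 : q ≠ 0) (x : ℝ) {y : ℝ} (hy : Real.sin y ≠ 0) :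
    -16 * lamSin lamS ((x + y : ℝ) : ℂ) q * lamSin lamS ((x - y : ℝ) : ℂ) q
      - 4 * dlogTheta1 ((2 * y : ℝ) : ℂ) q *
        (lamSin lamS ((x + y : ℝ) : ℂ) q - lamSin lamS ((x - y : ℝ) : ℂ) q) =
    -8 * lamCos (fun m q => lamS m q * lamS m q) ((2 * y : ℝ) : ℂ) q
      - 4 * lamCos (fun m q => lamS m q * (1 + 2 * lamT m q)) ((x + y : ℝ) : ℂ) q
      - 4 * lamCos (fun m q => lamS m q * (1 + 2 * lamT m q)) ((x - y : ℝ) : ℂ) q := by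
  have h := kernel_identity_left hq hq0 hy x
  rw [show ((y - x : ℝ) : ℂ) = -((x - y : ℝ) : ℂ) by push_cast; ring, lamSin_neg, lamCos_neg,
    add_comm y x] at h
  linear_combination h

end KernelDerivatives

/-! ### The kernel function identity and integration by parts -/

section ReducedOperator

variable {κ a b c : ℝ} {q : ℂ} {P Q : ℂ × ℂ → ℂ} {Ω : Set (ℂ × ℂ)}

/-- The potential of the reduced operator. -/
noncomputable def potential (κ a : ℝ) (x : ℝ) (q : ℂ) : ℂ :=
  4 * κ * a * (lamSigma q + 2 * lamCos (fun m q => lamS m q * lamS m q) ((2 * x : ℝ) : ℂ) q) +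
    a ^ 2 * (1 + 4 * lamSigma q -
      16 * lamCos (fun m q => lamS m q * lamS m q) ((2 * x : ℝ) : ℂ) q)

/-- The non-stationary Lamé operator for `(κ, a)`, acting on the factor `Q(cos x, q)` of
`(θ₁(x)²)^{a/2} Q(cos x, q)`, up to a function of `q`. -/
noncomputable def reducedOp (κ a : ℝ) (Q : ℂ × ℂ → ℂ) (x : ℝ) (q : ℂ) : ℂ :=
  -2 * κ * (q * deriv (fun q => Q (Complex.cos x, q)) q)
    - deriv (deriv fun s : ℝ => Q (Complex.cos s, q)) x
    - 2 * a * dlogTheta1 ((2 * x : ℝ) : ℂ) q * deriv (fun s : ℝ => Q (Complex.cos s, q)) x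
    + potential κ a x q * Q (Complex.cos x, q)

theorem hasDerivAt_comp_cos {f : ℂ → ℂ} {x : ℝ} (hf : DifferentiableAt ℂ f (Complex.cos x)) :
    HasDerivAt (fun s : ℝ => f (Complex.cos s)) (-Complex.sin x * deriv f (Complex.cos x)) x := by
  have := (hf.hasDerivAt.comp (x : ℂ) (Complex.hasDerivAt_cos x)).comp_ofReal
  convert! this using 1
  ring

theorem isOpen_slice_left (hΩ : IsOpen Ω) (q : ℂ) : IsOpen {z : ℂ | (z, q) ∈ Ω} :=
  hΩ.preimage (by fun_prop)

theorem differentiableOn_slice_left (hP : DifferentiableOn ℂ P Ω) (q : ℂ) :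
    DifferentiableOn ℂ (fun z => P (z, q)) {z : ℂ | (z, q) ∈ Ω} :=
  hP.comp (f := fun z : ℂ => (z, q)) (by fun_prop) fun _ hz => hz

theorem deriv_comp_cos (hΩ : IsOpen Ω) (hP : DifferentiableOn ℂ P Ω)
    (hmem : ∀ (y : ℝ), (Complex.cos y, q) ∈ Ω) (x : ℝ) :
    HasDerivAt (fun s : ℝ => P (Complex.cos s, q))
      (-Complex.sin x * deriv (fun z => P (z, q)) (Complex.cos x)) x ∧
    HasDerivAt (deriv fun s : ℝ => P (Complex.cos s, q))
      (Complex.sin x ^ 2 * deriv (deriv fun z => P (z, q)) (Complex.cos x) -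
        Complex.cos x * deriv (fun z => P (z, q)) (Complex.cos x)) x := by
  have ho := isOpen_slice_left hΩ q
  have hd := differentiableOn_slice_left hP q
  have h1 : ∀ x : ℝ, HasDerivAt (fun s : ℝ => P (Complex.cos s, q))
      (-Complex.sin x * deriv (fun z => P (z, q)) (Complex.cos x)) x := fun x =>
    hasDerivAt_comp_cos (f := fun z => P (z, q)) (hd.differentiableAt (ho.mem_nhds (hmem x)))
  refine ⟨h1 x, ?_⟩
  rw [show (deriv fun s : ℝ => P (Complex.cos s, q)) = fun s : ℝ =>
    -Complex.sin s * deriv (fun z => P (z, q)) (Complex.cos s) from funext fun s => (h1 s).deriv]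
  have h2 := hasDerivAt_comp_cos (f := deriv fun z => P (z, q)) (x := x)
    ((hd.deriv ho).differentiableAt (ho.mem_nhds (hmem x)))
  have h3 := ((Complex.hasDerivAt_sin x).neg).comp_ofReal
  convert! h3.mul h2 using 1
  simp only [Pi.neg_apply]
  ring

section Factor

/-- The weight `(θ₁(y)²)^b`, up to a factor independent of `y`. -/
noncomputable def weight (b : ℝ) (y : ℝ) (q : ℂ) : ℂ :=
  (((Real.sin y ^ 2) ^ b : ℝ) : ℂ) * Complex.exp (2 * b * weightLog y q)

theorem continuous_weight (hb : 0 ≤ b) (hq : ‖q‖ < 1) : Continuous fun y : ℝ => weight b y q := by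
  have h : Continuous fun y : ℝ => weightLog y q :=
    continuous_iff_continuousAt.2 fun x => (hasDerivAt_weightLog hq x).continuousAt
  unfold weight
  exact (Complex.continuous_ofReal.comp (continuous_sin_sq_rpow hb)).mul
    (Complex.continuous_exp.comp (h.const_mul _))

theorem dlogTheta1_two_mul (x : ℝ) : dlogTheta1 ((2 * x : ℝ) : ℂ) q =
    Complex.cos x / Complex.sin x + 4 * lamSin lamT ((2 * x : ℝ) : ℂ) q := by
  rw [dlogTheta1, Complex.cot_eq_cos_div_sin, show ((2 * x : ℝ) : ℂ) / 2 = (x : ℂ) by push_cast; ring]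

theorem hasDerivAt_weight (b : ℝ) (hq : ‖q‖ < 1) {y : ℝ} (hy : Real.sin y ≠ 0) :
    HasDerivAt (fun y : ℝ => weight b y q)
      (2 * b * dlogTheta1 ((2 * y : ℝ) : ℂ) q * weight b y q) y := by
  have h1 : HasDerivAt (fun y : ℝ => ((Real.sin y ^ 2) ^ b : ℝ))
      (2 * b * (Real.cos y / Real.sin y) * (Real.sin y ^ 2) ^ b) y := by
    have h2 : HasDerivAt (fun y : ℝ => Real.sin y ^ 2) (2 * Real.sin y * Real.cos y) y := by
      convert! (Real.hasDerivAt_sin y).pow 2 using 1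
      simp
    convert! h2.rpow_const (p := b) (Or.inl (pow_ne_zero 2 hy)) using 1
    rw [Real.rpow_sub_one (pow_ne_zero 2 hy)]
    field_simp
  have h3 := (((hasDerivAt_weightLog hq y).const_mul (2 * b : ℂ)).cexp)
  convert! (h1.ofReal_comp).mul h3 using 1
  rw [weight, dlogTheta1_two_mul]
  push_cast
  ring

end Factor

/-- The kernel as a function of `x`, `y` and the nome. -/
noncomputable def kernelExp (c : ℝ) (x y : ℝ) (q : ℂ) : ℂ :=
  Complex.exp (c * kernelLog (Complex.cos x) y q)

theorem coreIntegrand_cos (x y : ℝ) : coreIntegrand b c P (Complex.cos x, q) y =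
    weight b y q * kernelExp c x y q * P (Complex.cos y, q) := by
  rw [coreIntegrand, weight, kernelExp, Complex.exp_add]
  ring

/-- `∂ₓ` of the logarithm of the kernel, divided by `-2 c`. -/
noncomputable def kernelDx (x y : ℝ) (q : ℂ) : ℂ :=
  lamSin lamS ((x + y : ℝ) : ℂ) q + lamSin lamS ((x - y : ℝ) : ℂ) q

noncomputable def kernelDy (x y : ℝ) (q : ℂ) : ℂ :=
  lamSin lamS ((x + y : ℝ) : ℂ) q - lamSin lamS ((x - y : ℝ) : ℂ) q

/-- This is also the y-derivative of `kernelDy`: a function of x + y plus a function of x - y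
satisfies the wave equation. -/
noncomputable def kernelDxx (x y : ℝ) (q : ℂ) : ℂ :=
  lamCos (fun m q => m * lamS m q) ((x + y : ℝ) : ℂ) q +
    lamCos (fun m q => m * lamS m q) ((x - y : ℝ) : ℂ) q

theorem continuous_kernelDx (hq : ‖q‖ < 1) : Continuous fun p : ℝ × ℝ => kernelDx p.1 p.2 q :=
  ((isLambert_lamS.continuous_lamSin hq).comp (continuous_fst.add continuous_snd)).add
    ((isLambert_lamS.continuous_lamSin hq).comp (continuous_fst.sub continuous_snd))

theorem continuous_kernelDy (hq : ‖q‖ < 1) : Continuous fun p : ℝ × ℝ => kernelDy p.1 p.2 q :=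
  ((isLambert_lamS.continuous_lamSin hq).comp (continuous_fst.add continuous_snd)).sub
    ((isLambert_lamS.continuous_lamSin hq).comp (continuous_fst.sub continuous_snd))

theorem continuous_kernelDxx (hq : ‖q‖ < 1) : Continuous fun p : ℝ × ℝ => kernelDxx p.1 p.2 q :=
  ((isLambert_lamS.natCast_mul.continuous_lamCos hq).comp (continuous_fst.add continuous_snd)).add
    ((isLambert_lamS.natCast_mul.continuous_lamCos hq).comp (continuous_fst.sub continuous_snd))

theorem continuous_kernelExp (hq : ‖q‖ < 1) : Continuous fun p : ℝ × ℝ => kernelExp c p.1 p.2 q := by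
  have h := isLambert_lamS.div_natCast.continuous_lamCos hq
  have h1 := (((h.comp (continuous_fst.add continuous_snd)).const_mul 2).const_add
    (2 * lamZero q)).add ((h.comp (continuous_fst.sub continuous_snd)).const_mul 2)
  unfold kernelExp
  simp only [kernelLog_cos hq]
  exact Complex.continuous_exp.comp (h1.const_mul _)

theorem hasDerivAt_kernelExp_left (hq : ‖q‖ < 1) (x y : ℝ) :
    HasDerivAt (fun x => kernelExp c x y q) (kernelExp c x y q * (-2 * c * kernelDx x y q)) x := by
  convert! ((hasDerivAt_kernelLog_left hq x y).const_mul (c : ℂ)).cexp using 1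
  rw [kernelExp, kernelDx]
  ring

theorem hasDerivAt_kernelExp_right (hq : ‖q‖ < 1) (x y : ℝ) :
    HasDerivAt (fun y => kernelExp c x y q) (kernelExp c x y q * (-2 * c * kernelDy x y q)) y := by
  convert! ((hasDerivAt_kernelLog_right hq x y).const_mul (c : ℂ)).cexp using 1
  rw [kernelExp, kernelDy]
  ring

theorem hasDerivAt_kernelDx (hq : ‖q‖ < 1) (x y : ℝ) :
    HasDerivAt (fun x => kernelDx x y q) (kernelDxx x y q) x := hasDerivAt_lamSin_add_left hq x y

theorem hasDerivAt_kernelDy (hq : ‖q‖ < 1) (x y : ℝ) :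
    HasDerivAt (fun y => kernelDy x y q) (kernelDxx x y q) y := hasDerivAt_lamSin_sub_right hq x y

theorem integral_sub_sub_add_of_continuous {f g h k : ℝ → ℂ} (hf : Continuous f)
    (hg : Continuous g) (hh : Continuous h) (hk : Continuous k) (s t : ℝ) :
    ∫ y in s..t, (f y - g y - h y + k y) =
      (∫ y in s..t, f y) - (∫ y in s..t, g y) - (∫ y in s..t, h y) + ∫ y in s..t, k y := by
  have h1 : Continuous fun y => f y - g y := hf.sub hg
  have h2 : Continuous fun y => f y - g y - h y := h1.sub hh
  rw [intervalIntegral.integral_add (h2.intervalIntegrable _ _) (hk.intervalIntegrable _ _),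
    intervalIntegral.integral_sub (h1.intervalIntegrable _ _) (hh.intervalIntegrable _ _),
    intervalIntegral.integral_sub (hf.intervalIntegrable _ _) (hg.intervalIntegrable _ _)]

/-- The integrand of the reduced operator applied to the integral transform. -/
noncomputable def opIntegrand (κ a b c : ℝ) (P : ℂ × ℂ → ℂ) (x : ℝ) (q : ℂ) (y : ℝ) : ℂ :=
  -2 * κ * (q * deriv (fun q => coreIntegrand b c P (Complex.cos x, q) y) q)
    - coreIntegrand b c P (Complex.cos x, q) y *
      (4 * c ^ 2 * kernelDx x y q ^ 2 - 2 * c * kernelDxx x y q)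
    - 2 * a * dlogTheta1 ((2 * x : ℝ) : ℂ) q *
      (coreIntegrand b c P (Complex.cos x, q) y * (-2 * c * kernelDx x y q))
    + potential κ a x q * coreIntegrand b c P (Complex.cos x, q) y

theorem continuous_coreIntegrand_cos (hb : 0 ≤ b) (hq : ‖q‖ < 1) (hP : ContinuousOn P Ω)
    (hmem : ∀ y : ℝ, (Complex.cos y, q) ∈ Ω) :
    Continuous fun p : ℝ × ℝ => coreIntegrand b c P (Complex.cos p.1, q) p.2 := by
  simp only [coreIntegrand_cos]
  refine (((continuous_weight hb hq).comp continuous_snd).mul (continuous_kernelExp hq)).mul ?_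
  exact hP.comp_continuous (f := fun p : ℝ × ℝ => (Complex.cos p.2, q)) (by fun_prop)
    fun p => hmem p.2


/-- The operator is moved under the integral; the weight vanishes or stays bounded at sin y = 0
because b ≥ 0, and it is not differentiated here. -/
theorem reducedOp_coreIntegral (hb : 0 ≤ b) (hq : ‖q‖ < 1) (hP : DifferentiableOn ℂ P Ω)
    (hmem : ∀ (y : ℝ) (q : ℂ), ‖q‖ < 1 → (Complex.cos y, q) ∈ Ω) (x : ℝ) :
    Continuous (opIntegrand κ a b c P x q) ∧
    reducedOp κ a (coreIntegral b c P) x q =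
      1 / (2 * Real.pi) * ∫ y in (-Real.pi)..Real.pi, opIntegrand κ a b c P x q y := by
  have hpi : -Real.pi ≤ Real.pi := by linarith [Real.pi_pos]
  have hcn := continuous_coreIntegrand_cos (c := c) hb hq hP.continuousOn fun y => hmem y q hq
  have hc1 : Continuous fun p : ℝ × ℝ => coreIntegrand b c P (Complex.cos p.1, q) p.2 *
      (-2 * c * kernelDx p.1 p.2 q) := hcn.mul ((continuous_kernelDx hq).const_mul _)
  have hc2 : Continuous fun p : ℝ × ℝ => coreIntegrand b c P (Complex.cos p.1, q) p.2 *
      (4 * c ^ 2 * kernelDx p.1 p.2 q ^ 2 - 2 * c * kernelDxx p.1 p.2 q) :=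
    hcn.mul ((((continuous_kernelDx hq).pow 2).const_mul _).sub ((continuous_kernelDxx hq).const_mul _))
  have hd0 : ∀ x y : ℝ, HasDerivAt (fun x : ℝ => coreIntegrand b c P (Complex.cos x, q) y)
      (coreIntegrand b c P (Complex.cos x, q) y * (-2 * c * kernelDx x y q)) x := fun x y => by
    simp only [coreIntegrand_cos]
    convert! ((hasDerivAt_kernelExp_left (c := c) hq x y).const_mul (weight b y q)).mul_const
      (P (Complex.cos y, q)) using 1
    ring
  have hd1 : ∀ x y : ℝ, HasDerivAt (fun x : ℝ => coreIntegrand b c P (Complex.cos x, q) y *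
      (-2 * c * kernelDx x y q)) (coreIntegrand b c P (Complex.cos x, q) y *
      (4 * c ^ 2 * kernelDx x y q ^ 2 - 2 * c * kernelDxx x y q)) x := fun x y => by
    convert! (hd0 x y).mul ((hasDerivAt_kernelDx hq x y).const_mul (-2 * c : ℂ)) using 1
    ring
  have hs1 : ∀ x : ℝ, HasDerivAt (fun s : ℝ => coreIntegral b c P (Complex.cos s, q))
      (1 / (2 * Real.pi) * ∫ y in (-Real.pi)..Real.pi, coreIntegrand b c P (Complex.cos x, q) y *
        (-2 * c * kernelDx x y q)) x := fun x =>
    (hasDerivAt_intervalIntegral (U := univ) hpi isOpen_univ hcn.continuousOn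
      hc1.continuousOn (fun x _ y _ => hd0 x y) (mem_univ x)).const_mul _
  have hs2 : HasDerivAt (deriv fun s : ℝ => coreIntegral b c P (Complex.cos s, q))
      (1 / (2 * Real.pi) * ∫ y in (-Real.pi)..Real.pi, coreIntegrand b c P (Complex.cos x, q) y *
        (4 * c ^ 2 * kernelDx x y q ^ 2 - 2 * c * kernelDxx x y q)) x := by
    rw [show (deriv fun s : ℝ => coreIntegral b c P (Complex.cos s, q)) = _ from
      funext fun s => (hs1 s).deriv]
    exact (hasDerivAt_intervalIntegral (U := univ) hpi isOpen_univ hc1.continuousOn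
      hc2.continuousOn (fun x _ y _ => hd1 x y) (mem_univ x)).const_mul _
  have hcq : ContinuousOn (fun p : ℂ × ℝ => coreIntegrand b c P (Complex.cos x, p.1) p.2)
      (Metric.ball 0 1 ×ˢ univ) := by
    refine (continuousOn_coreIntegrand (c := c) hb hP.continuousOn hmem).comp
      (f := fun p : ℂ × ℝ => ((Complex.cos x, p.1), p.2)) (by fun_prop) ?_
    rintro p ⟨hp, -⟩
    exact ⟨cos_mem_kernelDomain x (by simpa using hp), mem_univ _⟩
  have hdq : ∀ y : ℝ, DifferentiableOn ℂ (fun q => coreIntegrand b c P (Complex.cos x, q) y)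
      (Metric.ball 0 1) := fun y => by
    refine (differentiableOn_coreIntegrand (b := b) (c := c) hP hmem y).comp
      (f := fun q : ℂ => (Complex.cos x, q)) (by fun_prop) ?_
    exact fun q hq => cos_mem_kernelDomain x (by simpa using hq)
  have hqb : q ∈ Metric.ball (0 : ℂ) 1 := by simpa using hq
  have hsq : HasDerivAt (fun q => coreIntegral b c P (Complex.cos x, q))
      (1 / (2 * Real.pi) * ∫ y in (-Real.pi)..Real.pi,
        deriv (fun q => coreIntegrand b c P (Complex.cos x, q) y) q) q :=
    (hasDerivAt_intervalIntegral_deriv hpi Metric.isOpen_ball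
      (hcq.mono (prod_mono subset_rfl (subset_univ _))) (fun y _ => hdq y) hqb).const_mul _
  have hcdq : Continuous fun y : ℝ => deriv (fun q => coreIntegrand b c P (Complex.cos x, q) y) q := by
    have := continuousOn_deriv_of_continuousOn_prod Metric.isOpen_ball hcq fun y _ => hdq y
    exact this.comp_continuous (f := fun y : ℝ => (q, y)) (by fun_prop) fun y => ⟨hqb, mem_univ _⟩
  have hx : Continuous fun y : ℝ => (x, y) := by fun_prop
  have e0 : Continuous fun y : ℝ => coreIntegrand b c P (Complex.cos x, q) y :=
    by have := hcn.comp hx; exact this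
  have e1 : Continuous fun y : ℝ => coreIntegrand b c P (Complex.cos x, q) y *
      (-2 * c * kernelDx x y q) := by have := hc1.comp hx; exact this
  have e2 : Continuous fun y : ℝ => coreIntegrand b c P (Complex.cos x, q) y *
      (4 * c ^ 2 * kernelDx x y q ^ 2 - 2 * c * kernelDxx x y q) := by have := hc2.comp hx; exact this
  have c1 := ((hcdq.const_mul q).const_mul (-2 * κ : ℂ))
  have c3 := e1.const_mul (2 * a * dlogTheta1 ((2 * x : ℝ) : ℂ) q)
  have c4 := e0.const_mul (potential κ a x q)
  refine ⟨((c1.sub e2).sub c3).add c4, ?_⟩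
  rw [reducedOp, hsq.deriv, hs2.deriv, (hs1 x).deriv, coreIntegral]
  simp only [opIntegrand]
  have h := integral_sub_sub_add_of_continuous c1 e2 c3 c4 (-Real.pi) Real.pi
  simp only [intervalIntegral.integral_const_mul] at h
  rw [h]
  ring

theorem mul_deriv_coreIntegrand_nome (hΩ : IsOpen Ω) (hP : DifferentiableOn ℂ P Ω)
    (hmem : ∀ (y : ℝ) (q : ℂ), ‖q‖ < 1 → (Complex.cos y, q) ∈ Ω) (hq : ‖q‖ < 1) (x y : ℝ) :
    q * deriv (fun q => coreIntegrand b c P (Complex.cos x, q) y) q =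
      weight b y q * kernelExp c x y q * (P (Complex.cos y, q) *
        (2 * b * (q * deriv (fun q => weightLog y q) q) +
          c * (q * deriv (fun q => kernelLog (Complex.cos x) y q) q)) +
        q * deriv (fun q => P (Complex.cos y, q)) q) := by
  have h1 := (weightLog_nome hq y).1.hasDerivAt
  have h2 := (kernelLog_nome hq x y).1.hasDerivAt
  have h3 : HasDerivAt (fun q => P (Complex.cos y, q)) (deriv (fun q => P (Complex.cos y, q)) q) q :=
    ((hP.differentiableAt (hΩ.mem_nhds (hmem y q hq))).comp q
      (f := fun q : ℂ => (Complex.cos y, q)) (by fun_prop)).hasDerivAt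
  have h4 := ((((h1.const_mul (2 * b : ℂ)).add (h2.const_mul (c : ℂ))).cexp).mul h3).const_mul
    (((Real.sin y ^ 2) ^ b : ℝ) : ℂ)
  have h5 : deriv (fun q => coreIntegrand b c P (Complex.cos x, q) y) q = _ := h4.deriv
  rw [h5, weight, kernelExp]
  simp only [Pi.add_apply, Complex.exp_add]
  ring

/-- The differentiated function is the Wronskian in y of kernel and P, multiplied by the weight
(θ₁²)^b that makes the y-operator formally self-adjoint. Its derivative trades the y-operator acting
on P for the one acting on the kernel. What then has to vanish is the kernel function identity. -/
theorem hasDerivAt_boundary (hΩ : IsOpen Ω) (hP : DifferentiableOn ℂ P Ω)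
    (hmem : ∀ (y : ℝ) (q : ℂ), ‖q‖ < 1 → (Complex.cos y, q) ∈ Ω) (hq : ‖q‖ < 1) (hq0 : q ≠ 0)
    {x y : ℝ} (hx : Real.sin x ≠ 0) (hy : Real.sin y ≠ 0) {E : ℂ}
    (hE : reducedOp (a - b) b P y q = E * P (Complex.cos y, q)) :
    HasDerivAt (fun y : ℝ => weight b y q * (kernelExp (a + b) x y q *
        deriv (fun s : ℝ => P (Complex.cos s, q)) y -
        kernelExp (a + b) x y q * (-2 * (a + b : ℝ) * kernelDy x y q) * P (Complex.cos y, q)))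
      (opIntegrand (a - b) a b (a + b) P x q y -
        (E + a ^ 2 - b ^ 2) * coreIntegrand b (a + b) P (Complex.cos x, q) y) y := by
  obtain ⟨hv1, hv2⟩ := deriv_comp_cos hΩ hP (fun y => hmem y q hq) y
  have hv1' := hv1.differentiableAt.hasDerivAt
  have hv2' := hv2.differentiableAt.hasDerivAt
  have hf := hasDerivAt_kernelExp_right (c := a + b) hq x y
  have hfy := hf.mul ((hasDerivAt_kernelDy hq x y).const_mul (-2 * (a + b : ℝ) : ℂ))
  have hG := (hasDerivAt_weight b hq hy).mul ((hf.mul hv2').sub (hfy.mul hv1'))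
  convert! hG using 1
  rw [opIntegrand, mul_deriv_coreIntegrand_nome hΩ hP hmem hq, (weightLog_nome hq y).2,
    (kernelLog_nome hq x y).2, coreIntegrand_cos]
  rw [reducedOp] at hE
  have k1 := kernel_identity_left hq hq0 hx y
  have k2 := kernel_identity_right hq hq0 x hy
  simp only [potential, kernelDx, kernelDy, Pi.mul_apply, Pi.sub_apply] at hE ⊢
  push_cast at hE k1 k2 ⊢
  -- The product of the two sine series enters with c² from the kernel and with c(a + b) from the
  -- two identities, so it cancels for c = a + b. The q-derivative of the kernel cancels because κ =
  -- a - b. The remaining constants give a² - b².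
  linear_combination weight b y q * kernelExp (a + b) x y q * hE
    - a * (a + b) * weight b y q * kernelExp (a + b) x y q * P (Complex.cos y, q) * k1
    + b * (a + b) * weight b y q * kernelExp (a + b) x y q * P (Complex.cos y, q) * k2

theorem sin_ne_zero_of_mem_Ioo {y : ℝ} (hy : y ∈ Ioo (-Real.pi) Real.pi) (hy0 : y ≠ 0) :
    Real.sin y ≠ 0 := by
  rcases lt_or_gt_of_ne hy0 with h | h
  · exact (Real.sin_neg_of_neg_of_neg_pi_lt h hy.1).ne
  · exact (Real.sin_pos_of_pos_of_lt_pi h hy.2).ne'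

theorem kernelDy_pi (x : ℝ) : kernelDy x Real.pi q = 0 := by
  rw [kernelDy, sub_eq_zero]
  refine tsum_congr fun m => ?_
  rw [← Complex.sin_add_nat_mul_two_pi (m * ((x - Real.pi : ℝ) : ℂ)) m]
  push_cast
  ring_nf

theorem kernelDy_neg (x y : ℝ) : kernelDy x (-y) q = -kernelDy x y q := by
  simp only [kernelDy, sub_neg_eq_add, ← sub_eq_add_neg]
  ring

/-- Integrate the total derivative of `hasDerivAt_boundary` over a full period. -/
theorem reducedOp_coreIntegral_eq (hb : 0 ≤ b) (hΩ : IsOpen Ω) (hP : DifferentiableOn ℂ P Ω)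
    (hmem : ∀ (y : ℝ) (q : ℂ), ‖q‖ < 1 → (Complex.cos y, q) ∈ Ω) (hq : ‖q‖ < 1) (hq0 : q ≠ 0)
    {x : ℝ} (hx : Real.sin x ≠ 0) {E : ℂ} (hE : ∀ y ∈ Ioo (-Real.pi) Real.pi, y ≠ 0 →
      reducedOp (a - b) b P y q = E * P (Complex.cos y, q)) :
    reducedOp (a - b) a (coreIntegral b (a + b) P) x q =
      (E + a ^ 2 - b ^ 2) * coreIntegral b (a + b) P (Complex.cos x, q) := by
  obtain ⟨hc, h1⟩ := reducedOp_coreIntegral (κ := a - b) (a := a) (c := a + b) hb hq hP hmem x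
  have hcn := continuous_coreIntegrand_cos (c := a + b) hb hq hP.continuousOn fun y => hmem y q hq
  have hc2 : Continuous fun y : ℝ => coreIntegrand b (a + b) P (Complex.cos x, q) y := by
    have := hcn.comp (show Continuous fun y : ℝ => (x, y) by fun_prop); exact this
  have hv := deriv_comp_cos hΩ hP fun y => hmem y q hq
  set G : ℝ → ℂ := fun y : ℝ => weight b y q * (kernelExp (a + b) x y q *
        deriv (fun s : ℝ => P (Complex.cos s, q)) y -
        kernelExp (a + b) x y q * (-2 * (a + b : ℝ) * kernelDy x y q) * P (Complex.cos y, q)) with hG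
  have hGc : Continuous G := by
    have f1 : Continuous fun y : ℝ => kernelExp (a + b) x y q := by
      have := (continuous_kernelExp (c := a + b) hq).comp
        (show Continuous fun y : ℝ => (x, y) by fun_prop); exact this
    have f2 : Continuous fun y : ℝ => kernelDy x y q := by
      have := (continuous_kernelDy hq).comp
        (show Continuous fun y : ℝ => (x, y) by fun_prop); exact this
    have f3 : Continuous fun s : ℝ => P (Complex.cos s, q) :=
      continuous_iff_continuousAt.2 fun y => (hv y).1.continuousAt
    have f4 : Continuous (deriv fun s : ℝ => P (Complex.cos s, q)) :=
      continuous_iff_continuousAt.2 fun y => (hv y).2.continuousAt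
    exact (continuous_weight hb hq).mul ((f1.mul f4).sub ((f1.mul (f2.const_mul _)).mul f3))
  have hint : Continuous fun y => opIntegrand (a - b) a b (a + b) P x q y -
        (E + a ^ 2 - b ^ 2) * coreIntegrand b (a + b) P (Complex.cos x, q) y :=
    hc.sub (hc2.const_mul _)
  -- At y = 0 the weight may fail to be differentiable, but continuity is enough at one exceptional
  -- point.
  have hftc := MeasureTheory.integral_eq_of_hasDerivAt_off_countable G _
    (countable_singleton (0 : ℝ)) (a := -Real.pi) (b := Real.pi) hGc.continuousOn
    (fun y hy => ?_) (hint.intervalIntegrable _ _)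
  -- There is no boundary term: d/dy P(cos y) contains the factor sin y, and `kernelDy` vanishes at
  -- ±π. This works for b = 0 too, where the weight does not vanish.
  · have hv0 : deriv (fun s : ℝ => P (Complex.cos s, q)) Real.pi = 0 := by
      rw [(hv Real.pi).1.deriv, Complex.sin_pi]; ring
    have hv0' : deriv (fun s : ℝ => P (Complex.cos s, q)) (-Real.pi) = 0 := by
      rw [(hv (-Real.pi)).1.deriv, Complex.ofReal_neg, Complex.sin_neg, Complex.sin_pi]; ring
    have hG0 : G Real.pi - G (-Real.pi) = 0 := by
      simp only [hG, hv0, hv0', kernelDy_neg, kernelDy_pi]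
      ring
    rw [hG0, intervalIntegral.integral_sub (hc.intervalIntegrable _ _)
      ((hc2.const_mul _).intervalIntegrable _ _), intervalIntegral.integral_const_mul] at hftc
    rw [h1, coreIntegral]
    linear_combination (1 / (2 * Real.pi)) * hftc
  · rw [min_eq_left (by linarith [Real.pi_pos]), max_eq_right (by linarith [Real.pi_pos])] at hy
    have hy' := sin_ne_zero_of_mem_Ioo hy.1 hy.2
    exact hasDerivAt_boundary hΩ hP hmem hq hq0 hx hy' (hE y hy.1 hy.2)

end ReducedOperator

/-! ### From the Lamé equation to the reduced equation -/

section Solution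

variable {κ a : ℝ} {q τ : ℂ} {Q : ℂ × ℂ → ℂ} {Ω : Set (ℂ × ℂ)} {x : ℝ}

theorem theta1SqHalfPow_eq_weight (hτ : 0 < τ.im) (a x : ℝ) :
    theta1SqHalfPow a x τ = weight (a / 2) x (nome τ) := by
  rw [theta1SqHalfPow, weight, logTheta1DivSin_eq_weightLog hτ]
  congr 2
  push_cast
  ring

theorem weight_ne_zero (b : ℝ) (hx : Real.sin x ≠ 0) : weight b x q ≠ 0 := by
  refine mul_ne_zero ?_ (Complex.exp_ne_zero _)
  have : 0 < Real.sin x ^ 2 := by positivity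
  exact_mod_cast (Real.rpow_pos_of_pos this b).ne'

theorem hasDerivAt_dlogTheta1 (hq : ‖q‖ < 1) (hx : Real.sin x ≠ 0) :
    HasDerivAt (fun x : ℝ => dlogTheta1 ((2 * x : ℝ) : ℂ) q)
      (ddlogTheta1 ((2 * x : ℝ) : ℂ) q) x := by
  have hx' : Complex.sin x ≠ 0 := by exact_mod_cast hx
  have h1 := ((Complex.hasDerivAt_cos x).div (Complex.hasDerivAt_sin x) hx').comp_ofReal
  have h2 := (isLambert_lamT.hasDerivAt_lamSin_ofReal hq (2 * x)).scomp x
    ((hasDerivAt_id x).const_mul 2)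
  rw [show (fun x : ℝ => dlogTheta1 ((2 * x : ℝ) : ℂ) q) = _ from
    funext fun x => dlogTheta1_two_mul x]
  convert! h1.add (h2.const_mul 4) using 1
  rw [ddlogTheta1, show ((2 * x : ℝ) : ℂ) / 2 = (x : ℂ) by push_cast; ring]
  have h3 := Complex.sin_sq_add_cos_sq x
  simp only [mul_one, Complex.real_smul, Complex.ofReal_ofNat]
  field_simp
  linear_combination h3

theorem contDiffAt_comp_ofReal {f : ℂ → ℂ} {U : Set ℂ} (hU : IsOpen U) (hf : DifferentiableOn ℂ f U)
    (hx : (x : ℂ) ∈ U) {n : WithTop ℕ∞} : ContDiffAt ℝ n (fun s : ℝ => f s) x := by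
  have h1 : ContDiffAt ℝ n f x := (hf.analyticAt (hU.mem_nhds hx)).contDiffAt.restrict_scalars ℝ
  exact h1.comp x Complex.ofRealCLM.contDiff.contDiffAt

theorem contDiffAt_weight_mul (hΩ : IsOpen Ω) (hQ : DifferentiableOn ℂ Q Ω) (hq : ‖q‖ < 1)
    (hmem : ∀ y : ℝ, (Complex.cos y, q) ∈ Ω) (hx : Real.sin x ≠ 0) {n : WithTop ℕ∞} :
    ContDiffAt ℝ n (fun s : ℝ => weight a s q * Q (Complex.cos s, q)) x := by
  have h1 : ContDiffAt ℝ n (fun s : ℝ => ((Real.sin s ^ 2) ^ a : ℝ)) x :=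
    ContDiffAt.rpow_const_of_ne (Real.contDiff_sin.contDiffAt.pow 2) (pow_ne_zero 2 hx)
  have h2 : ContDiffAt ℝ n (fun s : ℝ => (((Real.sin s ^ 2) ^ a : ℝ) : ℂ)) x :=
    Complex.ofRealCLM.contDiff.contDiffAt.comp x h1
  have h3 : ContDiffAt ℝ n (fun s : ℝ => weightLog s q) x := by
    refine contDiffAt_comp_ofReal (f := fun z => weightLog z q)
      (U := {z | ‖q‖ < 1 ∧ ‖q‖ * Real.exp |(2 * z).im| < 1}) ?_ ?_ (norm_mul_exp_abs_im_two_mul hq x)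
    · exact IsOpen.and isOpen_const (isOpen_lt (by fun_prop) (by fun_prop))
    · exact differentiableOn_weightLog.comp (f := fun z : ℂ => (z, q)) (by fun_prop) fun z hz => hz
  have h4 : ContDiffAt ℝ n (fun s : ℝ => Q (Complex.cos s, q)) x := by
    refine contDiffAt_comp_ofReal (f := fun z => Q (Complex.cos z, q))
      (U := {z | (Complex.cos z, q) ∈ Ω}) (hΩ.preimage (by fun_prop)) ?_ (hmem x)
    exact hQ.comp (f := fun z : ℂ => (Complex.cos z, q)) (by fun_prop) fun z hz => hz
  unfold weight
  exact (h2.mul ((contDiffAt_const.mul h3).cexp)).mul h4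

/-- The logarithmic derivative of the weight with exponent a/2 is aφ, with φ = θ₁'/θ₁; the rest is
the product rule twice. -/
theorem deriv2_weight_mul (hΩ : IsOpen Ω) (hQ : DifferentiableOn ℂ Q Ω) (hq : ‖q‖ < 1)
    (hmem : ∀ y : ℝ, (Complex.cos y, q) ∈ Ω) (hx : Real.sin x ≠ 0) :
    iteratedDeriv 2 (fun s : ℝ => weight (a / 2) s q * Q (Complex.cos s, q)) x =
      weight (a / 2) x q *
        ((a ^ 2 * dlogTheta1 ((2 * x : ℝ) : ℂ) q ^ 2 + a * ddlogTheta1 ((2 * x : ℝ) : ℂ) q) *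
          Q (Complex.cos x, q) +
        2 * a * dlogTheta1 ((2 * x : ℝ) : ℂ) q * deriv (fun s : ℝ => Q (Complex.cos s, q)) x +
        deriv (deriv fun s : ℝ => Q (Complex.cos s, q)) x) := by
  have hd := deriv_comp_cos hΩ hQ hmem
  have h1 : ∀ {s : ℝ}, Real.sin s ≠ 0 →
      HasDerivAt (fun s : ℝ => weight (a / 2) s q * Q (Complex.cos s, q))
        (weight (a / 2) s q * (a * dlogTheta1 ((2 * s : ℝ) : ℂ) q * Q (Complex.cos s, q) +
          deriv (fun s : ℝ => Q (Complex.cos s, q)) s)) s := fun {s} hs => by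
    convert! (hasDerivAt_weight (a / 2) hq hs).mul (hd s).1.differentiableAt.hasDerivAt using 1
    push_cast
    ring
  have h2 : deriv (fun s : ℝ => weight (a / 2) s q * Q (Complex.cos s, q)) =ᶠ[𝓝 x] fun s : ℝ =>
      weight (a / 2) s q * (a * dlogTheta1 ((2 * s : ℝ) : ℂ) q * Q (Complex.cos s, q) +
          deriv (fun s : ℝ => Q (Complex.cos s, q)) s) := by
    filter_upwards [Real.continuous_sin.continuousAt.eventually_ne hx] with s hs
    exact (h1 hs).deriv
  rw [iteratedDeriv_succ, iteratedDeriv_one, h2.deriv_eq]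
  have h3 := (hasDerivAt_weight (a / 2) hq hx).mul
    ((((hasDerivAt_dlogTheta1 hq hx).const_mul (a : ℂ)).mul
      (hd x).1.differentiableAt.hasDerivAt).add (hd x).2.differentiableAt.hasDerivAt)
  refine HasDerivAt.deriv ?_
  convert! h3 using 1
  simp only [Pi.add_apply, Pi.mul_apply]
  push_cast
  ring

theorem hasDerivAt_nome (τ : ℂ) : HasDerivAt nome (Complex.I * Real.pi * nome τ) τ := by
  have := ((hasDerivAt_id τ).const_mul (Complex.I * Real.pi)).cexp
  convert! this using 1
  rw [nome]
  simp only [id]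
  ring

theorem hasDerivAt_weight_mul_nome (hΩ : IsOpen Ω) (hQ : DifferentiableOn ℂ Q Ω) (hτ : 0 < τ.im)
    (hmem : (Complex.cos x, nome τ) ∈ Ω) :
    HasDerivAt (fun t => weight (a / 2) x (nome t) * Q (Complex.cos x, nome t))
      (Complex.I * Real.pi * (weight (a / 2) x (nome τ) *
        (a * (-2 * lamSigma (nome τ) -
          4 * lamCos (fun m q => lamS m q * lamS m q) ((2 * x : ℝ) : ℂ) (nome τ)) *
          Q (Complex.cos x, nome τ) +
        nome τ * deriv (fun q => Q (Complex.cos x, q)) (nome τ)))) τ := by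
  have hq := norm_nome_lt_one hτ
  have h1 := (weightLog_nome hq x).1.hasDerivAt
  have h3 : HasDerivAt (fun q => Q (Complex.cos x, q))
      (deriv (fun q => Q (Complex.cos x, q)) (nome τ)) (nome τ) :=
    ((hQ.differentiableAt (hΩ.mem_nhds hmem)).comp (nome τ)
      (f := fun q : ℂ => (Complex.cos x, q)) (by fun_prop)).hasDerivAt
  have h4 := (((h1.const_mul (2 * (a / 2 : ℝ) : ℂ)).cexp).const_mul
    (((Real.sin x ^ 2) ^ (a / 2) : ℝ) : ℂ)).mul h3
  have h5 := h4.comp τ (hasDerivAt_nome τ)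
  convert! h5 using 1
  rw [← (weightLog_nome hq x).2, weight]
  push_cast
  ring

/-- The Lamé operator in terms of the reduced operator. -/
theorem lame_eq_reducedOp (hΩ : IsOpen Ω) (hQ : DifferentiableOn ℂ Q Ω)
    (hmem : ∀ (y : ℝ) (q : ℂ), ‖q‖ < 1 → (Complex.cos y, q) ∈ Ω) {ψ : ℝ → ℂ → ℂ}
    (hψ : ∀ x ∈ Icc (-Real.pi) Real.pi, ∀ τ : ℂ, 0 < τ.im →
      ψ x τ = theta1SqHalfPow a x τ * Q (Complex.cos x, nome τ))
    (n : ℕ) (hτ : 0 < τ.im) (hx : x ∈ Ioo (-Real.pi) Real.pi) (hx0 : x ≠ 0) :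
    DifferentiableAt ℂ (fun t => ψ x t) τ ∧ ContDiffAt ℝ 2 (fun s => ψ s τ) x ∧
    2 * Complex.I / Real.pi * κ * deriv (fun t => ψ x t) τ
      - iteratedDeriv 2 (fun s => ψ s τ) x
      + a * (a - 1) * (periods τ hτ).weierstrassP x * ψ x τ - energy n a τ * ψ x τ =
    weight (a / 2) x (nome τ) * (reducedOp κ a Q x (nome τ) -
      ((n : ℂ) + a) ^ 2 * Q (Complex.cos x, nome τ)) := by
  have hq := norm_nome_lt_one hτ
  have hsin := sin_ne_zero_of_mem_Ioo hx hx0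
  have e1 : (fun t => ψ x t) =ᶠ[𝓝 τ]
      fun t => weight (a / 2) x (nome t) * Q (Complex.cos x, nome t) := by
    filter_upwards [(isOpen_lt continuous_const Complex.continuous_im).mem_nhds hτ] with t ht
    rw [hψ x (Ioo_subset_Icc_self hx) t ht, theta1SqHalfPow_eq_weight ht]
  have e2 : (fun s => ψ s τ) =ᶠ[𝓝 x]
      fun s => weight (a / 2) s (nome τ) * Q (Complex.cos s, nome τ) := by
    filter_upwards [isOpen_Ioo.mem_nhds hx] with s hs
    rw [hψ s (Ioo_subset_Icc_self hs) τ hτ, theta1SqHalfPow_eq_weight hτ]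
  have h1 := (hasDerivAt_weight_mul_nome (a := a) hΩ hQ hτ (hmem x _ hq)).congr_of_eventuallyEq e1
  refine ⟨h1.differentiableAt, (contDiffAt_weight_mul hΩ hQ hq (fun y => hmem y _ hq)
    hsin).congr_of_eventuallyEq e2, ?_⟩
  have h2 : iteratedDeriv 2 (fun s => ψ s τ) x = _ :=
    (e2.iteratedDeriv_eq 2).trans (deriv2_weight_mul hΩ hQ hq (fun y => hmem y _ hq) hsin)
  have hpi : (Real.pi : ℂ) ≠ 0 := by exact_mod_cast Real.pi_ne_zero
  have hW := weierstrassP_eq hτ hsin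
  have hR := riccati (x := 2 * x) hq (nome_ne_zero τ) (by
    rw [show ((2 * x : ℝ) : ℂ) / 2 = (x : ℂ) by push_cast; ring]; exact_mod_cast hsin)
  have hI : ∀ D : ℂ, 2 * Complex.I / Real.pi * κ * (Complex.I * Real.pi * D) = -2 * κ * D :=
    fun D => by
      field_simp
      rw [Complex.I_sq]
      ring
  rw [h1.deriv, hI, h2, hW, e2.eq_of_nhds, energy, reducedOp, potential, etaOverPi_eq hτ]
  have e3 : (2 : ℂ) * (x : ℂ) = ((2 * x : ℝ) : ℂ) := by push_cast; rfl
  rw [e3]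
  -- Since ℘ = -φ' - 4η₁/π, the terms -aφ' and a(a-1)℘ combine to -a²φ' up to a constant. Together
  -- with -a²φ² this is what the Riccati identity evaluates.
  linear_combination (-a ^ 2 * weight (a / 2) x (nome τ) * Q (Complex.cos x, nome τ)) * hR

end Solution

/-! ### Taylor coefficients as Cauchy integrals -/

section Cauchy

variable {Ω : Set (ℂ × ℂ)} {F : ℂ × ℂ → ℂ} {r : ℝ}

/-- The Cauchy kernel for the `j`-th Taylor coefficient. -/
noncomputable def cauchyKernel (r : ℝ) (j : ℕ) (θ : ℝ) : ℂ :=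
  (2 * Real.pi * Complex.I)⁻¹ * (circleMap 0 r θ * Complex.I / circleMap 0 r θ ^ (j + 1))

theorem continuous_cauchyKernel (hr : 0 < r) (j : ℕ) : Continuous (cauchyKernel r j) := by
  have h := continuous_circleMap 0 r
  exact continuous_const.mul ((h.mul continuous_const).div (h.pow _) fun θ =>
    pow_ne_zero _ (circleMap_ne_center hr.ne'))

theorem taylorCoeff_eq_integral (hr : 0 < r) {f : ℂ → ℂ}
    (hf : DifferentiableOn ℂ f (Metric.closedBall 0 r)) (j : ℕ) :
    taylorCoeff f j = ∫ θ in (0)..(2 * Real.pi), cauchyKernel r j θ * f (circleMap 0 r θ) := by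
  have h := hf.circleIntegral_one_div_sub_center_pow_smul hr j
  have hne : (2 * Real.pi * Complex.I : ℂ) ≠ 0 := Complex.two_pi_I_ne_zero
  have hfac : (j.factorial : ℂ) ≠ 0 := by exact_mod_cast j.factorial_ne_zero
  have h2 : taylorCoeff f j = (2 * Real.pi * Complex.I : ℂ)⁻¹ *
      ∮ z in C(0, r), (1 / (z - 0) ^ (j + 1)) • f z := by
    rw [h, taylorCoeff, smul_eq_mul]
    field_simp
  rw [h2, circleIntegral, ← intervalIntegral.integral_const_mul]
  refine intervalIntegral.integral_congr fun θ _ => ?_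
  simp only [deriv_circleMap, smul_eq_mul, sub_zero, cauchyKernel]
  ring

theorem circleMap_zero_mem_ball {s : ℝ} (hr : 0 ≤ r) (hrs : r < s) (θ : ℝ) :
    circleMap 0 r θ ∈ Metric.ball (0 : ℂ) s := by
  simpa [abs_of_nonneg hr] using hrs

theorem exists_ball_prod_subset (hΩ : IsOpen Ω) {p : ℂ × ℂ} (hp : p ∈ Ω) :
    ∃ r > 0, Metric.ball p.1 r ×ˢ Metric.ball p.2 r ⊆ Ω := by
  obtain ⟨r, hr, h⟩ := Metric.isOpen_iff.1 hΩ p hp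
  exact ⟨r, hr, by rwa [ball_prod_same]⟩

/-- Locally ∂_z F is a Cauchy integral over a circle of fixed radius, and such an integral is
jointly holomorphic in the parameters. -/
theorem differentiableOn_deriv_left (hΩ : IsOpen Ω) (hF : DifferentiableOn ℂ F Ω) :
    DifferentiableOn ℂ (fun p : ℂ × ℂ => deriv (fun z => F (z, p.2)) p.1) Ω := by
  rintro ⟨z₀, q₀⟩ hp
  obtain ⟨r, hr, h⟩ := exists_ball_prod_subset hΩ hp
  have hr2 : 0 < r / 2 := by positivity
  have hD : IsOpen (Metric.ball z₀ (r / 2) ×ˢ Metric.ball q₀ r) :=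
    Metric.isOpen_ball.prod Metric.isOpen_ball
  have hadd : ∀ z ∈ Metric.ball z₀ (r / 2), ∀ w ∈ Metric.ball (0 : ℂ) (r / 2),
      z + w ∈ Metric.ball z₀ r := fun z hz w hw => by
    rw [mem_ball_iff_norm] at hz hw ⊢
    calc ‖z + w - z₀‖ = ‖(z - z₀) + (w - 0)‖ := by ring_nf
      _ ≤ _ := norm_add_le _ _
      _ < r := by linarith
  -- Centres within r/2 of z₀ and circles of radius r/4 stay inside the ball of radius r.
  have hr4 : 0 < r / 4 := by positivity
  have key : DifferentiableOn ℂ (fun p : ℂ × ℂ => ∫ θ in (0)..(2 * Real.pi),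
      cauchyKernel (r / 4) 1 θ * F (p.1 + circleMap 0 (r / 4) θ, p.2))
      (Metric.ball z₀ (r / 2) ×ˢ Metric.ball q₀ r) := by
    refine differentiableOn_intervalIntegral (by positivity) hD ?_ ?_
    · refine (((continuous_cauchyKernel hr4 1).comp continuous_snd).continuousOn).mul ?_
      have hc := continuous_circleMap 0 (r / 4)
      refine hF.continuousOn.comp (f := fun p : (ℂ × ℂ) × ℝ =>
        (p.1.1 + circleMap 0 (r / 4) p.2, p.1.2)) (by fun_prop) ?_
      rintro ⟨p, θ⟩ ⟨⟨h1, h2⟩, -⟩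
      exact h ⟨hadd _ h1 _ (circleMap_zero_mem_ball hr4.le (by linarith) θ), h2⟩
    · intro θ _
      refine DifferentiableOn.const_mul (hF.comp (f := fun p : ℂ × ℂ =>
        (p.1 + circleMap 0 (r / 4) θ, p.2)) (by fun_prop) ?_) _
      rintro p ⟨h1, h2⟩
      exact h ⟨hadd _ h1 _ (circleMap_zero_mem_ball hr4.le (by linarith) θ), h2⟩
  have heq : EqOn (fun p : ℂ × ℂ => deriv (fun z => F (z, p.2)) p.1) (fun p : ℂ × ℂ =>
      ∫ θ in (0)..(2 * Real.pi), cauchyKernel (r / 4) 1 θ * F (p.1 + circleMap 0 (r / 4) θ, p.2))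
      (Metric.ball z₀ (r / 2) ×ˢ Metric.ball q₀ r) := by
    rintro ⟨z, q⟩ ⟨h1, h2⟩
    have hf : DifferentiableOn ℂ (fun w => F (z + w, q)) (Metric.closedBall 0 (r / 4)) := by
      refine hF.comp (f := fun w : ℂ => (z + w, q)) (by fun_prop) fun w hw => ?_
      exact h ⟨hadd _ h1 _ (Metric.closedBall_subset_ball (by linarith) hw), h2⟩
    have h3 := taylorCoeff_eq_integral hr4 hf 1
    rw [taylorCoeff, iteratedDeriv_one, Nat.factorial_one, Nat.cast_one, div_one] at h3
    simp only
    rw [← h3, deriv_comp_const_add (f := fun w => F (w, q)), add_zero]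
  exact ((key.congr heq).differentiableAt
    (hD.mem_nhds ⟨Metric.mem_ball_self hr2, Metric.mem_ball_self hr⟩)).differentiableWithinAt

/-- Differentiation in z commutes with the Cauchy integral in q. -/
theorem hasDerivAt_taylorCoeff (hΩ : IsOpen Ω) (hF : DifferentiableOn ℂ F Ω) {z₀ : ℂ}
    (hz : (z₀, (0 : ℂ)) ∈ Ω) (j : ℕ) :
    HasDerivAt (fun z => taylorCoeff (fun q => F (z, q)) j)
      (taylorCoeff (fun q => deriv (fun z => F (z, q)) z₀) j) z₀ := by
  obtain ⟨r, hr, h⟩ := exists_ball_prod_subset hΩ hz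
  have hr2 : 0 < r / 2 := by positivity
  have hball : ∀ θ, circleMap 0 (r / 2) θ ∈ Metric.ball (0 : ℂ) r := fun θ =>
    circleMap_zero_mem_ball hr2.le (by linarith) θ
  have hint : ∀ G : ℂ × ℂ → ℂ, DifferentiableOn ℂ G Ω → ∀ z ∈ Metric.ball z₀ r,
      taylorCoeff (fun q => G (z, q)) j = ∫ θ in (0)..(2 * Real.pi), cauchyKernel (r / 2) j θ *
        G (z, circleMap 0 (r / 2) θ) := fun G hG z hz => by
    refine taylorCoeff_eq_integral (f := fun q => G (z, q)) hr2 (hG.comp (f := fun q : ℂ => (z, q))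
      (by fun_prop) fun q hq => h ⟨hz, Metric.closedBall_subset_ball (by linarith) hq⟩) j
  have h1 := hasDerivAt_intervalIntegral_deriv (a := 0) (b := 2 * Real.pi)
    (f := fun z θ => cauchyKernel (r / 2) j θ * F (z, circleMap 0 (r / 2) θ))
    (U := Metric.ball z₀ r) (by positivity) Metric.isOpen_ball ?_ ?_ (Metric.mem_ball_self hr)
  · have h2 : ∀ θ : ℝ, deriv (fun z => cauchyKernel (r / 2) j θ * F (z, circleMap 0 (r / 2) θ)) z₀ =
        cauchyKernel (r / 2) j θ * deriv (fun z => F (z, circleMap 0 (r / 2) θ)) z₀ := fun θ => by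
      simp
    simp only [h2] at h1
    rw [← hint (fun p => deriv (fun z => F (z, p.2)) p.1) (differentiableOn_deriv_left hΩ hF) z₀
      (Metric.mem_ball_self hr)] at h1
    refine h1.congr_of_eventuallyEq ?_
    filter_upwards [Metric.ball_mem_nhds z₀ hr] with z hz using hint F hF z hz
  · refine (((continuous_cauchyKernel hr2 j).comp continuous_snd).continuousOn).mul ?_
    have hc := continuous_circleMap 0 (r / 2)
    exact hF.continuousOn.comp (f := fun p : ℂ × ℝ => (p.1, circleMap 0 (r / 2) p.2)) (by fun_prop)
      fun p hp => h ⟨hp.1, hball _⟩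
  · intro θ _
    exact DifferentiableOn.const_mul (hF.comp (f := fun z : ℂ => (z, circleMap 0 (r / 2) θ))
      (by fun_prop) fun z hz => h ⟨hz, hball θ⟩) _

/-- Differentiation of Taylor coefficients which are polynomials on `(-1, 1)`. -/
theorem taylorCoeff_deriv_left (hΩ : IsOpen Ω) (hF : DifferentiableOn ℂ F Ω)
    (hmem : ∀ z ∈ Ioo (-1 : ℝ) 1, ((z : ℂ), (0 : ℂ)) ∈ Ω) {p : ℕ → Polynomial ℂ} {j : ℕ}
    (hp : ∀ z ∈ Ioo (-1 : ℝ) 1, taylorCoeff (fun q => F ((z : ℂ), q)) j = (p j).eval (z : ℂ))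
    {z : ℝ} (hz : z ∈ Ioo (-1 : ℝ) 1) :
    taylorCoeff (fun q => deriv (fun w => F (w, q)) (z : ℂ)) j =
      (p j).derivative.eval (z : ℂ) := by
  have h1 := (hasDerivAt_taylorCoeff hΩ hF (hmem z hz) j).comp_ofReal
  have h2 := ((p j).hasDerivAt (z : ℂ)).comp_ofReal
  refine h1.unique (h2.congr_of_eventuallyEq ?_)
  filter_upwards [isOpen_Ioo.mem_nhds hz] with s hs using hp s hs

end Cauchy

/-! ### The Gegenbauer operator -/

section GegenbauerOp

open Polynomial

/-- The Gegenbauer operator `(1 - X²) p'' - (2a + 1) X p' + μ p`. -/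
noncomputable def gegenbauerOp (a μ : ℂ) (p : ℂ[X]) : ℂ[X] :=
  (1 - X ^ 2) * derivative (derivative p) - C (2 * a + 1) * (X * derivative p) + C μ * p

theorem coeff_gegenbauerOp (a μ : ℂ) (p : ℂ[X]) (i : ℕ) :
    (gegenbauerOp a μ p).coeff i =
      (i + 2) * (i + 1) * p.coeff (i + 2) + (μ - i * (i + 2 * a)) * p.coeff i := by
  have h1 : (X ^ 2 * derivative (derivative p)).coeff i = i * (i - 1) * p.coeff i := by
    rw [coeff_X_pow_mul']
    split_ifs with h
    · obtain ⟨k, rfl⟩ := Nat.exists_eq_add_of_le h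
      rw [Nat.add_sub_cancel_left, coeff_derivative, coeff_derivative, add_comm 2 k]
      push_cast
      ring
    · interval_cases i <;> simp
  have h2 : (X * derivative p).coeff i = i * p.coeff i := by
    rcases i with _ | i
    · simp
    · rw [coeff_X_mul, coeff_derivative]; push_cast; ring
  rw [gegenbauerOp, coeff_add, coeff_sub, sub_mul, one_mul, coeff_sub, coeff_C_mul, coeff_C_mul, h1,
    h2, coeff_derivative, coeff_derivative]
  push_cast
  ring

/-- The operator is triangular on monomials, so the top coefficient determines μ from the degree. -/
theorem eq_of_gegenbauerOp_eq_zero {a μ : ℂ} {p : ℂ[X]} (hp : p ≠ 0) (h : gegenbauerOp a μ p = 0) :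
    μ = p.natDegree * (p.natDegree + 2 * a) := by
  have h1 := coeff_gegenbauerOp a μ p p.natDegree
  rw [h, coeff_zero, coeff_eq_zero_of_natDegree_lt (by omega), mul_zero, zero_add] at h1
  have h2 : p.coeff p.natDegree ≠ 0 := by simpa using hp
  have h3 := (mul_eq_zero.1 h1.symm).resolve_right h2
  linear_combination h3

theorem gegenbauerOp_sub (a μ : ℂ) (p r : ℂ[X]) :
    gegenbauerOp a μ (p - r) = gegenbauerOp a μ p - gegenbauerOp a μ r := by
  simp only [gegenbauerOp, derivative_sub]; ring

theorem gegenbauerOp_C_mul (a μ c : ℂ) (p : ℂ[X]) :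
    gegenbauerOp a μ (C c * p) = C c * gegenbauerOp a μ p := by
  simp only [gegenbauerOp, derivative_C_mul]; ring

theorem eq_zero_of_eval_Ioo {p : ℂ[X]} (h : ∀ z ∈ Ioo (-1 : ℝ) 1, p.eval (z : ℂ) = 0) : p = 0 := by
  refine eq_zero_of_infinite_isRoot p (((Ioo_infinite (by norm_num : (-1 : ℝ) < 1)).image
    (Complex.ofReal_injective.injOn)).mono ?_)
  rintro _ ⟨z, hz, rfl⟩
  exact h z hz

end GegenbauerOp

/-! ### The lowest Taylor coefficient of a solution -/

section LowestCoefficient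

variable {κ a : ℝ} {Ω : Set (ℂ × ℂ)} {F : ℂ × ℂ → ℂ}

theorem lamSigma_continuousAt_zero : ContinuousAt lamSigma 0 ∧ lamSigma 0 = 0 := by
  constructor
  · have h := ((isLambert_lamS.mul isLambert_lamS).hasDerivAt_nome (q := 0) (ρ := 1)
      (e := fun _ => 1) (by simp) zero_le_one (by simp) (by simp)).continuousAt
    simp only [mul_one] at h
    exact h
  · rw [lamSigma]
    refine (tsum_congr fun m => ?_).trans tsum_zero
    rcases eq_or_ne m 0 with rfl | hm <;> simp [lamS, *]

theorem lamCos_continuousAt_zero (x : ℝ) :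
    ContinuousAt (fun q => lamCos (fun m q => lamS m q * lamS m q) x q) 0 ∧
    lamCos (fun m q => lamS m q * lamS m q) x 0 = 0 := by
  constructor
  · exact ((isLambert_lamS.mul isLambert_lamS).hasDerivAt_nome (q := 0) (ρ := 1)
      (e := fun m => Complex.cos (m * x)) (by simp) zero_le_one (by simp)
      (fun m => by simpa using norm_cos_nat_mul_le m (x : ℂ))).continuousAt
  · rw [lamCos]
    refine (tsum_congr fun m => ?_).trans tsum_zero
    rcases eq_or_ne m 0 with rfl | hm <;> simp [lamS, *]

theorem lamSin_continuousAt_zero (x : ℝ) :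
    ContinuousAt (fun q => lamSin lamT x q) 0 ∧ lamSin lamT x 0 = 0 := by
  constructor
  · exact (isLambert_lamT.hasDerivAt_nome (q := 0) (ρ := 1)
      (e := fun m => Complex.sin (m * x)) (by simp) zero_le_one (by simp)
      (fun m => by simpa using norm_sin_nat_mul_le m (x : ℂ))).continuousAt
  · rw [lamSin]
    refine (tsum_congr fun m => ?_).trans tsum_zero
    rcases eq_or_ne m 0 with rfl | hm <;> simp [lamT, *]

theorem analyticAt_slice_right (hΩ : IsOpen Ω) (hF : DifferentiableOn ℂ F Ω) {z q : ℂ}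
    (h : (z, q) ∈ Ω) : AnalyticAt ℂ (fun q => F (z, q)) q :=
  (hF.comp (f := fun q : ℂ => (z, q)) (s := {q | (z, q) ∈ Ω}) (by fun_prop)
    fun _ h => h).analyticAt ((hΩ.preimage (by fun_prop)).mem_nhds h)

/-- Divide the equation by q^j and let q → 0. Then φ(x) → cot x, the potential tends to a², and q
∂_q becomes multiplication by j. In the variable z = cos x the limit is a Gegenbauer equation. -/
theorem gegenbauerOp_taylorCoeff (hΩ : IsOpen Ω) (hF : DifferentiableOn ℂ F Ω)
    (hmem : ∀ (y : ℝ) (q : ℂ), ‖q‖ < 1 → (Complex.cos y, q) ∈ Ω) {p : ℕ → Polynomial ℂ}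
    (hp : ∀ j, ∀ z ∈ Ioo (-1 : ℝ) 1, taylorCoeff (fun q => F ((z : ℂ), q)) j = (p j).eval (z : ℂ))
    {E : ℂ} (hE : ∀ x ∈ Ioo 0 Real.pi, ∀ q : ℂ, ‖q‖ < 1 → q ≠ 0 →
      reducedOp κ a F x q = E * F (Complex.cos x, q))
    {j : ℕ} (hj : ∀ i < j, p i = 0) :
    gegenbauerOp a (E + 2 * κ * j - a ^ 2) (p j) = 0 := by
  refine eq_zero_of_eval_Ioo fun z hz => ?_
  obtain ⟨x, hx, rfl⟩ : ∃ x ∈ Ioo 0 Real.pi, Real.cos x = z :=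
    ⟨Real.arccos z, ⟨Real.arccos_pos.2 hz.2, by
      rw [← Real.arccos_neg_one]; exact Real.strictAntiOn_arccos ⟨le_rfl, by norm_num⟩
        ⟨hz.1.le, hz.2.le⟩ hz.1⟩, Real.cos_arccos hz.1.le hz.2.le⟩
  have hmem0 : ∀ z ∈ Ioo (-1 : ℝ) 1, ((z : ℂ), (0 : ℂ)) ∈ Ω := fun z hz => by
    have := hmem (Real.arccos z) 0 (by simp)
    rwa [← Complex.ofReal_cos, Real.cos_arccos hz.1.le hz.2.le] at this
  have hF1 := differentiableOn_deriv_left hΩ hF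
  have hF2 := differentiableOn_deriv_left hΩ hF1
  have hp1 := fun i z hz => taylorCoeff_deriv_left hΩ hF hmem0 (p := p) (hp i) (z := z) hz
  have hp2 := fun i z hz => taylorCoeff_deriv_left hΩ hF1 hmem0
    (p := fun i => Polynomial.derivative (p i)) (hp1 i) (z := z) hz
  have hz0 := hmem0 _ hz
  obtain ⟨f, hfa, hf, hf0⟩ := exists_eq_pow_mul_of_taylorCoeff_eq_zero
    (analyticAt_slice_right hΩ hF hz0) (j := j) fun i hi => by rw [hp i _ hz, hj i hi]; simp
  obtain ⟨f1, hf1a, hf1, hf10⟩ := exists_eq_pow_mul_of_taylorCoeff_eq_zero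
    (analyticAt_slice_right hΩ hF1 hz0) (j := j) fun i hi => by
      simp only; rw [hp1 i _ hz, hj i hi]; simp
  obtain ⟨f2, hf2a, hf2, hf20⟩ := exists_eq_pow_mul_of_taylorCoeff_eq_zero
    (analyticAt_slice_right hΩ hF2 hz0) (j := j) fun i hi => by
      simp only; rw [hp2 i _ hz, hj i hi]; simp
  rw [hp j _ hz] at hf0
  simp only at hf1 hf2 hf10 hf20
  rw [hp1 j _ hz] at hf10
  rw [hp2 j _ hz] at hf20
  have hsin := (Real.sin_pos_of_pos_of_lt_pi hx.1 hx.2).ne'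
  -- This is q^{-j} times the equation. The factor sin x from d/dx = -sin x d/dz has absorbed the
  -- pole of cot x.
  set B : ℂ → ℂ := fun q => -2 * κ * (j * f q + q * deriv f q)
    - (Complex.sin x ^ 2 * f2 q - Complex.cos x * f1 q)
    + 2 * a * (Complex.cos x + 4 * Complex.sin x * lamSin lamT ((2 * x : ℝ) : ℂ) q) * f1 q
    + (potential κ a x q - E) * f q with hB
  have hBc : ContinuousAt B 0 := by
    have s1 := lamSigma_continuousAt_zero.1
    have s2 := (lamCos_continuousAt_zero (2 * x)).1
    have s3 := (lamSin_continuousAt_zero (2 * x)).1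
    have s4 := hfa.deriv.continuousAt
    have s5 := hfa.continuousAt
    have s6 := hf1a.continuousAt
    have s7 := hf2a.continuousAt
    have s8 : ContinuousAt (fun q => potential κ a x q) 0 := by
      unfold potential
      fun_prop
    rw [hB]
    fun_prop
  have hB0 : B =ᶠ[𝓝[≠] 0] fun _ => 0 := by
    have hne : ∀ᶠ q : ℂ in 𝓝[≠] 0, AnalyticAt ℂ f q := nhdsWithin_le_nhds hfa.eventually_analyticAt
    have hlt : ∀ᶠ q : ℂ in 𝓝[≠] 0, ‖q‖ < 1 := nhdsWithin_le_nhds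
      ((isOpen_lt continuous_norm continuous_const).mem_nhds (by simp))
    filter_upwards [hne, hlt, self_mem_nhdsWithin] with q hqa hq hq0
    have hq0 : q ≠ 0 := hq0
    have h1 := hE x hx q hq hq0
    have h2 := deriv_comp_cos hΩ hF (fun y => hmem y q hq) x
    have h3 : deriv (fun q => F (Complex.cos x, q)) q = j * q ^ (j - 1) * f q + q ^ j * deriv f q := by
      have : (fun q => F (Complex.cos x, q)) = fun q => q ^ j * f q := by
        ext q; rw [← hf q, Complex.ofReal_cos]
      rw [this]
      exact ((hasDerivAt_pow j q).mul hqa.differentiableAt.hasDerivAt).deriv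
    have h4 : q * q ^ (j - 1) * j = q ^ j * j := by
      rcases j with _ | j
      · simp
      · rw [Nat.add_sub_cancel, pow_succ]; ring
    rw [reducedOp, h2.1.deriv, h2.2.deriv, h3, dlogTheta1_two_mul, ← Complex.ofReal_cos, hf q] at h1
    have e2 : deriv (deriv fun z => F (z, q)) ((Real.cos x : ℝ) : ℂ) = q ^ j * f2 q := hf2 q
    rw [hf1 q, e2] at h1
    have hsin' : Complex.sin x ≠ 0 := by exact_mod_cast hsin
    have h5 : q ^ j * B q = 0 := by
      have h6 : Complex.cos x / Complex.sin x * Complex.sin x = Complex.cos x :=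
        div_mul_cancel₀ _ hsin'
      rw [Complex.ofReal_cos] at h1
      rw [hB]
      linear_combination h1 - 2 * a * q ^ j * f1 q * h6 + 2 * κ * f q * h4
    exact (mul_eq_zero.1 h5).resolve_left (pow_ne_zero _ hq0)
  -- The equation is available only for q ≠ 0; its limit is taken by continuity.
  have h0 : B 0 = 0 := tendsto_nhds_unique (hBc.tendsto.mono_left nhdsWithin_le_nhds)
    (tendsto_const_nhds.congr' hB0.symm)
  rw [hB] at h0
  simp only [potential, lamSigma_continuousAt_zero.2, (lamCos_continuousAt_zero (2 * x)).2,
    (lamSin_continuousAt_zero (2 * x)).2, hf0, hf10, hf20] at h0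
  have h7 := Complex.sin_sq_add_cos_sq x
  simp only [gegenbauerOp, Polynomial.eval_add, Polynomial.eval_sub, Polynomial.eval_mul,
    Polynomial.eval_pow, Polynomial.eval_one, Polynomial.eval_X, Polynomial.eval_C]
  rw [Complex.ofReal_cos] at h0 ⊢
  linear_combination -h0 - (Polynomial.derivative (Polynomial.derivative (p j))).eval
    (Complex.cos x) * h7

end LowestCoefficient

/-! ### Gegenbauer polynomials -/

section Gegenbauer

open Polynomial

variable {g : ℝ} {n : ℕ}

theorem poch_succ (a : ℝ) (n : ℕ) : poch a (n + 1) = poch a n * (a + n) := by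
  rw [poch, poch, ascPochhammer_succ_eval]

theorem poch_zero (a : ℝ) : poch a 0 = 1 := by simp [poch]

theorem poch_pos {a : ℝ} (ha : 0 < a) (n : ℕ) : 0 < poch a n := ascPochhammer_pos n a ha

theorem coeff_gegenbauer_sum (hg : g ≠ 0) (n i : ℕ) : (gegenbauer g n).coeff i =
    ∑ k ∈ Finset.range (n / 2 + 1), if i = n - 2 * k then
      (((-1) ^ k * poch g (n - k) / (k.factorial * (n - 2 * k).factorial) : ℝ) : ℂ) * 2 ^ i
      else 0 := by
  rw [gegenbauer, if_neg hg, finsetSum_coeff]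
  refine Finset.sum_congr rfl fun k _ => ?_
  rw [mul_pow, show (2 : ℂ[X]) = C 2 from rfl, ← C_pow, coeff_C_mul, coeff_C_mul, coeff_X_pow]
  split_ifs with h
  · rw [h, mul_one]
  · simp

theorem coeff_gegenbauer (hg : g ≠ 0) (i k : ℕ) : (gegenbauer g (i + 2 * k)).coeff i =
    (-1) ^ k * poch g (i + k) * 2 ^ i / (k.factorial * i.factorial) := by
  rw [coeff_gegenbauer_sum hg, Finset.sum_eq_single k]
  · rw [if_pos (by omega), show i + 2 * k - k = i + k by omega, Nat.add_sub_cancel]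
    push_cast
    ring
  · intro b hb hbk
    rw [Finset.mem_range] at hb
    exact if_neg (by omega)
  · intro h
    rw [Finset.mem_range] at h
    omega

theorem coeff_gegenbauer_eq_zero (hg : g ≠ 0) {i : ℕ} (h : ∀ k, n ≠ i + 2 * k) :
    (gegenbauer g n).coeff i = 0 := by
  rw [coeff_gegenbauer_sum hg]
  refine Finset.sum_eq_zero fun k hk => if_neg fun hi => h k ?_
  rw [Finset.mem_range] at hk
  omega

theorem gegenbauer_zero_left (n : ℕ) : gegenbauer 0 n = Chebyshev.T ℂ n := if_pos rfl

theorem natDegree_gegenbauer_le (g : ℝ) (n : ℕ) : (gegenbauer g n).natDegree ≤ n := by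
  rcases eq_or_ne g 0 with rfl | hg
  · rw [gegenbauer_zero_left, Chebyshev.natDegree_T, Int.natAbs_natCast]
  · rw [natDegree_le_iff_coeff_eq_zero]
    exact fun i hi => coeff_gegenbauer_eq_zero hg fun k => by omega

/-- The coefficient of `z^n` in `C_n^{(g)}(z)`. -/
noncomputable def gegenbauerLead (g : ℝ) (n : ℕ) : ℂ :=
  if g = 0 then (if n = 0 then 1 else 2 ^ (n - 1)) else 2 ^ n * poch g n / n.factorial

theorem coeff_gegenbauer_self (g : ℝ) (n : ℕ) : (gegenbauer g n).coeff n = gegenbauerLead g n := by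
  rcases eq_or_ne g 0 with rfl | hg
  · have h := Chebyshev.leadingCoeff_T ℂ n
    rw [leadingCoeff, Chebyshev.natDegree_T, Int.natAbs_natCast] at h
    rw [gegenbauer_zero_left, h, gegenbauerLead, if_pos rfl]
    rcases eq_or_ne n 0 with rfl | hn
    · simp
    · simp [hn]
  · have h := coeff_gegenbauer hg n 0
    rw [mul_zero, add_zero] at h
    rw [h, gegenbauerLead, if_neg hg]
    simp
    ring

theorem gegenbauer_eval_neg (g : ℝ) (n : ℕ) (z : ℂ) :
    (gegenbauer g n).eval (-z) = (-1) ^ n * (gegenbauer g n).eval z := by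
  rcases eq_or_ne g 0 with rfl | hg
  · rw [gegenbauer_zero_left, chebyshevT_eval_neg]
  · rw [gegenbauer, if_neg hg, eval_finsetSum, eval_finsetSum, Finset.mul_sum]
    refine Finset.sum_congr rfl fun k hk => ?_
    rw [Finset.mem_range] at hk
    have h1 : (-1 : ℂ) ^ n = (-1) ^ (n - 2 * k) := by
      conv_lhs => rw [show n = n - 2 * k + 2 * k by omega, pow_add, pow_mul]
      simp
    rw [h1]
    simp only [eval_mul, eval_C, eval_pow, eval_X, eval_ofNat]
    rw [mul_neg, neg_eq_neg_one_mul (2 * z), mul_pow (-1 : ℂ)]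
    exact mul_left_comm _ _ _

/-- For g ≠ 0 the operator couples only the coefficients i and i + 2, whose ratio is explicit; for g
= 0 it is Chebyshev's equation. -/
theorem gegenbauerOp_gegenbauer (g : ℝ) (n : ℕ) :
    gegenbauerOp g (n * (n + 2 * g)) (gegenbauer g n) = 0 := by
  rcases eq_or_ne g 0 with rfl | hg
  · have h := Chebyshev.one_sub_X_sq_mul_derivative_derivative_T_eq_poly_in_T (R := ℂ) n
    rw [gegenbauer_zero_left]
    simp only [Function.iterate_succ, Function.iterate_zero, Function.comp, id] at h
    rw [gegenbauerOp, h]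
    simp
    ring
  · ext i
    rw [coeff_gegenbauerOp, coeff_zero]
    by_cases h : ∃ k, n = i + 2 * k
    · obtain ⟨k, rfl⟩ := h
      rcases k with _ | k
      · rw [coeff_gegenbauer_eq_zero hg fun k => by omega]
        push_cast
        ring
      · have h1 := coeff_gegenbauer hg (i + 2) k
        have h2 := coeff_gegenbauer hg i (k + 1)
        have h3 := poch_succ g (i + k + 1)
        rw [show i + 2 + 2 * k = i + 2 * (k + 1) by ring, show i + 2 + k = i + k + 1 + 1 by ring,
          h3] at h1
        rw [h1, h2, show i + (k + 1) = i + k + 1 by ring]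
        have f1 := Nat.factorial_ne_zero i
        have f2 := Nat.factorial_ne_zero k
        have f3 : (i : ℂ) + 1 ≠ 0 := by exact_mod_cast Nat.succ_ne_zero i
        have f4 : (i : ℂ) + 1 + 1 ≠ 0 := by exact_mod_cast Nat.succ_ne_zero (i + 1)
        have f5 : (k : ℂ) + 1 ≠ 0 := by exact_mod_cast Nat.succ_ne_zero k
        rw [Nat.factorial_succ (i + 1), Nat.factorial_succ i, Nat.factorial_succ k]
        push_cast
        have f1' : (i.factorial : ℂ) ≠ 0 := by exact_mod_cast f1
        have f2' : (k.factorial : ℂ) ≠ 0 := by exact_mod_cast f2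
        field_simp
        ring
    · push Not at h
      rw [coeff_gegenbauer_eq_zero hg h, coeff_gegenbauer_eq_zero hg fun k hk => h (k + 1) (by omega)]
      ring

/-- Compared coefficient by coefficient. Its purpose is to relate consecutive moments of the
Gegenbauer weight. -/
theorem gegenbauer_recurrence (hg : g ≠ 0) (n : ℕ) :
    C ((n : ℂ) + 2) * gegenbauer g (n + 2) = C (2 * ((n : ℂ) + 1 + g)) * (X * gegenbauer g (n + 1)) -
      C ((n : ℂ) + 2 * g) * gegenbauer g n := by
  ext i
  rw [coeff_sub, coeff_C_mul, coeff_C_mul, coeff_C_mul]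
  by_cases h : ∃ k, n + 2 = i + 2 * k
  · obtain ⟨k, hk⟩ := h
    rcases i with _ | i
    · obtain ⟨k, rfl⟩ : ∃ l, k = l + 1 := ⟨k - 1, by omega⟩
      obtain rfl : n = 0 + 2 * k := by omega
      have h1 := coeff_gegenbauer hg 0 (k + 1)
      have h2 := coeff_gegenbauer hg 0 k
      rw [show 0 + 2 * (k + 1) = 0 + 2 * k + 2 by ring] at h1
      rw [coeff_X_mul_zero, h1, h2, zero_add, zero_add, poch_succ, Nat.factorial_succ]
      have f5 : (k : ℂ) + 1 ≠ 0 := by exact_mod_cast Nat.succ_ne_zero k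
      have f2' : (k.factorial : ℂ) ≠ 0 := by exact_mod_cast Nat.factorial_ne_zero k
      simp only [zero_add]
      push_cast
      field_simp
      ring
    · rw [coeff_X_mul]
      have h2 := coeff_gegenbauer hg i k
      rw [show i + 2 * k = n + 1 by omega] at h2
      have h1 := coeff_gegenbauer hg (i + 1) k
      rw [show i + 1 + 2 * k = n + 2 by omega, show i + 1 + k = i + k + 1 by ring, poch_succ,
        Nat.factorial_succ] at h1
      have f3 : (i : ℂ) + 1 ≠ 0 := by exact_mod_cast Nat.succ_ne_zero i
      have f1' : (i.factorial : ℂ) ≠ 0 := by exact_mod_cast Nat.factorial_ne_zero i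
      rcases k with _ | k
      · rw [h1, h2, coeff_gegenbauer_eq_zero (n := n) hg fun k => by omega]
        obtain rfl : n + 1 = i := by omega
        push_cast at f3 ⊢
        field_simp
        ring
      · have h3 := coeff_gegenbauer hg (i + 1) k
        rw [show i + 1 + 2 * k = n by omega, show i + 1 + k = i + (k + 1) by ring,
          Nat.factorial_succ] at h3
        have f5 : (k : ℂ) + 1 ≠ 0 := by exact_mod_cast Nat.succ_ne_zero k
        have f2' : (k.factorial : ℂ) ≠ 0 := by exact_mod_cast Nat.factorial_ne_zero k
        rw [h1, h2, h3, Nat.factorial_succ]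
        obtain rfl : n = i + 1 + 2 * k := by omega
        push_cast
        field_simp
        ring
  · push Not at h
    rw [coeff_gegenbauer_eq_zero hg h, coeff_gegenbauer_eq_zero (n := n) hg
      fun k hk => h (k + 1) (by omega)]
    rcases i with _ | i
    · simp
    · rw [coeff_X_mul, coeff_gegenbauer_eq_zero hg fun k hk => h k (by omega)]
      ring

end Gegenbauer

/-! ### Gegenbauer integrals and the normalization constant -/

section Moments

open Polynomial

variable {b : ℝ}

/-- The integral `(2π)⁻¹ ∫_{-π}^{π} (sin² y)^b f(cos y) dy`. -/
noncomputable def gegenbauerIntegral (b : ℝ) (f : ℂ[X]) : ℂ :=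
  1 / (2 * Real.pi) * ∫ y in (-Real.pi)..Real.pi,
    (((Real.sin y ^ 2) ^ b : ℝ) : ℂ) * f.eval (Complex.cos y)

theorem continuous_gegenbauerIntegrand (hb : 0 ≤ b) (f : ℂ[X]) : Continuous fun y : ℝ =>
    (((Real.sin y ^ 2) ^ b : ℝ) : ℂ) * f.eval (Complex.cos y) :=
  (Complex.continuous_ofReal.comp (continuous_sin_sq_rpow hb)).mul
    (f.continuous.comp (Complex.continuous_cos.comp Complex.continuous_ofReal))

theorem gegenbauerIntegral_add (hb : 0 ≤ b) (f h : ℂ[X]) :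
    gegenbauerIntegral b (f + h) = gegenbauerIntegral b f + gegenbauerIntegral b h := by
  simp only [gegenbauerIntegral, eval_add, mul_add]
  rw [intervalIntegral.integral_add ((continuous_gegenbauerIntegrand hb f).intervalIntegrable _ _)
    ((continuous_gegenbauerIntegrand hb h).intervalIntegrable _ _)]
  ring

theorem gegenbauerIntegral_C_mul (c : ℂ) (f : ℂ[X]) :
    gegenbauerIntegral b (C c * f) = c * gegenbauerIntegral b f := by
  simp only [gegenbauerIntegral, eval_mul, eval_C, mul_left_comm _ c]
  rw [intervalIntegral.integral_const_mul]
  ring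

theorem gegenbauerIntegral_sub (hb : 0 ≤ b) (f h : ℂ[X]) :
    gegenbauerIntegral b (f - h) = gegenbauerIntegral b f - gegenbauerIntegral b h := by
  rw [sub_eq_add_neg, ← neg_one_mul, show (-1 : ℂ[X]) = C (-1) by simp, gegenbauerIntegral_add hb,
    gegenbauerIntegral_C_mul]
  ring

theorem gegenbauerIntegral_zero : gegenbauerIntegral b 0 = 0 := by
  simp [gegenbauerIntegral]

theorem gegenbauerIntegral_sum (hb : 0 ≤ b) {ι : Type*} (s : Finset ι) (f : ι → ℂ[X]) :
    gegenbauerIntegral b (∑ i ∈ s, f i) = ∑ i ∈ s, gegenbauerIntegral b (f i) := by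
  classical
  induction s using Finset.induction_on with
  | empty => simp [gegenbauerIntegral_zero]
  | insert i s hi ih => rw [Finset.sum_insert hi, Finset.sum_insert hi, gegenbauerIntegral_add hb, ih]

/-- The integrand is the derivative of -(sin² y)^b sin y f(cos y), which vanishes at ±π. -/
theorem gegenbauerIntegral_eq_zero_of_total_derivative (hb : 0 ≤ b) (f : ℂ[X]) :
    gegenbauerIntegral b ((1 - X ^ 2) * derivative f - C (2 * (b : ℂ) + 1) * (X * f)) = 0 := by
  have hc := continuous_gegenbauerIntegrand hb
    ((1 - X ^ 2) * derivative f - C (2 * (b : ℂ) + 1) * (X * f))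
  have hftc := MeasureTheory.integral_eq_of_hasDerivAt_off_countable
    (fun y : ℝ => -((((Real.sin y ^ 2) ^ b : ℝ) : ℂ) * (Complex.sin y * f.eval (Complex.cos y)))) _
    (countable_singleton (0 : ℝ)) (a := -Real.pi) (b := Real.pi) ?_ (fun y hy => ?_)
    (hc.intervalIntegrable _ _)
  · rw [gegenbauerIntegral, hftc]
    simp
  · refine Continuous.continuousOn ?_
    exact ((Complex.continuous_ofReal.comp (continuous_sin_sq_rpow hb)).mul
      ((Complex.continuous_sin.comp Complex.continuous_ofReal).mul
        (f.continuous.comp (Complex.continuous_cos.comp Complex.continuous_ofReal)))).neg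
  · obtain ⟨hy, hy0⟩ := hy
    rw [min_eq_left (by linarith [Real.pi_pos]), max_eq_right (by linarith [Real.pi_pos])] at hy
    have hs : Real.sin y ≠ 0 := sin_ne_zero_of_mem_Ioo hy hy0
    have h1 : HasDerivAt (fun y : ℝ => (((Real.sin y ^ 2) ^ b : ℝ) : ℂ))
        (((Real.sin y ^ 2) ^ b : ℝ) * (2 * b * (Real.cos y / Real.sin y)) : ℝ) y := by
      have h := ((Real.hasDerivAt_sin y).pow 2).rpow_const (p := b) (Or.inl (pow_ne_zero 2 hs))
      refine HasDerivAt.ofReal_comp (h.congr_deriv ?_)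
      rw [Pi.pow_apply, Real.rpow_sub_one (pow_ne_zero 2 hs)]
      push_cast
      field_simp
    have h2 : HasDerivAt (fun y : ℝ => Complex.sin y) (Complex.cos y) y :=
      (Complex.hasDerivAt_sin _).comp_ofReal
    have h3 : HasDerivAt (fun y : ℝ => f.eval (Complex.cos y))
        ((derivative f).eval (Complex.cos y) * -Complex.sin y) y :=
      ((f.hasDerivAt _).comp _ (Complex.hasDerivAt_cos _)).comp_ofReal
    refine (h1.mul (h2.mul h3)).neg.congr_deriv ?_
    simp only [eval_sub, eval_mul, eval_pow, eval_one, eval_X, eval_C]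
    have hs' : Complex.sin y ≠ 0 := by rw [← Complex.ofReal_sin]; exact_mod_cast hs
    push_cast
    have h4 := Complex.sin_sq_add_cos_sq y
    simp only [Pi.mul_apply]
    field_simp
    linear_combination ((derivative f).eval (Complex.cos y) * (((Real.sin y ^ 2) ^ b : ℝ) : ℂ)) * h4

theorem gegenbauerIntegral_gegenbauerOp_symm (hb : 0 ≤ b) (μ : ℂ) (f h : ℂ[X]) :
    gegenbauerIntegral b (gegenbauerOp b μ f * h) = gegenbauerIntegral b (f * gegenbauerOp b μ h) := by
  rw [← sub_eq_zero, ← gegenbauerIntegral_sub hb]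
  convert! gegenbauerIntegral_eq_zero_of_total_derivative hb (derivative f * h - f * derivative h)
    using 2
  simp only [gegenbauerOp, derivative_sub, derivative_mul]
  ring

theorem gegenbauerOp_eq_add (a μ : ℂ) (p : ℂ[X]) :
    gegenbauerOp a μ p = gegenbauerOp a 0 p + C μ * p := by
  simp [gegenbauerOp]

theorem gegenbauerOp_X_pow (a : ℂ) (i : ℕ) : gegenbauerOp a 0 (X ^ i) =
    C ((i : ℂ) * (i - 1)) * X ^ (i - 2) - C ((i : ℂ) * (i + 2 * a)) * X ^ i := by
  rcases i with _ | _ | i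
  · simp [gegenbauerOp]
  · simp [gegenbauerOp]
    ring
  · simp only [gegenbauerOp, derivative_X_pow, derivative_mul, Nat.add_sub_cancel, map_mul, map_add, map_sub, map_natCast, map_ofNat, map_one, Nat.cast_add,
      Nat.cast_one]
    simp
    ring

/-- Self-adjointness of the operator. It sends X^i to a multiple of X^i plus a multiple of X^{i-2};
the latter is handled by induction, and the eigenvalues differ by (n - i)(n + i + 2b) ≠ 0. -/
theorem gegenbauerIntegral_X_pow_mul_gegenbauer_eq_zero (hb : 0 ≤ b) {n i : ℕ} (hi : i < n) :
    gegenbauerIntegral b (X ^ i * gegenbauer b n) = 0 := by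
  induction i using Nat.strong_induction_on with
  | _ i ih =>
    have h1 := gegenbauerIntegral_gegenbauerOp_symm hb 0 (X ^ i) (gegenbauer b n)
    have h2 := gegenbauerOp_gegenbauer b n
    rw [gegenbauerOp_eq_add, ← eq_neg_iff_add_eq_zero] at h2
    rw [h2, gegenbauerOp_X_pow, sub_mul, gegenbauerIntegral_sub hb, mul_assoc, mul_assoc,
      gegenbauerIntegral_C_mul, gegenbauerIntegral_C_mul, ← neg_mul, ← C_neg, mul_left_comm,
      gegenbauerIntegral_C_mul] at h1
    have h3 : (i : ℂ) * (i - 1) * gegenbauerIntegral b (X ^ (i - 2) * gegenbauer b n) = 0 := by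
      rcases i with _ | _ | i
      · simp
      · simp
      · rw [ih _ (by omega) (by omega), mul_zero]
    have h4 : ((n : ℂ) - i) * (n + i + 2 * b) * gegenbauerIntegral b (X ^ i * gegenbauer b n) = 0 := by
      linear_combination h1 - h3
    refine (mul_eq_zero.1 h4).resolve_left (mul_ne_zero ?_ ?_)
    · rw [sub_ne_zero]
      exact_mod_cast hi.ne'
    · have : (0 : ℝ) < n + i + 2 * b := by
        have : (0 : ℝ) < n := by exact_mod_cast (by omega : 0 < n)
        positivity
      exact_mod_cast this.ne'

theorem gegenbauerIntegral_X_pow_succ (hb : 0 < b) (n : ℕ) :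
    2 * ((n : ℂ) + 1 + b) * gegenbauerIntegral b (X ^ (n + 1) * gegenbauer b (n + 1)) =
      (n + 2 * b) * gegenbauerIntegral b (X ^ n * gegenbauer b n) := by
  have h1 := congrArg (fun p => gegenbauerIntegral b (X ^ n * p)) (gegenbauer_recurrence hb.ne' n)
  simp only [mul_sub, mul_left_comm (X ^ n) (C _)] at h1
  rw [gegenbauerIntegral_sub hb.le, gegenbauerIntegral_C_mul, gegenbauerIntegral_C_mul,
    gegenbauerIntegral_C_mul, gegenbauerIntegral_X_pow_mul_gegenbauer_eq_zero hb.le (by omega),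
    ← mul_assoc (X ^ n), ← pow_succ] at h1
  linear_combination -h1

theorem gegenbauerIntegral_zero_one : gegenbauerIntegral 0 1 = 1 := by
  simp only [gegenbauerIntegral, Real.rpow_zero, Complex.ofReal_one, one_mul, eval_one]
  rw [intervalIntegral.integral_const]
  have : (Real.pi : ℂ) ≠ 0 := by exact_mod_cast Real.pi_ne_zero
  simp
  field_simp
  ring

/-- At b = 0 the polynomials are renormalized to T_n and satisfy the recurrence T_{n+2} = 2X T_{n+1}
- T_n instead; pair it with X^n and use orthogonality. -/
theorem gegenbauerIntegral_zero_X_pow (n : ℕ) :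
    2 ^ n * gegenbauerIntegral 0 (X ^ n * gegenbauer 0 n) = 1 := by
  induction n with
  | zero => simp [gegenbauer_zero_left, gegenbauerIntegral_zero_one]
  | succ n ih =>
    have h := Chebyshev.T_add_two ℂ n
    have h1 := congrArg (fun p => gegenbauerIntegral 0 (X ^ n * p)) h
    have h2 := gegenbauerIntegral_X_pow_mul_gegenbauer_eq_zero (b := 0) le_rfl
      (show n < n + 2 by omega)
    rw [gegenbauer_zero_left] at h2
    push_cast at h2
    simp only [h2] at h1
    rw [mul_sub, gegenbauerIntegral_sub le_rfl, show (X ^ n * (2 * X * Chebyshev.T ℂ (n + 1)) : ℂ[X]) =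
      C 2 * (X ^ (n + 1) * Chebyshev.T ℂ (n + 1)) by rw [show (2 : ℂ[X]) = C 2 from rfl]; ring,
      gegenbauerIntegral_C_mul] at h1
    rw [gegenbauer_zero_left] at ih ⊢
    push_cast
    rw [pow_succ]
    linear_combination ih - 2 ^ n * h1

theorem integral_zero_one_rpow_mul_rpow {s : ℝ} (hs : -1 < s) :
    ∫ x in (0 : ℝ)..1, x ^ s * (1 - x) ^ s = Real.Gamma (s + 1) ^ 2 / Real.Gamma (2 * s + 2) := by
  have h := Complex.betaIntegral_eq_Gamma_mul_div ((s + 1 : ℝ) : ℂ) ((s + 1 : ℝ) : ℂ)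
    (by simpa using by linarith) (by simpa using by linarith)
  rw [← Complex.ofReal_add, Complex.Gamma_ofReal, Complex.Gamma_ofReal, Complex.betaIntegral] at h
  have h1 : ∫ x in (0 : ℝ)..1, (x : ℂ) ^ (((s + 1 : ℝ) : ℂ) - 1) * (1 - (x : ℂ)) ^ (((s + 1 : ℝ) : ℂ) - 1)
      = ∫ x in (0 : ℝ)..1, ((x ^ s * (1 - x) ^ s : ℝ) : ℂ) := by
    refine intervalIntegral.integral_congr fun x hx => ?_
    rw [uIcc_of_le zero_le_one] at hx
    push_cast
    rw [add_sub_cancel_right, Complex.ofReal_cpow hx.1, Complex.ofReal_cpow (by linarith [hx.2])]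
    push_cast
    rfl
  rw [h1, intervalIntegral.integral_ofReal] at h
  rw [show 2 * s + 2 = s + 1 + (s + 1) by ring, sq]
  exact_mod_cast h

theorem intervalIntegrable_rpow_mul_rpow {s : ℝ} (hs : -1 < s) :
    IntervalIntegrable (fun x : ℝ => x ^ s * (1 - x) ^ s) MeasureTheory.volume 0 1 := by
  have h := (Complex.betaIntegral_convergent (u := ((s + 1 : ℝ) : ℂ)) (v := ((s + 1 : ℝ) : ℂ))
    (by simpa using by linarith) (by simpa using by linarith)).norm
  rw [intervalIntegrable_iff_integrableOn_Ioo_of_le zero_le_one] at h ⊢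
  refine h.congr_fun (fun x hx => ?_) measurableSet_Ioo
  have h1 : (x : ℂ) ^ (((s + 1 : ℝ) : ℂ) - 1) * (1 - (x : ℂ)) ^ (((s + 1 : ℝ) : ℂ) - 1) =
      ((x ^ s * (1 - x) ^ s : ℝ) : ℂ) := by
    push_cast
    rw [add_sub_cancel_right, Complex.ofReal_cpow hx.1.le, Complex.ofReal_cpow (by linarith [hx.2])]
    push_cast
    rfl
  simp only [h1, Complex.norm_real]
  exact Real.norm_of_nonneg (mul_nonneg (Real.rpow_nonneg hx.1.le _)
    (Real.rpow_nonneg (by linarith [hx.2]) _))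

/-- Substitute x = (1 - cos y)/2 in a beta integral: x(1 - x) = sin² y / 4 and dx = (sin y / 2) dy,
so the exponent on the beta side is b - 1/2. -/
theorem integral_sin_sq_rpow (hb : 0 < b) : ∫ y in (0 : ℝ)..Real.pi, (Real.sin y ^ 2) ^ b =
    4 ^ b * (Real.Gamma (b + 1 / 2) ^ 2 / Real.Gamma (2 * b + 1)) := by
  have hI := integral_zero_one_rpow_mul_rpow (s := b - 1 / 2) (by linarith)
  have hint := intervalIntegrable_rpow_mul_rpow (s := b - 1 / 2) (by linarith)
  rw [show b - 1 / 2 + 1 = b + 1 / 2 by ring, show 2 * (b - 1 / 2) + 2 = 2 * b + 1 by ring] at hI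
  have himg : (fun y : ℝ => (1 - Real.cos y) / 2) '' uIcc 0 Real.pi ⊆ Icc 0 1 := by
    rintro _ ⟨y, -, rfl⟩
    exact ⟨by linarith [Real.cos_le_one y], by linarith [Real.neg_one_le_cos y]⟩
  have key : EqOn (fun y => ((fun x : ℝ => x ^ (b - 1 / 2) * (1 - x) ^ (b - 1 / 2)) ∘
      fun y : ℝ => (1 - Real.cos y) / 2) y * (Real.sin y / 2))
      (fun y => (4 ^ b)⁻¹ * (Real.sin y ^ 2) ^ b) (uIcc 0 Real.pi) := by
    intro y hy
    rw [uIcc_of_le Real.pi_pos.le] at hy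
    have hs : 0 ≤ Real.sin y := Real.sin_nonneg_of_nonneg_of_le_pi hy.1 hy.2
    simp only [Function.comp]
    rw [← Real.mul_rpow (by linarith [Real.cos_le_one y]) (by linarith [Real.neg_one_le_cos y]),
      show (1 - Real.cos y) / 2 * (1 - (1 - Real.cos y) / 2) = Real.sin y ^ 2 / 4 by
        rw [Real.sin_sq]; ring]
    rcases hs.eq_or_lt with h0 | h0
    · rw [← h0]
      simp [hb.ne']
    · rw [Real.rpow_sub (by positivity), Real.div_rpow (by positivity) (by norm_num),
        ← Real.sqrt_eq_rpow, show Real.sin y ^ 2 / 4 = (Real.sin y / 2) ^ 2 by ring,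
        Real.sqrt_sq (by positivity)]
      field_simp
  have hcont : Continuous fun y : ℝ => (4 ^ b)⁻¹ * (Real.sin y ^ 2) ^ b :=
    (continuous_sin_sq_rpow hb.le).const_mul _
  have hsub := intervalIntegral.integral_comp_mul_deriv''' (a := 0) (b := Real.pi)
    (f := fun y => (1 - Real.cos y) / 2) (f' := fun y => Real.sin y / 2)
    (g := fun x : ℝ => x ^ (b - 1 / 2) * (1 - x) ^ (b - 1 / 2))
    (by fun_prop)
    (fun y _ => ((((Real.hasDerivAt_cos y).const_sub 1).div_const 2).congr_deriv
      (by ring)).hasDerivWithinAt) ?_ ?_ ?_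
  · rw [intervalIntegral.integral_congr key, intervalIntegral.integral_const_mul] at hsub
    rw [show (1 - Real.cos 0) / 2 = 0 by simp, show (1 - Real.cos Real.pi) / 2 = 1 by norm_num,
      hI] at hsub
    rw [← hsub]
    field_simp
  · have hpi := Real.pi_pos
    rintro _ ⟨y, hy, rfl⟩
    rw [min_eq_left hpi.le, max_eq_right hpi.le] at hy
    have h1 : Real.cos y < 1 := by
      have := Real.cos_lt_cos_of_nonneg_of_le_pi le_rfl hy.2.le hy.1
      simpa using this
    have h2 : -1 < Real.cos y := by
      have := Real.cos_lt_cos_of_nonneg_of_le_pi hy.1.le le_rfl hy.2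
      simpa using this
    refine ContinuousAt.continuousWithinAt (ContinuousAt.mul ?_ ?_)
    · exact continuousAt_id.rpow_const (Or.inl (by simp only [id]; linarith))
    · exact (by fun_prop : ContinuousAt (fun x : ℝ => 1 - x) _).rpow_const (Or.inl (by linarith))
  · rw [intervalIntegrable_iff_integrableOn_Icc_of_le zero_le_one] at hint
    exact hint.mono_set himg
  · exact (hcont.continuousOn.integrableOn_compact isCompact_uIcc).congr_fun key.symm
      measurableSet_uIcc

/-- Legendre's duplication formula brings the beta integral to the form of 𝔥₀. -/
theorem gegenbauerIntegral_one (hb : 0 < b) :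
    gegenbauerIntegral b 1 = (gegenbauerNorm 0 b : ℝ) := by
  have hc : Continuous fun y => (Real.sin y ^ 2) ^ b := continuous_sin_sq_rpow hb.le
  have h1 : ∫ y in (-Real.pi)..Real.pi, (Real.sin y ^ 2) ^ b =
      2 * ∫ y in (0 : ℝ)..Real.pi, (Real.sin y ^ 2) ^ b := by
    rw [← intervalIntegral.integral_add_adjacent_intervals (hc.intervalIntegrable _ 0)
      (hc.intervalIntegrable _ _)]
    have := intervalIntegral.integral_comp_neg (a := 0) (b := Real.pi)
      (fun y => (Real.sin y ^ 2) ^ b)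
    simp only [Real.sin_neg, neg_sq, neg_zero] at this
    rw [← this]
    ring
  have h2 : gegenbauerIntegral b 1 = ((1 / (2 * Real.pi) *
      ∫ y in (-Real.pi)..Real.pi, (Real.sin y ^ 2) ^ b : ℝ) : ℂ) := by
    simp only [gegenbauerIntegral, eval_one, mul_one]
    rw [intervalIntegral.integral_ofReal]
    push_cast
    rfl
  rw [h2, h1, integral_sin_sq_rpow hb, gegenbauerNorm]
  congr 1
  have hG := Real.Gamma_mul_Gamma_add_half b
  have hGb := (Real.Gamma_pos_of_pos hb).ne'
  have hG2 := (Real.Gamma_pos_of_pos (by linarith : 0 < 2 * b)).ne'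
  rw [Real.Gamma_add_one (by linarith), eq_div_of_mul_eq hGb ((mul_comm _ _).trans hG)]
  have h4 : (4 : ℝ) ^ b = 2 ^ (2 * b) := by
    rw [Real.rpow_mul (by norm_num)]
    norm_num
  rw [h4, Real.rpow_sub two_pos, Real.rpow_one]
  have := Real.sq_sqrt Real.pi_pos.le
  have hpi := Real.pi_ne_zero
  have h5 : (2 : ℝ) ^ (2 * b) ≠ 0 := by positivity
  simp only [Nat.cast_zero, zero_add, Nat.factorial_zero, Nat.cast_one, one_mul]
  field_simp
  rw [this]

/-- By orthogonality the right-hand side is the integral of C_n² against the weight. The induction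
compares the ratio of moments with Γ(n + 1 + 2b)/Γ(n + 2b) = n + 2b. -/
theorem gegenbauerNorm_eq (hb : 0 < b) (n : ℕ) : (gegenbauerNorm n b : ℂ) =
    2 ^ n * poch b n / n.factorial * gegenbauerIntegral b (X ^ n * gegenbauer b n) := by
  induction n with
  | zero =>
    have h0 : gegenbauer b 0 = 1 := by simp [gegenbauer, hb.ne', poch_zero]
    rw [h0, pow_zero, pow_zero, mul_one, gegenbauerIntegral_one hb]
    simp [poch_zero]
  | succ n ih =>
    have h1 := gegenbauerIntegral_X_pow_succ hb n
    have hn0 : (0 : ℝ) ≤ n := n.cast_nonneg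
    have h2 : gegenbauerNorm (n + 1) b =
        (n + 2 * b) * (n + b) / ((n + 1) * (n + 1 + b)) * gegenbauerNorm n b := by
      simp only [gegenbauerNorm]
      have hG := (Real.Gamma_pos_of_pos hb).ne'
      rw [show ((n + 1 : ℕ) : ℝ) + 2 * b = n + 2 * b + 1 by push_cast; ring,
        Real.Gamma_add_one (by positivity), Nat.factorial_succ]
      have f1 : (n.factorial : ℝ) ≠ 0 := by exact_mod_cast n.factorial_ne_zero
      push_cast
      field_simp
    have h3 : (n : ℂ) + 1 + b ≠ 0 := by
      have : (n : ℝ) + 1 + b ≠ 0 := by positivity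
      exact_mod_cast this
    have h4 : (n : ℂ) + 1 ≠ 0 := by exact_mod_cast n.succ_ne_zero
    have f1 : (n.factorial : ℂ) ≠ 0 := by exact_mod_cast n.factorial_ne_zero
    rw [h2, poch_succ, Nat.factorial_succ]
    push_cast
    rw [ih]
    field_simp
    linear_combination (-(2 : ℂ) ^ n * poch b n * (b + n)) * h1

/-- The normalization constant makes the leading term of the transform monic relative to
`C_n^{(g+κ)}`. -/
theorem normConst_mul {κ g : ℝ} (hg : 0 ≤ g) (hgκ : 0 < 2 * g + κ) (n : ℕ) :
    (normConst n g κ : ℂ) * (4 ^ n * poch (2 * g + κ) n / n.factorial *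
      gegenbauerIntegral g (X ^ n * gegenbauer g n)) = gegenbauerLead (g + κ) n := by
  have f1 : (n.factorial : ℂ) ≠ 0 := by exact_mod_cast n.factorial_ne_zero
  have h4 : (4 : ℂ) ^ n = 2 ^ n * 2 ^ n := by rw [← mul_pow]; norm_num
  rcases hg.eq_or_lt with rfl | hg
  · have hκ : κ ≠ 0 := by
      rintro rfl
      simp at hgκ
    have h := gegenbauerIntegral_zero_X_pow n
    rw [normConst, if_pos rfl, gegenbauerLead, zero_add, if_neg hκ, h4, mul_zero, zero_add]
    push_cast
    field_simp
    linear_combination (poch κ n : ℂ) * h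
  · have hN := gegenbauerNorm_eq hg n
    have hp : (poch g n : ℂ) ≠ 0 := by exact_mod_cast (poch_pos hg n).ne'
    have hc : (poch (2 * g + κ) n : ℂ) ≠ 0 := by exact_mod_cast (poch_pos hgκ n).ne'
    have hn0 : (gegenbauerNorm n g : ℂ) ≠ 0 := by
      have hG := Real.Gamma_pos_of_pos hg
      have hG2 : 0 < Real.Gamma (n + 2 * g) := Real.Gamma_pos_of_pos (by positivity)
      have : 0 < gegenbauerNorm n g := by
        rw [gegenbauerNorm]
        have := n.factorial_pos
        positivity
      exact_mod_cast this.ne'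
    generalize gegenbauerIntegral g (X ^ n * gegenbauer g n) = I at hN ⊢
    have hI : I ≠ 0 := by
      rintro rfl
      exact hn0 (by rw [hN, mul_zero])
    rw [normConst, if_neg hg.ne', gegenbauerLead]
    split_ifs with h1 h2
    · subst h2
      push_cast
      rw [hN]
      simp only [poch_zero, Complex.ofReal_one, pow_zero, mul_one]
      field_simp
    · obtain ⟨m, rfl⟩ := Nat.exists_eq_succ_of_ne_zero h2
      -- Here κ = -g. The factor 1/2 in the constant reflects that T_n has leading coefficient
      -- 2^{n-1}.
      rw [show 2 * g + κ = g by linarith, h4]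
      push_cast
      rw [hN, pow_succ]
      field_simp
    · push_cast
      rw [h4, hN]
      generalize (poch (2 * g + κ) n : ℂ) = d at hc ⊢
      field_simp

end Moments

/-! ### Taylor coefficients of Lambert series -/

section TaylorLambert

theorem taylorCoeff_const_mul (a : ℂ) (f : ℂ → ℂ) (j : ℕ) :
    taylorCoeff (fun q => a * f q) j = a * taylorCoeff f j := by
  simp only [taylorCoeff]
  rw [iteratedDeriv_const_mul_field]
  ring

theorem taylorCoeff_add {f h : ℂ → ℂ} (hf : AnalyticAt ℂ f 0) (hh : AnalyticAt ℂ h 0) (j : ℕ) :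
    taylorCoeff (fun q => f q + h q) j = taylorCoeff f j + taylorCoeff h j := by
  simp only [taylorCoeff]
  rw [iteratedDeriv_fun_add hf.contDiffAt hh.contDiffAt]
  ring

theorem analyticAt_const_mul (a : ℂ) {f : ℂ → ℂ} (hf : AnalyticAt ℂ f 0) :
    AnalyticAt ℂ (fun q => a * f q) 0 :=
  analyticAt_const.mul hf

namespace IsLambert

variable {c : ℕ → ℂ → ℂ}

theorem analyticAt (hc : IsLambert c) (m : ℕ) : AnalyticAt ℂ (c m) 0 :=
  (hc.differentiableOn m).analyticAt (Metric.ball_mem_nhds _ one_pos)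

/-- The bound O(|q|^m) forces a zero of order at least m at q = 0. -/
theorem taylorCoeff_eq_zero (hc : IsLambert c) {m j : ℕ} (hj : j < m) : taylorCoeff (c m) j = 0 := by
  induction j using Nat.strong_induction_on with
  | _ j ih =>
    obtain ⟨h, hh, hfh, h0⟩ := exists_eq_pow_mul_of_taylorCoeff_eq_zero (hc.analyticAt m) (j := j)
      fun i hi => ih i hi (by omega)
    rw [← h0]
    obtain ⟨C, k, hC, hb⟩ := hc.bound (1 / 2) (by norm_num)
    have ht : Tendsto (fun q : ℂ => C * ((m : ℝ) + 1) ^ k * ‖q‖ ^ (m - j)) (𝓝[≠] 0) (𝓝 0) := by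
      have : Continuous fun q : ℂ => C * ((m : ℝ) + 1) ^ k * ‖q‖ ^ (m - j) := by fun_prop
      have := this.tendsto 0
      rw [norm_zero, zero_pow (by omega), mul_zero] at this
      exact this.mono_left nhdsWithin_le_nhds
    have hl : Tendsto h (𝓝[≠] 0) (𝓝 (h 0)) := hh.continuousAt.tendsto.mono_left nhdsWithin_le_nhds
    refine tendsto_nhds_unique hl (squeeze_zero_norm' ?_ ht)
    filter_upwards [self_mem_nhdsWithin, nhdsWithin_le_nhds
      (Metric.ball_mem_nhds (0 : ℂ) (by norm_num : (0 : ℝ) < 1 / 2))] with q hq0 hq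
    have h1 := hb m q (by simpa using (mem_ball_zero_iff.1 hq).le)
    rw [hfh, norm_mul, norm_pow] at h1
    have h2 : 0 < ‖q‖ ^ j := pow_pos (norm_pos_iff.2 hq0) _
    have h3 : ‖q‖ ^ m = ‖q‖ ^ j * ‖q‖ ^ (m - j) := by rw [← pow_add]; congr 1; omega
    rw [h3] at h1
    refine le_of_mul_le_mul_left ?_ h2
    linarith

/-- The Cauchy integral is taken term by term under the uniform majorant. Only the terms m ≤ j
survive, because the m-th vanishes to order m. -/
theorem taylorCoeff_tsum (hc : IsLambert c) {ρ : ℝ} (hρ : 0 ≤ ρ) {e : ℕ → ℂ}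
    (he : ∀ m, ‖e m‖ ≤ ρ ^ m) (j : ℕ) : taylorCoeff (fun q => ∑' m, c m q * e m) j =
      ∑ m ∈ Finset.range (j + 1), taylorCoeff (c m) j * e m := by
  obtain ⟨r, hr0, hr1, hrρ⟩ : ∃ r : ℝ, 0 < r ∧ r < 1 ∧ r * ρ < 1 := by
    refine ⟨(ρ + 2)⁻¹, by positivity, inv_lt_one_of_one_lt₀ (by linarith), ?_⟩
    rw [inv_mul_lt_iff₀ (by positivity)]
    linarith
  have hR0 : 0 ≤ r * ρ := by positivity
  obtain ⟨u, hu, hub⟩ := hc.exists_summable_bound hr1 hR0 hrρ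
  have hub' : ∀ m q, ‖q‖ ≤ r → ‖c m q * e m‖ ≤ u m := fun m q hq =>
    hub m q ρ (e m) hq hρ (by gcongr) (he m)
  have hmem : ∀ q ∈ Metric.closedBall (0 : ℂ) r, ‖q‖ < 1 := fun q hq => by
    rw [mem_closedBall_zero_iff] at hq
    linarith
  have hd : ∀ m, DifferentiableOn ℂ (fun q => c m q * e m) (Metric.closedBall 0 r) := fun m =>
    ((hc.differentiableOn m).mono fun q hq => by simpa using hmem q hq).mul_const _
  have hD : DifferentiableOn ℂ (fun q => ∑' m, c m q * e m) (Metric.closedBall 0 r) := fun q hq =>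
    (hc.hasDerivAt_nome (hmem q hq) hρ (lt_of_le_of_lt (by
      rw [mem_closedBall_zero_iff] at hq; gcongr) hrρ) he).differentiableAt.differentiableWithinAt
  obtain ⟨K, hK⟩ := (isCompact_uIcc (a := (0 : ℝ)) (b := 2 * Real.pi)).exists_bound_of_continuousOn
    (continuous_cauchyKernel hr0 j).continuousOn
  have hcm : ∀ θ, circleMap 0 r θ ∈ Metric.closedBall (0 : ℂ) r := fun θ =>
    circleMap_mem_closedBall _ hr0.le _
  have hsum : HasSum (fun m => taylorCoeff (c m) j * e m)
      (taylorCoeff (fun q => ∑' m, c m q * e m) j) := by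
    rw [taylorCoeff_eq_integral hr0 hD]
    have hm : ∀ m, taylorCoeff (c m) j * e m = ∫ θ in (0)..(2 * Real.pi),
        cauchyKernel r j θ * (c m (circleMap 0 r θ) * e m) := fun m => by
      rw [← taylorCoeff_eq_integral hr0 (hd m), mul_comm, ← taylorCoeff_const_mul]
      simp only [mul_comm]
    simp only [hm]
    refine intervalIntegral.hasSum_integral_of_dominated_convergence (fun m _ => K * u m)
      (fun m => ?_) (fun m => .of_forall fun θ hθ => ?_) (.of_forall fun θ _ => hu.mul_left _)
      intervalIntegrable_const (.of_forall fun θ hθ => ?_)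
    · refine Continuous.aestronglyMeasurable ((continuous_cauchyKernel hr0 j).mul ?_)
      exact (hd m).continuousOn.comp_continuous (continuous_circleMap 0 r) hcm
    · rw [norm_mul]
      have h1 := hK θ (uIoc_subset_uIcc hθ)
      exact mul_le_mul h1 (hub' m _ (by simpa using hcm θ)) (norm_nonneg _) ((norm_nonneg _).trans h1)
    · exact (Summable.of_norm_bounded hu fun m => hub' m _ (by simpa using hcm θ)).hasSum.mul_left _
  refine hsum.unique (hasSum_sum_of_ne_finset_zero fun m hm => ?_)
  rw [Finset.mem_range, not_lt] at hm
  rw [hc.taylorCoeff_eq_zero (by omega), zero_mul]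

end IsLambert

theorem taylorCoeff_lamS_self {m : ℕ} (hm : m ≠ 0) : taylorCoeff (lamS m) m = 1 := by
  obtain ⟨h, hh, hfh, h0⟩ := exists_eq_pow_mul_of_taylorCoeff_eq_zero (isLambert_lamS.analyticAt m)
    (j := m) fun i hi => isLambert_lamS.taylorCoeff_eq_zero hi
  rw [← h0]
  have hl : Tendsto h (𝓝[≠] 0) (𝓝 (h 0)) := hh.continuousAt.tendsto.mono_left nhdsWithin_le_nhds
  have ht : Tendsto (fun q : ℂ => (1 - q ^ (2 * m))⁻¹) (𝓝[≠] 0) (𝓝 1) := by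
    have : ContinuousAt (fun q : ℂ => (1 - q ^ (2 * m))⁻¹) 0 :=
      ContinuousAt.inv₀ (by fun_prop) (by simp [hm])
    have := this.tendsto
    simp only [zero_pow (by omega : 2 * m ≠ 0), sub_zero, inv_one] at this
    exact this.mono_left nhdsWithin_le_nhds
  refine tendsto_nhds_unique hl (ht.congr' ?_)
  filter_upwards [self_mem_nhdsWithin] with q hq0
  have h1 := hfh q
  have h2 : q ^ m ≠ 0 := pow_ne_zero _ hq0
  rw [lamS, div_eq_mul_inv] at h1
  exact mul_left_cancel₀ h2 h1

end TaylorLambert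

/-! ### Expansion of the kernel in polynomials of cos x and cos y -/

section Bivariate

open Polynomial

variable {b c : ℝ}

theorem analyticAt_weightLog (y : ℝ) : AnalyticAt ℂ (fun q => weightLog y q) 0 := by
  have h : DifferentiableOn ℂ (fun q => weightLog y q) (Metric.ball 0 1) :=
    differentiableOn_weightLog.comp (f := fun q => ((y : ℂ), q)) (by fun_prop) fun q hq => by
      have : ‖q‖ < 1 := by simpa using hq
      simpa using this
  exact h.analyticAt (Metric.ball_mem_nhds _ one_pos)

theorem zero_mem_kernelDomain (z : ℂ) : (z, (0 : ℂ)) ∈ kernelDomain := by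
  simp [kernelDomain]

theorem analyticAt_kernelLog (z : ℂ) (y : ℝ) : AnalyticAt ℂ (fun q => kernelLog z y q) 0 :=
  analyticAt_slice_right isOpen_kernelDomain (differentiableOn_kernelLog y) (zero_mem_kernelDomain z)

theorem taylorCoeff_weightLog (y : ℝ) (j : ℕ) : taylorCoeff (fun q => weightLog y q) j =
    -taylorCoeff lamZero j - 2 * ∑ m ∈ Finset.range (j + 1),
      taylorCoeff (fun q => lamT m q / m) j * (Chebyshev.T ℂ (2 * m : ℕ)).eval (Complex.cos y) := by
  have h1 : AnalyticAt ℂ lamZero 0 :=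
    differentiableOn_lamZero.analyticAt (Metric.ball_mem_nhds _ one_pos)
  have h2 : (fun q => weightLog y q) = fun q => (-1) * lamZero q + (-2) *
      ∑' m : ℕ, lamT m q / m * (Chebyshev.T ℂ (2 * m : ℕ)).eval (Complex.cos y) := by
    funext q
    rw [weightLog, lamCos]
    have : ∀ m : ℕ, Complex.cos (m * (2 * y)) = (Chebyshev.T ℂ (2 * m : ℕ)).eval (Complex.cos y) := by
      intro m
      rw [Chebyshev.T_complex_cos]
      congr 1
      push_cast
      ring
    simp only [this]
    ring
  have h3 := isLambert_lamT.div_natCast.taylorCoeff_tsum zero_le_one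
    (e := fun m => (Chebyshev.T ℂ (2 * m : ℕ)).eval (Complex.cos y)) (fun m => by
      rw [Chebyshev.T_complex_cos, one_pow, ← Complex.ofReal_intCast, ← Complex.ofReal_mul,
        ← Complex.ofReal_cos, Complex.norm_real]
      exact Real.abs_cos_le_one _) j
  have h4 : AnalyticAt ℂ (fun q => (-2) * ∑' m : ℕ, lamT m q / m *
      (Chebyshev.T ℂ (2 * m : ℕ)).eval (Complex.cos y)) 0 := by
    have := (analyticAt_weightLog y).sub (analyticAt_const_mul (-1) h1)
    refine this.congr (.of_forall fun q => ?_)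
    have := congrFun h2 q
    simp only [Pi.sub_apply, this]
    ring
  rw [h2, taylorCoeff_add (analyticAt_const_mul (-1) h1) h4, taylorCoeff_const_mul,
    taylorCoeff_const_mul, h3]
  ring

theorem taylorCoeff_kernelLog (z : ℂ) (y : ℝ) (j : ℕ) : taylorCoeff (fun q => kernelLog z y q) j =
    2 * taylorCoeff lamZero j + 4 * ∑ m ∈ Finset.range (j + 1),
      taylorCoeff (fun q => lamS m q / m) j *
        ((Chebyshev.T ℂ m).eval z * (Chebyshev.T ℂ m).eval (Complex.cos y)) := by
  have h1 : AnalyticAt ℂ lamZero 0 :=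
    differentiableOn_lamZero.analyticAt (Metric.ball_mem_nhds _ one_pos)
  have h2 : (fun q => kernelLog z y q) = fun q => 2 * lamZero q + 4 *
      ∑' m : ℕ, lamS m q / m * ((Chebyshev.T ℂ m).eval z * Complex.cos (m * y)) := rfl
  have h3 := isLambert_lamS.div_natCast.taylorCoeff_tsum (ellipseRho_nonneg z)
    (norm_chebyshevT_mul_cos_le · z y) j
  have h4 : AnalyticAt ℂ (fun q => 4 *
      ∑' m : ℕ, lamS m q / m * ((Chebyshev.T ℂ m).eval z * Complex.cos (m * y))) 0 := by
    have := (analyticAt_kernelLog z y).sub (analyticAt_const_mul 2 h1)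
    refine this.congr (.of_forall fun q => ?_)
    have := congrFun h2 q
    simp only [Pi.sub_apply, this]
    ring
  rw [h2, taylorCoeff_add (analyticAt_const_mul 2 h1) h4, taylorCoeff_const_mul,
    taylorCoeff_const_mul, h3]
  simp only [Chebyshev.T_complex_cos, Int.cast_natCast]

/-- The Taylor coefficients in the nome of the logarithm of the kernel, as polynomials in `cos x`
whose coefficients are polynomials in `cos y`. -/
noncomputable def exponentPoly (b c : ℝ) (j : ℕ) : ℂ[X][X] :=
  C (C ((2 * c - 2 * b) * taylorCoeff lamZero j) - C (4 * (b : ℂ)) * ∑ m ∈ Finset.range (j + 1),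
      C (taylorCoeff (fun q => lamT m q / m) j) * Chebyshev.T ℂ (2 * m : ℕ)) +
    ∑ m ∈ Finset.range (j + 1), C (C (4 * (c : ℂ) * taylorCoeff (fun q => lamS m q / m) j) *
      Chebyshev.T ℂ m) * (Chebyshev.T ℂ m).map C

theorem analyticAt_exponent (b c : ℝ) (z : ℂ) (y : ℝ) :
    AnalyticAt ℂ (fun q => 2 * b * weightLog y q + c * kernelLog z y q) 0 :=
  (analyticAt_const_mul _ (analyticAt_weightLog y)).add (analyticAt_const_mul _ (analyticAt_kernelLog z y))

theorem taylorCoeff_exponent (b c : ℝ) (z : ℂ) (y : ℝ) (j : ℕ) :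
    taylorCoeff (fun q => 2 * b * weightLog y q + c * kernelLog z y q) j =
      (exponentPoly b c j).evalEval (Complex.cos y) z := by
  rw [taylorCoeff_add (analyticAt_const_mul _ (analyticAt_weightLog y))
    (analyticAt_const_mul _ (analyticAt_kernelLog z y)), taylorCoeff_const_mul, taylorCoeff_const_mul,
    taylorCoeff_weightLog, taylorCoeff_kernelLog, exponentPoly]
  have h1 : (∑ m ∈ Finset.range (j + 1), C (C (4 * (c : ℂ) * taylorCoeff (fun q => lamS m q / m) j) *
      Chebyshev.T ℂ m) * (Chebyshev.T ℂ m).map C).evalEval (Complex.cos y) z =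
      4 * c * ∑ m ∈ Finset.range (j + 1), taylorCoeff (fun q => lamS m q / m) j *
        ((Chebyshev.T ℂ m).eval z * (Chebyshev.T ℂ m).eval (Complex.cos y)) := by
    rw [evalEval_finsetSum, Finset.mul_sum]
    refine Finset.sum_congr rfl fun m _ => ?_
    rw [evalEval_mul, evalEval_C, evalEval_map_C, eval_mul, eval_C]
    ring
  rw [evalEval_add, h1, evalEval_C, eval_sub, eval_mul, eval_C, eval_C, eval_finsetSum]
  simp only [eval_mul, eval_C]
  ring

theorem natDegree_chebyshevT (m : ℕ) : (Chebyshev.T ℂ m).natDegree = m := by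
  rw [Chebyshev.natDegree_T, Int.natAbs_natCast]

theorem natDegree_exponentPoly_le (b c : ℝ) (j : ℕ) : (exponentPoly b c j).natDegree ≤ j := by
  refine natDegree_add_le_of_degree_le (by rw [natDegree_C]; omega) ?_
  refine natDegree_sum_le_of_forall_le _ _ fun m hm => ?_
  rw [Finset.mem_range] at hm
  refine (natDegree_C_mul_le _ _).trans (natDegree_map_le.trans ?_)
  rw [natDegree_chebyshevT]
  omega

/-- Only m = j + 1 reaches the top degree in z. T_{j+1} has leading coefficient 2^j there, and 4c/(j
+ 1) comes from the kernel series. -/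
theorem coeff_exponentPoly_self (b c : ℝ) (j : ℕ) : (exponentPoly b c (j + 1)).coeff (j + 1) =
    C (2 ^ (j + 2) * (c : ℂ) / (j + 1)) * Chebyshev.T ℂ (j + 1 : ℕ) := by
  rw [exponentPoly, coeff_add, coeff_C_succ, zero_add, finsetSum_coeff,
    Finset.sum_eq_single (j + 1)]
  · have h := Chebyshev.leadingCoeff_T ℂ (j + 1 : ℕ)
    rw [leadingCoeff, natDegree_chebyshevT] at h
    have h1 : taylorCoeff (fun q => lamS (j + 1) q / (j + 1 : ℕ)) (j + 1) = 1 / (j + 1 : ℕ) := by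
      have : (fun q => lamS (j + 1) q / (j + 1 : ℕ)) =
          fun q => ((j + 1 : ℕ) : ℂ)⁻¹ * lamS (j + 1) q := by
        funext q; ring
      rw [this, taylorCoeff_const_mul, taylorCoeff_lamS_self (by omega)]
      ring
    rw [coeff_C_mul, coeff_map, h, h1]
    simp only [Int.natAbs_natCast, Nat.add_sub_cancel]
    rw [mul_assoc, mul_comm (Chebyshev.T ℂ _), ← mul_assoc, ← C_mul]
    congr 2
    push_cast
    ring
  · intro m hm hne
    rw [Finset.mem_range] at hm
    rw [coeff_C_mul, coeff_map, coeff_eq_zero_of_natDegree_lt (by rw [natDegree_chebyshevT]; omega),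
      C_0, mul_zero]
  · intro h
    simp at h

/-- The coefficients of (1 - x) f' = c f for f = (1 - x)^{-c}. The terms of top bidegree of the
kernel are those of f at x = 4qzw, with z = cos x and w = cos y. -/
theorem sum_poch_div_factorial (c : ℝ) (n : ℕ) :
    c * ∑ k ∈ Finset.range (n + 1), poch c k / k.factorial = poch c (n + 1) / n.factorial := by
  induction n with
  | zero => simp [poch_zero, poch_succ]
  | succ n ih =>
    rw [Finset.sum_range_succ, mul_add, ih, poch_succ c (n + 1), Nat.factorial_succ]
    have f1 : (n.factorial : ℝ) ≠ 0 := by exact_mod_cast n.factorial_ne_zero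
    push_cast
    field_simp
    ring

theorem exponent_zero (b c : ℝ) (z : ℂ) (y : ℝ) :
    2 * b * weightLog y 0 + c * kernelLog z y 0 = 0 := by
  have hS : ∀ m, lamS m 0 = 0 := fun m => by
    rcases eq_or_ne m 0 with rfl | hm
    · simp [lamS]
    · simp [lamS, hm]
  have hT : ∀ m, lamT m 0 = 0 := fun m => by rw [lamT_eq, hS, mul_zero]
  simp [weightLog, kernelLog, lamZero, lamCos, hS, hT]

/-- The Taylor coefficients of the kernel in the nome are polynomials in `cos x` and `cos y`. -/
theorem exists_taylorCoeff_exp_exponent (b c : ℝ) (n : ℕ) : ∃ E : ℂ[X][X],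
    E.natDegree ≤ n ∧ (E.coeff n).natDegree ≤ n ∧
    (E.coeff n).coeff n = 4 ^ n * poch c n / n.factorial ∧
    ∀ (z : ℂ) (y : ℝ), taylorCoeff (fun q => Complex.exp (2 * b * weightLog y q + c * kernelLog z y q)) n =
      E.evalEval (Complex.cos y) z := by
  induction n using Nat.strong_induction_on with
  | _ n ih =>
    rcases n with _ | n
    · refine ⟨1, by simp, by simp, by simp [poch_zero], fun z y => ?_⟩
      rw [taylorCoeff_zero, exponent_zero, Complex.exp_zero, evalEval_one]
    have ih' : ∀ i ≤ n, ∃ E : ℂ[X][X], E.natDegree ≤ i ∧ (E.coeff i).natDegree ≤ i ∧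
        (E.coeff i).coeff i = 4 ^ i * poch c i / i.factorial ∧
        ∀ (z : ℂ) (y : ℝ), taylorCoeff (fun q =>
          Complex.exp (2 * b * weightLog y q + c * kernelLog z y q)) i =
            E.evalEval (Complex.cos y) z := fun i hi => ih i (by omega)
    choose! E hE1 hE2 hE3 hE4 using ih'
    have hn1 : (n : ℂ) + 1 ≠ 0 := by exact_mod_cast n.succ_ne_zero
    have hdeg : ∀ i ∈ Finset.range (n + 1), (exponentPoly b c (i + 1) * E (n - i)).natDegree ≤ n + 1 :=
      fun i hi => by
        rw [Finset.mem_range] at hi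
        refine natDegree_mul_le.trans ?_
        have := natDegree_exponentPoly_le b c (i + 1)
        have := hE1 (n - i) (by omega)
        omega
    -- The degree bounds i + 1 and n - i add up to n + 1, so the top coefficient of the product is
    -- the product of the top coefficients.
    have htop : ∀ i ∈ Finset.range (n + 1), (exponentPoly b c (i + 1) * E (n - i)).coeff (n + 1) =
        C (2 ^ (i + 2) * (c : ℂ) / (i + 1)) * Chebyshev.T ℂ (i + 1 : ℕ) * (E (n - i)).coeff (n - i) :=
      fun i hi => by
        rw [Finset.mem_range] at hi
        conv_lhs => rw [show n + 1 = (i + 1) + (n - i) by omega]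
        rw [coeff_mul_add_eq_of_natDegree_le (natDegree_exponentPoly_le b c (i + 1)) (hE1 (n - i) (by omega)),
          coeff_exponentPoly_self]
    have hcoeff : ((∑ i ∈ Finset.range (n + 1), C (C (((i : ℂ) + 1) / (n + 1))) *
        (exponentPoly b c (i + 1) * E (n - i))).coeff (n + 1)) =
        ∑ i ∈ Finset.range (n + 1), C (2 ^ (i + 2) * (c : ℂ) / (n + 1)) *
          (Chebyshev.T ℂ (i + 1 : ℕ) * (E (n - i)).coeff (n - i)) := by
      rw [finsetSum_coeff]
      refine Finset.sum_congr rfl fun i hi => ?_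
      have hi1 : (i : ℂ) + 1 ≠ 0 := by exact_mod_cast i.succ_ne_zero
      rw [coeff_C_mul, htop i hi, mul_assoc, ← mul_assoc, ← C_mul]
      congr 2
      field_simp
    refine ⟨∑ i ∈ Finset.range (n + 1), C (C (((i : ℂ) + 1) / (n + 1))) *
      (exponentPoly b c (i + 1) * E (n - i)), ?_, ?_, ?_, fun z y => ?_⟩
    · exact natDegree_sum_le_of_forall_le _ _ fun i hi => (natDegree_C_mul_le _ _).trans (hdeg i hi)
    · rw [hcoeff]
      refine natDegree_sum_le_of_forall_le _ _ fun i hi => (natDegree_C_mul_le _ _).trans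
        (natDegree_mul_le.trans ?_)
      rw [Finset.mem_range] at hi
      have := hE2 (n - i) (by omega)
      rw [natDegree_chebyshevT]
      omega
    · rw [hcoeff, finsetSum_coeff]
      have h1 : ∀ i ∈ Finset.range (n + 1), (C (2 ^ (i + 2) * (c : ℂ) / (n + 1)) *
          (Chebyshev.T ℂ (i + 1 : ℕ) * (E (n - i)).coeff (n - i))).coeff (n + 1) =
          4 ^ (n + 1) / (n + 1) * (c * ((poch c (n - i) / (n - i).factorial : ℝ) : ℂ)) := by
        intro i hi
        rw [Finset.mem_range] at hi
        have h := Chebyshev.leadingCoeff_T ℂ (i + 1 : ℕ)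
        rw [leadingCoeff, natDegree_chebyshevT] at h
        conv_lhs => rw [show n + 1 = (i + 1) + (n - i) by omega]
        rw [coeff_C_mul, coeff_mul_add_eq_of_natDegree_le (natDegree_chebyshevT _).le (hE2 (n - i) (by omega)),
          h, hE3 (n - i) (by omega)]
        simp only [Int.natAbs_natCast, Nat.add_sub_cancel]
        have h4 : (4 : ℂ) ^ (n + 1) = 2 ^ (i + 2) * 2 ^ i * 4 ^ (n - i) := by
          conv_lhs => rw [show n + 1 = i + 1 + (n - i) by omega, pow_add]
          rw [show (4 : ℂ) ^ (i + 1) = (2 * 2) ^ (i + 1) by norm_num, mul_pow]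
          ring
        rw [h4]
        push_cast
        ring
      have hrefl := Finset.sum_range_reflect (fun k => poch c k / k.factorial) (n + 1)
      simp only [Nat.add_sub_cancel] at hrefl
      rw [Finset.sum_congr rfl h1, ← Finset.mul_sum, ← Finset.mul_sum, ← Complex.ofReal_sum,
        hrefl, ← Complex.ofReal_mul, sum_poch_div_factorial, Nat.factorial_succ]
      have f1 : (n.factorial : ℂ) ≠ 0 := by exact_mod_cast n.factorial_ne_zero
      push_cast
      field_simp
    · have h := taylorCoeff_exp_succ (analyticAt_exponent b c z y) n
      rw [evalEval_finsetSum]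
      refine mul_left_cancel₀ hn1 (h.trans ?_)
      rw [Finset.mul_sum]
      refine Finset.sum_congr rfl fun i hi => ?_
      rw [Finset.mem_range] at hi
      rw [taylorCoeff_exponent, hE4 (n - i) (by omega), evalEval_mul, evalEval_mul, evalEval_C, eval_C]
      field_simp

/-- The Taylor coefficients of the integral transform in the nome are polynomials. -/
theorem exists_taylorCoeff_coreIntegral (hb : 0 ≤ b) {P : ℂ × ℂ → ℂ} {Ω : Set (ℂ × ℂ)} (hΩ : IsOpen Ω)
    (hP : DifferentiableOn ℂ P Ω) (hmem : ∀ (y : ℝ) (q : ℂ), ‖q‖ < 1 → (Complex.cos y, q) ∈ Ω)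
    {p : ℕ → ℂ[X]} (hp : ∀ j (y : ℝ), taylorCoeff (fun q => P (Complex.cos y, q)) j =
      (p j).eval (Complex.cos y)) (n : ℕ) :
    ∃ r t : ℂ[X], r.natDegree ≤ n ∧ t.natDegree ≤ n ∧ t.coeff n = 4 ^ n * poch c n / n.factorial ∧
      r.coeff n = gegenbauerIntegral b (t * p 0) ∧
      ∀ z, taylorCoeff (fun q => coreIntegral b c P (z, q)) n = r.eval z := by
  choose E hE1 hE2 hE3 hE4 using exists_taylorCoeff_exp_exponent b c
  set F : ℂ[X][X] := ∑ i ∈ Finset.range (n + 1), E i * C (p (n - i)) with hF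
  have hFdeg : F.natDegree ≤ n := natDegree_sum_le_of_forall_le _ _ fun i hi => by
    rw [Finset.mem_range] at hi
    exact (natDegree_mul_C_le _ _).trans ((hE1 i).trans (by omega))
  -- Degree n in z is reached only by the q^n term of the kernel, hence only the leading coefficient
  -- p 0 of P is involved.
  have hFtop : F.coeff n = (E n).coeff n * p 0 := by
    rw [hF, finsetSum_coeff, Finset.sum_eq_single n]
    · rw [coeff_mul_C, Nat.sub_self]
    · intro i hi hne
      rw [Finset.mem_range] at hi
      rw [coeff_mul_C, coeff_eq_zero_of_natDegree_lt ((hE1 i).trans_lt (by omega)), zero_mul]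
    · intro h
      simp at h
  refine ⟨∑ k ∈ Finset.range (n + 1), C (gegenbauerIntegral b (F.coeff k)) * X ^ k, (E n).coeff n,
    ?_, hE2 n, hE3 n, ?_, fun z => ?_⟩
  · refine natDegree_sum_le_of_forall_le _ _ fun k hk => (natDegree_C_mul_X_pow_le _ _).trans ?_
    rw [Finset.mem_range] at hk
    omega
  · rw [finsetSum_coeff, Finset.sum_eq_single n]
    · rw [coeff_C_mul_X_pow, if_pos rfl, hFtop]
    · intro k hk hne
      rw [coeff_C_mul_X_pow, if_neg (Ne.symm hne)]
    · intro h
      simp at h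
  · have hU : IsOpen {q : ℂ | (z, q) ∈ kernelDomain} := isOpen_kernelDomain.preimage (by fun_prop)
    have h1 : taylorCoeff (fun q => ∫ y in (-Real.pi)..Real.pi, coreIntegrand b c P (z, q) y) n =
        ∫ y in (-Real.pi)..Real.pi, taylorCoeff (fun q => coreIntegrand b c P (z, q) y) n := by
      refine taylorCoeff_intervalIntegral (by linarith [Real.pi_pos]) hU
        (zero_mem_kernelDomain z) ?_ ?_ n
      · have h := continuousOn_coreIntegrand (c := c) hb hP.continuousOn hmem
        have := h.comp (f := fun p : ℂ × ℝ => ((z, p.1), p.2)) (by fun_prop)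
          (s := {q : ℂ | (z, q) ∈ kernelDomain} ×ˢ Icc (-Real.pi) Real.pi)
          fun p hp => ⟨hp.1, mem_univ _⟩
        exact this
      · intro y _
        exact (differentiableOn_coreIntegrand (b := b) (c := c) hP hmem y).comp
          (f := fun q => (z, q)) (by fun_prop) fun q hq => hq
    have h2 : ∀ y : ℝ, taylorCoeff (fun q => coreIntegrand b c P (z, q) y) n =
        (((Real.sin y ^ 2) ^ b : ℝ) : ℂ) * (F.eval (C z)).eval (Complex.cos y) := by
      intro y
      have hPa : AnalyticAt ℂ (fun q => P (Complex.cos y, q)) 0 :=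
        analyticAt_slice_right hΩ hP (hmem y 0 (by simp))
      simp only [coreIntegrand]
      rw [taylorCoeff_const_mul, taylorCoeff_mul (f := fun q =>
        Complex.exp (2 * b * weightLog y q + c * kernelLog z y q))
        (analyticAt_exponent b c z y).cexp hPa]
      congr 1
      rw [← evalEval, hF, evalEval_finsetSum]
      refine Finset.sum_congr rfl fun i _ => ?_
      rw [hE4, hp, evalEval_mul, evalEval_C]
    simp only [coreIntegral]
    rw [taylorCoeff_const_mul, h1]
    simp only [h2]
    rw [← gegenbauerIntegral, eval_eq_sum_range' (Nat.lt_succ_of_le hFdeg), gegenbauerIntegral_sum hb,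
      eval_finsetSum]
    refine Finset.sum_congr rfl fun k _ => ?_
    rw [← C_pow, mul_comm, gegenbauerIntegral_C_mul, eval_mul, eval_C, eval_pow, eval_X, mul_comm]

end Bivariate

/-! ### Parity and leading coefficients -/

section Leading

open Polynomial

variable {κ a b : ℝ} {q : ℂ} {P Q : ℂ × ℂ → ℂ} {Ω : Set (ℂ × ℂ)} {n : ℕ}

theorem exists_nome_eq (hq : ‖q‖ < 1) (hq0 : q ≠ 0) : ∃ τ : ℂ, 0 < τ.im ∧ nome τ = q := by
  have hpi : (Real.pi : ℂ) ≠ 0 := by exact_mod_cast Real.pi_ne_zero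
  refine ⟨Complex.log q / (Complex.I * Real.pi), ?_, ?_⟩
  · have h1 : Complex.log q / (Complex.I * Real.pi) =
        ((Real.pi⁻¹ : ℝ) : ℂ) * (-Complex.I * Complex.log q) := by
      push_cast
      field_simp
      rw [Complex.I_sq]
      ring
    rw [h1, Complex.im_ofReal_mul]
    have h2 : (-Complex.I * Complex.log q).im = -Real.log ‖q‖ := by simp [Complex.log_re]
    rw [h2]
    exact mul_pos (by positivity) (neg_pos.2 (Real.log_neg (norm_pos_iff.2 hq0) hq))
  · rw [nome, mul_div_cancel₀ _ (mul_ne_zero Complex.I_ne_zero hpi), Complex.exp_log hq0]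

theorem cos_eq_ofReal_cos_mem (y : ℝ) : ∃ z ∈ Icc (-1 : ℝ) 1, (z : ℂ) = Complex.cos y :=
  ⟨Real.cos y, ⟨Real.neg_one_le_cos y, Real.cos_le_one y⟩, Complex.ofReal_cos y⟩

theorem exists_cos_eq {z : ℝ} (hz : z ∈ Ioo (-1 : ℝ) 1) : ∃ x ∈ Ioo 0 Real.pi, Real.cos x = z :=
  ⟨Real.arccos z, ⟨Real.arccos_pos.2 hz.2, by
    rw [← Real.arccos_neg_one]
    exact Real.strictAntiOn_arccos ⟨le_rfl, by norm_num⟩ ⟨hz.1.le, hz.2.le⟩ hz.1⟩,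
    Real.cos_arccos hz.1.le hz.2.le⟩

/-- Under x ↦ π - x both φ and d/dx change sign, while the potential is unchanged. -/
theorem reducedOp_comp_neg (κ a : ℝ) (Q : ℂ × ℂ → ℂ) (x : ℝ) (q : ℂ) :
    reducedOp κ a (fun p => Q (-p.1, p.2)) x q = reducedOp κ a Q (Real.pi - x) q := by
  have hc : ∀ s : ℝ, -Complex.cos s = Complex.cos ((Real.pi - s : ℝ) : ℂ) := fun s => by
    push_cast; exact (Complex.cos_pi_sub _).symm
  have h1 : ∀ f : ℝ → ℂ, deriv (fun s => f (Real.pi - s)) = fun s => -deriv f (Real.pi - s) :=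
    fun f => funext fun s => deriv_comp_const_sub ..
  have h2 : dlogTheta1 ((2 * (Real.pi - x) : ℝ) : ℂ) q = -dlogTheta1 ((2 * x : ℝ) : ℂ) q := by
    have : ∀ m : ℕ, Complex.sin (m * ((2 * (Real.pi - x) : ℝ) : ℂ)) =
        -Complex.sin (m * ((2 * x : ℝ) : ℂ)) := fun m => by
      rw [← Complex.sin_nat_mul_two_pi_sub (m * ((2 * x : ℝ) : ℂ)) m]
      congr 1
      push_cast
      ring
    rw [dlogTheta1_two_mul, dlogTheta1_two_mul, ← hc, lamSin, lamSin, Complex.ofReal_sub,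
      Complex.sin_pi_sub]
    simp only [this, mul_neg, tsum_neg]
    ring
  have h3 : potential κ a (Real.pi - x) q = potential κ a x q := by
    have : ∀ m : ℕ, Complex.cos (m * ((2 * (Real.pi - x) : ℝ) : ℂ)) =
        Complex.cos (m * ((2 * x : ℝ) : ℂ)) := fun m => by
      rw [← Complex.cos_nat_mul_two_pi_sub (m * ((2 * x : ℝ) : ℂ)) m]
      congr 1
      push_cast
      ring
    simp only [potential, lamCos, this]
  simp only [reducedOp, hc]
  rw [h1 (fun s : ℝ => Q (Complex.cos s, q)), deriv.fun_neg', h1, h2, h3]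
  ring

theorem reducedOp_sub (hΩ : IsOpen Ω) (hP : DifferentiableOn ℂ P Ω) (hQ : DifferentiableOn ℂ Q Ω)
    (hmem : ∀ (y : ℝ), (Complex.cos y, q) ∈ Ω) (e : ℂ) (x : ℝ) :
    reducedOp κ a (fun p => P p - e * Q p) x q = reducedOp κ a P x q - e * reducedOp κ a Q x q := by
  have hp := deriv_comp_cos hΩ hP hmem
  have hq := deriv_comp_cos hΩ hQ hmem
  have h1 : deriv (fun s : ℝ => P (Complex.cos s, q) - e * Q (Complex.cos s, q)) = fun s =>
      deriv (fun s : ℝ => P (Complex.cos s, q)) s - e * deriv (fun s : ℝ => Q (Complex.cos s, q)) s :=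
    funext fun s => ((hp s).1.differentiableAt.hasDerivAt.sub
      ((hq s).1.differentiableAt.hasDerivAt.const_mul e)).deriv
  have h2 : deriv (fun q => P (Complex.cos x, q) - e * Q (Complex.cos x, q)) q =
      deriv (fun q => P (Complex.cos x, q)) q - e * deriv (fun q => Q (Complex.cos x, q)) q :=
    ((analyticAt_slice_right hΩ hP (hmem x)).differentiableAt.hasDerivAt.sub
      ((analyticAt_slice_right hΩ hQ (hmem x)).differentiableAt.hasDerivAt.const_mul e)).deriv
  have h3 := ((hp x).2.differentiableAt.hasDerivAt.sub
      ((hq x).2.differentiableAt.hasDerivAt.const_mul e)).deriv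
  simp only [reducedOp]
  rw [h1, h2]
  erw [h3]
  ring

/-- A polynomial all of whose coefficients of degree `≢ n mod 2` vanish has degree `≡ n`. -/
theorem even_natDegree_add_of_eval_neg {p : ℂ[X]} (hp : p ≠ 0)
    (h : ∀ z : ℂ, p.eval (-z) = (-1) ^ n * p.eval z) : Even (p.natDegree + n) := by
  have h1 : p.comp (C (-1) * X) = C ((-1) ^ n) * p := by
    refine Polynomial.funext fun z => ?_
    rw [eval_comp, eval_mul, eval_C, eval_X, neg_one_mul, h, eval_mul, eval_C]
  have h2 := congrArg (fun p' => p'.coeff p.natDegree) h1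
  simp only [comp_C_mul_X_coeff, coeff_C_mul] at h2
  have h3 : p.coeff p.natDegree ≠ 0 := by simpa using hp
  have h4 : ((-1 : ℂ)) ^ p.natDegree = (-1) ^ n :=
    mul_right_cancel₀ h3 ((mul_comm _ _).trans h2)
  by_contra hodd
  rw [Nat.not_even_iff_odd] at hodd
  have h5 : (-1 : ℂ) ^ (p.natDegree + n) = -1 := hodd.neg_one_pow
  rw [pow_add, h4, ← mul_pow] at h5
  norm_num at h5

theorem hasSum_even_iff {f : ℕ → ℂ} {s : ℂ} : HasSum (fun j => (if Even j then f (j / 2) else 0) * q ^ j) s ↔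
    HasSum (fun ℓ => f ℓ * q ^ (2 * ℓ)) s := by
  have hinj : Function.Injective fun ℓ : ℕ => 2 * ℓ := fun a b h => by simpa using h
  rw [← hinj.hasSum_iff]
  · simp [Function.comp_def]
  · intro j hj
    rw [if_neg, zero_mul]
    rintro ⟨k, rfl⟩
    exact hj ⟨k, two_mul k⟩

theorem taylorCoeff_of_hasSum_even {f : ℂ → ℂ} {u : ℕ → ℂ}
    (h : ∀ q, ‖q‖ < 1 → HasSum (fun ℓ => u ℓ * q ^ (2 * ℓ)) (f q)) (j : ℕ) :
    taylorCoeff f j = if Even j then u (j / 2) else 0 :=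
  taylorCoeff_eq_of_hasSum one_pos (fun q hq => hasSum_even_iff.2 (h q (by simpa using hq))) j

variable {p : ℕ → ℂ[X]}

/-- The parity of the function passes to its coefficients by uniqueness of Taylor coefficients. -/
theorem eval_neg_of_reflection
    (hsum : ∀ z ∈ Icc (-1 : ℝ) 1, ∀ q : ℂ, ‖q‖ < 1 →
      HasSum (fun ℓ : ℕ => (p ℓ).eval (z : ℂ) * q ^ (2 * ℓ)) (P ((z : ℂ), q)))
    (hp0 : p 0 = gegenbauer b n)
    (hP : ∀ z ∈ Ioo (-1 : ℝ) 1, ∀ q : ℂ, ‖q‖ < 1 → q ≠ 0 →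
      P (-(z : ℂ), q) = (-1) ^ n * P ((z : ℂ), q)) (ℓ : ℕ) (z : ℂ) :
    (p ℓ).eval (-z) = (-1) ^ n * (p ℓ).eval z := by
  have key : (p ℓ).comp (-X) - C ((-1) ^ n) * p ℓ = 0 := by
    refine eq_zero_of_eval_Ioo fun z hz => ?_
    have hz' : -z ∈ Icc (-1 : ℝ) 1 := ⟨by linarith [hz.2], by linarith [hz.1]⟩
    have h1 : ∀ q : ℂ, ‖q‖ < 1 → HasSum (fun ℓ : ℕ => (p ℓ).eval (-(z : ℂ)) * q ^ (2 * ℓ))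
        (P (-(z : ℂ), q)) := fun q hq => by
      have := hsum (-z) hz' q hq
      rwa [Complex.ofReal_neg] at this
    have h2 : ∀ q : ℂ, ‖q‖ < 1 → HasSum (fun ℓ : ℕ => ((-1) ^ n * (p ℓ).eval (z : ℂ)) * q ^ (2 * ℓ))
        (P (-(z : ℂ), q)) := fun q hq => by
      have h3 := (hsum z (Ioo_subset_Icc_self hz) q hq).mul_left ((-1) ^ n)
      simp only [← mul_assoc] at h3
      -- The value q = 0 is not a nome, so the reflection is not given there; only p 0 matters, and
      -- its parity is known.
      rcases eq_or_ne q 0 with rfl | hq0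
      · have h4 : ∀ f : ℕ → ℂ, HasSum (fun ℓ => f ℓ * (0 : ℂ) ^ (2 * ℓ)) (f 0) := fun f => by
          have := hasSum_single (f := fun ℓ => f ℓ * (0 : ℂ) ^ (2 * ℓ)) 0 fun ℓ hℓ => by simp [hℓ]
          simpa using this
        have h5 := (h1 0 hq).unique (h4 _)
        rw [h5, hp0, gegenbauer_eval_neg, ← hp0]
        exact h4 fun ℓ => (-1) ^ n * (p ℓ).eval (z : ℂ)
      · rwa [hP z hz q hq hq0]
    have h6 := (taylorCoeff_of_hasSum_even h1 (2 * ℓ)).symm.trans (taylorCoeff_of_hasSum_even h2 (2 * ℓ))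
    simp only [even_two_mul, if_true, Nat.mul_div_cancel_left ℓ two_pos] at h6
    rw [eval_sub, eval_mul, eval_C, eval_comp, eval_neg, eval_X, h6, sub_self]
  have := congrArg (eval z) key
  rw [eval_sub, eval_mul, eval_C, eval_comp, eval_neg, eval_X, eval_zero] at this
  linear_combination this

theorem neg_cos_mem (hmem : ∀ (y : ℝ) (q : ℂ), ‖q‖ < 1 → (Complex.cos y, q) ∈ Ω) (y : ℝ)
    (hq : ‖q‖ < 1) : (-Complex.cos y, q) ∈ Ω := by
  have := hmem (Real.pi - y) q hq
  rwa [Complex.ofReal_sub, Complex.cos_pi_sub] at this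

/-- The part of P of the wrong parity solves the same equation. If it were nonzero, its lowest
coefficient would be an eigenpolynomial whose degree m has the wrong parity, and (m, ℓ) would be a
resonance. -/
theorem eval_neg_of_not_resonance (hΩ : IsOpen Ω) (hP : DifferentiableOn ℂ P Ω)
    (hmem : ∀ (y : ℝ) (q : ℂ), ‖q‖ < 1 → (Complex.cos y, q) ∈ Ω)
    (hsum : ∀ z ∈ Icc (-1 : ℝ) 1, ∀ q : ℂ, ‖q‖ < 1 →
      HasSum (fun ℓ : ℕ => (p ℓ).eval (z : ℂ) * q ^ (2 * ℓ)) (P ((z : ℂ), q)))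
    (hp0 : p 0 = gegenbauer b n) (hdeg : ∀ ℓ, (p ℓ).natDegree ≤ n + 2 * ℓ)
    (hE : ∀ x ∈ Ioo 0 Real.pi, ∀ q : ℂ, ‖q‖ < 1 → q ≠ 0 →
      reducedOp κ b P x q = ((n : ℂ) + b) ^ 2 * P (Complex.cos x, q))
    (hres : ¬∃ m ℓ : ℕ, m ≤ n + 2 * ℓ ∧ Odd (m + n) ∧ IsResonance κ b n m ℓ) (ℓ : ℕ) (z : ℂ) :
    (p ℓ).eval (-z) = (-1) ^ n * (p ℓ).eval z := by
  set w : ℕ → ℂ[X] := fun ℓ => p ℓ - C ((-1) ^ n) * (p ℓ).comp (-X) with hw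
  have hweval : ∀ ℓ z, (w ℓ).eval z = (p ℓ).eval z - (-1) ^ n * (p ℓ).eval (-z) := fun ℓ z => by
    simp only [hw, eval_sub, eval_mul, eval_C, eval_comp, eval_neg, eval_X]
  have hsq : ((-1 : ℂ) ^ n) * (-1) ^ n = 1 := by rw [← mul_pow]; simp
  suffices hzero : ∀ ℓ, w ℓ = 0 by
    have h1 := hweval ℓ z
    rw [hzero, eval_zero] at h1
    linear_combination (-1) ^ n * h1 - (p ℓ).eval (-z) * hsq
  set N : ℂ × ℂ → ℂ × ℂ := fun p => (-p.1, p.2) with hN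
  have hNd : Differentiable ℂ N := by fun_prop
  have hΩ' : IsOpen (Ω ∩ N ⁻¹' Ω) := hΩ.inter (hΩ.preimage hNd.continuous)
  have hPN : DifferentiableOn ℂ (fun p => P (N p)) (Ω ∩ N ⁻¹' Ω) :=
    hP.comp hNd.differentiableOn fun p hp => hp.2
  have hPd : DifferentiableOn ℂ P (Ω ∩ N ⁻¹' Ω) := hP.mono inter_subset_left
  have hmem' : ∀ (y : ℝ) (q : ℂ), ‖q‖ < 1 → (Complex.cos y, q) ∈ Ω ∩ N ⁻¹' Ω :=
    fun y q hq => ⟨hmem y q hq, neg_cos_mem hmem y hq⟩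
  set F : ℂ × ℂ → ℂ := fun p => P p - (-1) ^ n * P (N p) with hF
  have hFd : DifferentiableOn ℂ F (Ω ∩ N ⁻¹' Ω) := hPd.sub (hPN.const_mul _)
  have hFsum : ∀ z ∈ Ioo (-1 : ℝ) 1, ∀ q : ℂ, ‖q‖ < 1 →
      HasSum (fun ℓ : ℕ => (w ℓ).eval (z : ℂ) * q ^ (2 * ℓ)) (F ((z : ℂ), q)) := fun z hz q hq => by
    have h1 := hsum z (Ioo_subset_Icc_self hz) q hq
    have h2 := hsum (-z) ⟨by linarith [hz.2], by linarith [hz.1]⟩ q hq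
    have h3 := h1.sub (h2.mul_left ((-1) ^ n))
    rw [Complex.ofReal_neg] at h3
    refine h3.congr_fun fun ℓ => ?_
    rw [hweval]
    ring
  have hFE : ∀ x ∈ Ioo 0 Real.pi, ∀ q : ℂ, ‖q‖ < 1 → q ≠ 0 →
      reducedOp κ b F x q = ((n : ℂ) + b) ^ 2 * F (Complex.cos x, q) := fun x hx q hq hq0 => by
    have h1 := reducedOp_comp_neg κ b P x q
    have h2 := hE (Real.pi - x) ⟨by linarith [hx.2], by linarith [hx.1]⟩ q hq hq0
    rw [Complex.ofReal_sub, Complex.cos_pi_sub] at h2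
    rw [hF, reducedOp_sub hΩ' hPd hPN (fun y => hmem' y q hq), hE x hx q hq hq0]
    simp only [hN]
    rw [h1, h2]
    ring
  intro ℓ
  induction ℓ using Nat.strong_induction_on with
  | _ ℓ ih =>
    rcases Nat.eq_zero_or_pos ℓ with rfl | hℓ
    · refine Polynomial.funext fun z => ?_
      rw [hweval, hp0, gegenbauer_eval_neg, eval_zero]
      linear_combination -(gegenbauer b n).eval z * hsq
    by_contra hne
    have h1 := gegenbauerOp_taylorCoeff (κ := κ) (a := b) hΩ' hFd hmem'
      (p := fun j => if Even j then w (j / 2) else 0) (fun j z hz => by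
        rw [taylorCoeff_of_hasSum_even (hFsum z hz)]
        split_ifs <;> simp) hFE (j := 2 * ℓ) (fun i hi => by
        split_ifs with he
        · exact ih _ (by omega)
        · rfl)
    simp only [even_two_mul, if_true, Nat.mul_div_cancel_left ℓ two_pos] at h1
    have h2 := eq_of_gegenbauerOp_eq_zero hne h1
    have h3 : Even ((w ℓ).natDegree + (n + 1)) := even_natDegree_add_of_eval_neg hne fun z => by
      rw [hweval, hweval, neg_neg, pow_succ]
      linear_combination -(p ℓ).eval (-z) * hsq
    refine hres ⟨(w ℓ).natDegree, ℓ, ?_, ?_, hℓ, ?_⟩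
    · refine (natDegree_sub_le _ _).trans (max_le (hdeg ℓ) ((natDegree_C_mul_le _ _).trans ?_))
      rw [natDegree_comp, natDegree_neg, natDegree_X, mul_one]
      exact hdeg ℓ
    · rw [← Nat.not_even_iff_odd]
      rw [← add_assoc, Nat.even_add_one] at h3
      exact h3
    · have h4 : (((n : ℝ) + b) ^ 2 + 2 * κ * (2 * ℓ : ℕ) - b ^ 2 : ℝ) =
          (w ℓ).natDegree * ((w ℓ).natDegree + 2 * b) := by exact_mod_cast h2
      push_cast at h4
      linear_combination -h4

theorem map_neg_of_eval_neg
    (hsum : ∀ z ∈ Icc (-1 : ℝ) 1, ∀ q : ℂ, ‖q‖ < 1 →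
      HasSum (fun ℓ : ℕ => (p ℓ).eval (z : ℂ) * q ^ (2 * ℓ)) (P ((z : ℂ), q)))
    (hneg : ∀ ℓ z, (p ℓ).eval (-z) = (-1) ^ n * (p ℓ).eval z) (y : ℝ) (hq : ‖q‖ < 1) :
    P (-Complex.cos y, q) = (-1) ^ n * P (Complex.cos y, q) ∧
      P (Complex.cos y, -q) = P (Complex.cos y, q) := by
  obtain ⟨z, hz, hzy⟩ := cos_eq_ofReal_cos_mem y
  rw [← hzy]
  constructor
  · have h1 := hsum (-z) ⟨by linarith [hz.2], by linarith [hz.1]⟩ q hq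
    have h2 := (hsum z hz q hq).mul_left ((-1) ^ n)
    rw [Complex.ofReal_neg] at h1
    simp only [hneg, mul_assoc] at h1
    exact h1.unique h2
  · have h1 := hsum z hz (-q) (by rwa [norm_neg])
    simp only [(even_two_mul _).neg_pow] at h1
    exact h1.unique (hsum z hz q hq)

theorem gegenbauerIntegral_mul_gegenbauer (hb : 0 ≤ b) {t : ℂ[X]} (ht : t.natDegree ≤ n) :
    gegenbauerIntegral b (t * gegenbauer b n) =
      t.coeff n * gegenbauerIntegral b (X ^ n * gegenbauer b n) := by
  conv_lhs => rw [t.as_sum_range' (n + 1) (by omega)]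
  rw [Finset.sum_mul, gegenbauerIntegral_sum hb, Finset.sum_range_succ, Finset.sum_eq_zero, zero_add,
    ← C_mul_X_pow_eq_monomial, mul_assoc, gegenbauerIntegral_C_mul]
  intro i hi
  rw [Finset.mem_range] at hi
  rw [← C_mul_X_pow_eq_monomial, mul_assoc, gegenbauerIntegral_C_mul,
    gegenbauerIntegral_X_pow_mul_gegenbauer_eq_zero hb hi, mul_zero]

variable {r : ℕ → ℂ[X]} {R : ℂ × ℂ → ℂ}

theorem taylorCoeff_comp_neg (f : ℂ → ℂ) (j : ℕ) :
    taylorCoeff (fun q => f (-q)) j = (-1) ^ j * taylorCoeff f j := by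
  simp only [taylorCoeff]
  rw [iteratedDeriv_comp_neg]
  simp
  ring

/-- The two symmetries together give R(z, -q) = (-1)^n R(z, q), which excludes powers q^j with j ≢ n
mod 2. -/
theorem eq_zero_of_odd (hr : ∀ j z, taylorCoeff (fun q => R (z, q)) j = (r j).eval z)
    (h1 : ∀ᶠ q in 𝓝 (0 : ℂ), ∀ z, R (-z, q) = (-1) ^ n * R (z, q))
    (h2 : ∀ᶠ q in 𝓝 (0 : ℂ), ∀ z, R (-z, -q) = R (z, q)) (j : ℕ) :
    (∀ z, (r j).eval (-z) = (-1) ^ n * (r j).eval z) ∧ (Odd (j + n) → r j = 0) := by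
  have e1 : ∀ z, (r j).eval (-z) = (-1) ^ n * (r j).eval z := fun z => by
    rw [← hr, ← hr, ← taylorCoeff_const_mul]
    have : (fun q => R (-z, q)) =ᶠ[𝓝 0] fun q => (-1) ^ n * R (z, q) := by
      filter_upwards [h1] with q hq using hq z
    rw [taylorCoeff, this.iteratedDeriv_eq, ← taylorCoeff]
  refine ⟨e1, fun hodd => Polynomial.funext fun z => ?_⟩
  have e2 : (-1) ^ j * (r j).eval (-z) = (r j).eval z := by
    rw [← hr, ← hr, ← taylorCoeff_comp_neg fun q => R (-z, q)]
    have : (fun q => R (-z, -q)) =ᶠ[𝓝 0] fun q => R (z, q) := by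
      filter_upwards [h2] with q hq using hq z
    rw [taylorCoeff, this.iteratedDeriv_eq, ← taylorCoeff]
  rw [e1, ← mul_assoc, ← pow_add, hodd.neg_one_pow] at e2
  rw [eval_zero]
  linear_combination (-1 / 2 : ℂ) * e2

/-- A first nonzero r_j with j < n has some degree m ≤ j of the same parity, j = m + 2ℓ, and its
eigenvalue equation becomes (m - n)(m + n + 2b) = 4κℓ with κ = a - b. This is an excluded resonance
if ℓ ≥ 1 and impossible if ℓ = 0. At j = n the same argument applies to the difference from
C_n^{(a)}, whose z^n coefficient is removed by the choice of M. -/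
theorem leading_coefficients (hb : 0 ≤ b)
    (hlow : ∀ m ℓ : ℕ, m + 2 * ℓ ≤ n → Even (m + n) → ¬ IsResonance (a - b) b n m ℓ)
    (hdeg : ∀ j, (r j).natDegree ≤ j) (hneg : ∀ j z, (r j).eval (-z) = (-1) ^ n * (r j).eval z)
    (hodd : ∀ j, Odd (j + n) → r j = 0)
    (hop : ∀ j, (∀ i < j, r i = 0) → gegenbauerOp a
      (((n : ℂ) + b) ^ 2 + a ^ 2 - b ^ 2 + 2 * ((a - b : ℝ) : ℂ) * j - a ^ 2) (r j) = 0)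
    {M : ℂ} (hM : M * (r n).coeff n = gegenbauerLead a n) :
    (∀ j < n, r j = 0) ∧ C M * r n = gegenbauer a n := by
  have h1 : ∀ j < n, r j = 0 := by
    intro j
    induction j using Nat.strong_induction_on with
    | _ j ih =>
      intro hj
      by_contra hne
      have h2 := eq_of_gegenbauerOp_eq_zero hne (hop j fun i hi => ih i hi (by omega))
      have h3 := even_natDegree_add_of_eval_neg hne (hneg j)
      have h4 : Even (j + n) := by
        by_contra h
        exact hne (hodd j (Nat.not_even_iff_odd.1 h))
      set m := (r j).natDegree with hm
      have hmj : m ≤ j := hdeg j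
      have h5 : ((n : ℝ) + b) ^ 2 + a ^ 2 - b ^ 2 + 2 * (a - b) * j - a ^ 2 = m * (m + 2 * a) := by
        exact_mod_cast h2
      obtain ⟨ℓ, hℓ⟩ : ∃ ℓ, j = m + 2 * ℓ := by
        obtain ⟨u, hu⟩ := h3
        obtain ⟨v, hv⟩ := h4
        exact ⟨(j - m) / 2, by omega⟩
      rcases Nat.eq_zero_or_pos ℓ with rfl | hℓ0
      · have h6 : ((n : ℝ) - j) * (n + j + 2 * b) = 0 := by
          have : (m : ℝ) = j := by exact_mod_cast hℓ.symm
          rw [this] at h5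
          linear_combination h5
        have hnj : (j : ℝ) < n := by exact_mod_cast hj
        have hj0 : (0 : ℝ) ≤ j := j.cast_nonneg
        have : 0 < ((n : ℝ) - j) * (n + j + 2 * b) := mul_pos (by linarith) (by linarith)
        exact this.ne' h6
      · refine hlow m ℓ (by omega) h3 ⟨hℓ0, ?_⟩
        have : (j : ℝ) = m + 2 * ℓ := by exact_mod_cast hℓ
        rw [this] at h5
        linear_combination -h5
  refine ⟨h1, ?_⟩
  by_contra hne
  rw [← sub_eq_zero] at hne
  -- The difference has degree m < n with n = m + 2ℓ, so its two eigenvalue expressions n(n + 2a)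
  -- and m(m + 2a) again produce an excluded resonance.
  set D := C M * r n - gegenbauer a n with hD
  have h2 := hop n h1
  have h3 : gegenbauerOp a (n * (n + 2 * a)) D = 0 := by
    rw [hD, gegenbauerOp_sub, gegenbauerOp_C_mul, gegenbauerOp_gegenbauer, sub_zero]
    convert! mul_zero (C M) using 2
    convert! h2 using 2
    push_cast
    ring
  have h4 := eq_of_gegenbauerOp_eq_zero hne h3
  have h5 := even_natDegree_add_of_eval_neg (n := n) hne fun z => by
    rw [hD, eval_sub, eval_sub, eval_mul, eval_mul, hneg, gegenbauer_eval_neg, eval_C, eval_C]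
    ring
  have h6 : D.coeff n = 0 := by
    rw [hD, coeff_sub, coeff_C_mul, hM, coeff_gegenbauer_self, sub_self]
  have h7 : D.natDegree ≤ n := (natDegree_sub_le _ _).trans
    (max_le ((natDegree_C_mul_le _ _).trans (hdeg n)) (natDegree_gegenbauer_le _ _))
  have h8 : D.natDegree ≠ n := fun h => hne (leadingCoeff_eq_zero.1 (by rw [leadingCoeff, h, h6]))
  set m := D.natDegree
  have h9 : (n : ℝ) * (n + 2 * a) = m * (m + 2 * a) := by exact_mod_cast h4
  obtain ⟨ℓ, hℓ⟩ : ∃ ℓ, n = m + 2 * ℓ := by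
    obtain ⟨u, hu⟩ := h5
    exact ⟨(n - m) / 2, by omega⟩
  refine hlow m ℓ hℓ.ge h5 ⟨by omega, ?_⟩
  have h10 : (n : ℝ) = m + 2 * ℓ := by exact_mod_cast hℓ
  linear_combination -h9 + 2 * (a - b) * h10

end Leading

/-! ### Division by the power q^n -/

section Quotient

variable {Ω : Set (ℂ × ℂ)} {F : ℂ × ℂ → ℂ} {n : ℕ}

/-- `F(z, q) / q^n`, extended to `q = 0`. -/
noncomputable def nomeQuotient (n : ℕ) (F : ℂ × ℂ → ℂ) (p : ℂ × ℂ) : ℂ :=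
  if p.2 = 0 then taylorCoeff (fun q => F (p.1, q)) n else F p / p.2 ^ n

theorem nomeQuotient_of_ne {p : ℂ × ℂ} (hp : p.2 ≠ 0) : nomeQuotient n F p = F p / p.2 ^ n :=
  if_neg hp

theorem nomeQuotient_zero (z : ℂ) :
    nomeQuotient n F (z, 0) = taylorCoeff (fun q => F (z, q)) n := if_pos rfl

theorem differentiableAt_nomeQuotient_of_ne (hΩ : IsOpen Ω) (hF : DifferentiableOn ℂ F Ω) {p : ℂ × ℂ}
    (hp : p ∈ Ω) (hp0 : p.2 ≠ 0) : DifferentiableAt ℂ (nomeQuotient n F) p := by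
  have h0 : DifferentiableAt ℂ (fun p : ℂ × ℂ => p.2 ^ n) p := by fun_prop
  have h1 : DifferentiableAt ℂ (fun p : ℂ × ℂ => F p * (p.2 ^ n)⁻¹) p :=
    (hF.differentiableAt (hΩ.mem_nhds hp)).fun_mul (h0.fun_inv (pow_ne_zero n hp0))
  refine h1.congr_of_eventuallyEq ?_
  filter_upwards [continuous_snd.continuousAt.eventually_ne hp0] with p' hp'
  rw [nomeQuotient_of_ne hp', div_eq_mul_inv]

theorem differentiableAt_nomeQuotient_right (hΩ : IsOpen Ω) (hF : DifferentiableOn ℂ F Ω) {z q : ℂ}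
    (hp : (z, q) ∈ Ω) (h : ∀ i < n, taylorCoeff (fun q => F (z, q)) i = 0) :
    DifferentiableAt ℂ (fun q => nomeQuotient n F (z, q)) q := by
  rcases eq_or_ne q 0 with rfl | hq
  · obtain ⟨g, hg, hFg, hg0⟩ :=
      exists_eq_pow_mul_of_taylorCoeff_eq_zero (analyticAt_slice_right hΩ hF hp) h
    have : (fun q => nomeQuotient n F (z, q)) = g := funext fun q => by
      rcases eq_or_ne q 0 with rfl | hq
      · rw [nomeQuotient_zero, hg0]
      · rw [nomeQuotient_of_ne hq, hFg, mul_div_cancel_left₀ _ (pow_ne_zero n hq)]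
    rw [this]
    exact hg.differentiableAt
  · exact (differentiableAt_nomeQuotient_of_ne hΩ hF hp hq).comp q
      (f := fun q => (z, q)) (by fun_prop)

/-- Near q = 0 the quotient is recovered from its values on a circle |w| = r/2, where it is F(z,
w)/w^n. Cauchy's integral then gives joint holomorphy. -/
theorem differentiableOn_nomeQuotient (hΩ : IsOpen Ω) (hF : DifferentiableOn ℂ F Ω)
    (h : ∀ z, (z, (0 : ℂ)) ∈ Ω → ∀ i < n, taylorCoeff (fun q => F (z, q)) i = 0) :
    DifferentiableOn ℂ (nomeQuotient n F) Ω := by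
  rintro ⟨z₀, q₀⟩ hp
  refine DifferentiableAt.differentiableWithinAt ?_
  rcases eq_or_ne q₀ 0 with rfl | hq₀
  swap
  · exact differentiableAt_nomeQuotient_of_ne hΩ hF hp hq₀
  obtain ⟨r, hr, hsub⟩ := exists_ball_prod_subset hΩ hp
  have hs : 0 < r / 2 := by positivity
  have hc0 : ∀ θ, circleMap 0 (r / 2) θ ≠ 0 := fun θ => circleMap_ne_center hs.ne'
  have hcm : ∀ z ∈ Metric.ball z₀ r, ∀ θ, (z, circleMap 0 (r / 2) θ) ∈ Ω := fun z hz θ =>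
    hsub ⟨hz, circleMap_zero_mem_ball hs.le (by linarith) θ⟩
  have hcq : ∀ q ∈ Metric.ball (0 : ℂ) (r / 2), ∀ θ, circleMap 0 (r / 2) θ - q ≠ 0 :=
    fun q hq θ => sub_ne_zero.2 (circleMap_ne_mem_ball hq θ)
  have key : DifferentiableOn ℂ (fun p : ℂ × ℂ => ∫ θ in (0)..(2 * Real.pi),
      (2 * Real.pi * Complex.I)⁻¹ * (circleMap 0 (r / 2) θ * Complex.I *
        ((circleMap 0 (r / 2) θ - p.2)⁻¹ *
          (F (p.1, circleMap 0 (r / 2) θ) / circleMap 0 (r / 2) θ ^ n))))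
      (Metric.ball z₀ r ×ˢ Metric.ball 0 (r / 2)) := by
    refine differentiableOn_intervalIntegral (by positivity)
      (Metric.isOpen_ball.prod Metric.isOpen_ball) ?_ ?_
    · have h1 : Continuous fun p : (ℂ × ℂ) × ℝ => circleMap 0 (r / 2) p.2 :=
        (continuous_circleMap 0 (r / 2)).comp continuous_snd
      refine continuousOn_const.mul ((h1.mul continuous_const).continuousOn.mul (ContinuousOn.mul ?_ ?_))
      · exact ContinuousOn.inv₀ (h1.sub (continuous_snd.comp continuous_fst)).continuousOn
          fun p hp => hcq _ hp.1.2 _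
      · refine ContinuousOn.div ?_ (h1.pow n).continuousOn fun p _ => pow_ne_zero n (hc0 _)
        exact hF.continuousOn.comp
          ((continuous_fst.comp continuous_fst).prodMk h1).continuousOn fun p hp => hcm _ hp.1.1 _
    · intro θ _
      refine DifferentiableOn.const_mul (DifferentiableOn.const_mul (DifferentiableOn.mul ?_ ?_) _) _
      · exact DifferentiableOn.inv (by fun_prop) fun p hp => hcq _ hp.2 _
      · simp only [div_eq_mul_inv (F _)]
        refine DifferentiableOn.mul_const ?_ _
        exact hF.comp (f := fun p : ℂ × ℂ => (p.1, circleMap 0 (r / 2) θ)) (by fun_prop)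
          fun p hp => hcm _ hp.1 _
  have hn : Metric.ball z₀ r ×ˢ Metric.ball (0 : ℂ) (r / 2) ∈ 𝓝 (z₀, (0 : ℂ)) :=
    prod_mem_nhds (Metric.ball_mem_nhds _ hr) (Metric.ball_mem_nhds _ hs)
  refine (key.differentiableAt hn).congr_of_eventuallyEq ?_
  filter_upwards [hn] with ⟨z, q⟩ ⟨hz, hq⟩
  have hz0 : (z, (0 : ℂ)) ∈ Ω := hsub ⟨hz, Metric.mem_ball_self hr⟩
  have hd : DifferentiableOn ℂ (fun q => nomeQuotient n F (z, q)) (Metric.closedBall 0 (r / 2)) :=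
    fun w hw => (differentiableAt_nomeQuotient_right hΩ hF
      (hsub (show (z, w) ∈ _ from ⟨hz, Metric.closedBall_subset_ball (half_lt_self hr) hw⟩)) (h z hz0)).differentiableWithinAt
  have h1 := hd.circleIntegral_sub_inv_smul hq
  have hne : (2 * Real.pi * Complex.I : ℂ) ≠ 0 := Complex.two_pi_I_ne_zero
  rw [circleIntegral] at h1
  rw [intervalIntegral.integral_const_mul, eq_inv_mul_iff_mul_eq₀ hne, ← smul_eq_mul, ← h1]
  refine intervalIntegral.integral_congr fun θ _ => ?_
  simp only [deriv_circleMap, smul_eq_mul]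
  rw [nomeQuotient_of_ne (hc0 θ)]

/-- Only the exponents j = n + 2ℓ remain in the Taylor series. -/
theorem hasSum_nomeQuotient {a : ℕ → ℂ} {z q : ℂ} (hF : DifferentiableOn ℂ (fun q => F (z, q)) (Metric.ball 0 1))
    (hq : ‖q‖ < 1) (ha : ∀ j, taylorCoeff (fun q => F (z, q)) j = a j) (h0 : ∀ j < n, a j = 0)
    (hodd : ∀ j, Odd (j + n) → a j = 0) :
    HasSum (fun ℓ => a (n + 2 * ℓ) * q ^ (2 * ℓ)) (nomeQuotient n F (z, q)) := by
  rcases eq_or_ne q 0 with rfl | hq0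
  · rw [nomeQuotient_zero, ha]
    have := hasSum_single (f := fun ℓ => a (n + 2 * ℓ) * (0 : ℂ) ^ (2 * ℓ)) 0
      fun ℓ hℓ => by simp [hℓ]
    simpa using this
  · have h1 := hasSum_taylorCoeff hF (q := q) (by simpa using hq)
    simp only [ha] at h1
    have hinj : Function.Injective fun ℓ : ℕ => n + 2 * ℓ := fun a b h => by
      simp only at h
      omega
    rw [← hinj.hasSum_iff] at h1
    · rw [nomeQuotient_of_ne hq0]
      refine (h1.div_const (q ^ n)).congr_fun fun ℓ => ?_
      have := pow_ne_zero n hq0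
      simp only [Function.comp]
      rw [pow_add]
      field_simp
    · intro j hj
      rcases lt_or_ge j n with hjn | hjn
      · rw [h0 j hjn, zero_mul]
      · rw [hodd, zero_mul]
        rw [← Nat.not_even_iff_odd]
        rintro ⟨u, hu⟩
        exact hj ⟨u - n, by simp only; omega⟩

/-- The factor q^{-n} changes q ∂_q by -n, so the eigenvalue changes by 2κn. -/
theorem reducedOp_const_mul_nomeQuotient {κ a : ℝ} {Q : ℂ × ℂ → ℂ} {q E : ℂ} {x : ℝ} (M : ℂ)
    (hΩ : IsOpen Ω) (hQ : DifferentiableOn ℂ Q Ω) (hmem : ∀ (y : ℝ), (Complex.cos y, q) ∈ Ω)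
    (hq0 : q ≠ 0) (h : reducedOp κ a Q x q = E * Q (Complex.cos x, q)) :
    reducedOp κ a (fun p => M * nomeQuotient n Q p) x q =
      (E + 2 * κ * n) * (M * nomeQuotient n Q (Complex.cos x, q)) := by
  have hqn := pow_ne_zero n hq0
  have hd := deriv_comp_cos hΩ hQ hmem
  have e1 : ∀ s : ℝ, M * nomeQuotient n Q (Complex.cos s, q) = M / q ^ n * Q (Complex.cos s, q) :=
    fun s => by
      rw [nomeQuotient_of_ne hq0]
      ring
  have e2 : (fun q => M * nomeQuotient n Q (Complex.cos x, q)) =ᶠ[𝓝 q]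
      fun q => M * (Q (Complex.cos x, q) / q ^ n) := by
    filter_upwards [isOpen_ne.mem_nhds hq0] with w hw
    rw [nomeQuotient_of_ne hw]
  have h1 : deriv (fun s : ℝ => M / q ^ n * Q (Complex.cos s, q)) = fun s =>
      M / q ^ n * deriv (fun s : ℝ => Q (Complex.cos s, q)) s :=
    funext fun s => ((hd s).1.differentiableAt.hasDerivAt.const_mul _).deriv
  have h2 := ((hd x).2.differentiableAt.hasDerivAt.const_mul (M / q ^ n)).deriv
  have h3 : HasDerivAt (fun q => M * (Q (Complex.cos x, q) / q ^ n)) _ q :=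
    ((analyticAt_slice_right hΩ hQ (hmem x)).differentiableAt.hasDerivAt.fun_div
      (hasDerivAt_pow n q) hqn).const_mul M
  have h4 : q * deriv (fun q => M * nomeQuotient n Q (Complex.cos x, q)) q =
      M / q ^ n * (q * deriv (fun q => Q (Complex.cos x, q)) q - n * Q (Complex.cos x, q)) := by
    rw [e2.deriv_eq, h3.deriv]
    rcases n with _ | n
    · simp
      ring
    · rw [Nat.add_sub_cancel]
      push_cast
      field_simp
      ring
  rw [reducedOp] at h ⊢
  rw [h4]
  simp only [e1]
  rw [h1, h2]
  linear_combination (M / q ^ n) * h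

end Quotient

/-! ### The transform in terms of the core integral -/

section Transform

variable {g κ : ℝ} {P : ℂ × ℂ → ℂ} {Ω : Set (ℂ × ℂ)} {ψ : ℝ → ℂ → ℂ} {τ : ℂ} {n : ℕ}

/-- One factor comes from the kernel, the other from ψ; together they form the integration weight.
-/
theorem theta1SqHalfPow_sq (hg : 0 ≤ g) (hτ : 0 < τ.im) (y : ℝ) :
    theta1SqHalfPow g y τ * theta1SqHalfPow g y τ = weight g y (nome τ) := by
  rw [theta1SqHalfPow_eq_weight hτ, weight, weight]
  have h1 : (Real.sin y ^ 2) ^ (g / 2) * (Real.sin y ^ 2) ^ (g / 2) = (Real.sin y ^ 2) ^ g := by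
    rw [← Real.rpow_add_of_nonneg (sq_nonneg _) (by linarith) (by linarith), add_halves]
  rw [mul_mul_mul_comm, ← Complex.ofReal_mul, h1, ← Complex.exp_add]
  congr 2
  push_cast
  ring

theorem integrand_eq (hg : 0 ≤ g) (hψ : ∀ x ∈ Icc (-Real.pi) Real.pi, ∀ τ : ℂ, 0 < τ.im →
      ψ x τ = theta1SqHalfPow g x τ * P (Complex.cos x, nome τ)) (hτ : 0 < τ.im) (x : ℝ) {y : ℝ}
    (hy : y ∈ Icc (-Real.pi) Real.pi) : integrand g κ ψ x τ y =
      theta1SqHalfPow (g + κ) x τ * coreIntegrand g (2 * g + κ) P (Complex.cos x, nome τ) y := by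
  rw [integrand, theta4Pow_mul_theta4Pow hτ, div_inv_eq_mul, hψ y hy τ hτ]
  have h := theta1SqHalfPow_sq hg hτ y
  rw [weight] at h
  rw [coreIntegrand, Complex.exp_add]
  linear_combination (theta1SqHalfPow (g + κ) x τ * P (Complex.cos y, nome τ) *
    Complex.exp (((2 * g + κ : ℝ) : ℂ) * kernelLog (Complex.cos x) y (nome τ))) * h

theorem continuous_coreIntegrand {b c : ℝ} (hb : 0 ≤ b) (hP : ContinuousOn P Ω)
    (hmem : ∀ (y : ℝ) (q : ℂ), ‖q‖ < 1 → (Complex.cos y, q) ∈ Ω) {p : ℂ × ℂ} (hp : p ∈ kernelDomain) :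
    Continuous (coreIntegrand b c P p) := by
  have h := continuousOn_coreIntegrand (c := c) hb hP hmem
  have := h.comp_continuous (f := fun y : ℝ => (p, y)) (by fun_prop) fun y => ⟨hp, mem_univ _⟩
  exact this

theorem intervalIntegrable_integrand (hg : 0 ≤ g) (hP : ContinuousOn P Ω)
    (hmem : ∀ (y : ℝ) (q : ℂ), ‖q‖ < 1 → (Complex.cos y, q) ∈ Ω)
    (hψ : ∀ x ∈ Icc (-Real.pi) Real.pi, ∀ τ : ℂ, 0 < τ.im →
      ψ x τ = theta1SqHalfPow g x τ * P (Complex.cos x, nome τ)) (hτ : 0 < τ.im) (x : ℝ) :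
    IntervalIntegrable (integrand g κ ψ x τ) MeasureTheory.volume (-Real.pi) Real.pi := by
  have hc := (continuous_coreIntegrand (c := 2 * g + κ) hg hP hmem
    (cos_mem_kernelDomain x (norm_nome_lt_one hτ))).const_mul (theta1SqHalfPow (g + κ) x τ)
  refine (hc.intervalIntegrable (-Real.pi) Real.pi).congr fun y hy => ?_
  rw [uIoc_of_le (by linarith [Real.pi_pos])] at hy
  exact (integrand_eq hg hψ hτ x (Ioc_subset_Icc_self hy)).symm

theorem transform_eq (hg : 0 ≤ g) (hψ : ∀ x ∈ Icc (-Real.pi) Real.pi, ∀ τ : ℂ, 0 < τ.im →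
      ψ x τ = theta1SqHalfPow g x τ * P (Complex.cos x, nome τ)) (hτ : 0 < τ.im) (x : ℝ) :
    transform n g κ ψ x τ = theta1SqHalfPow (g + κ) x τ * (normConst n g κ *
      nomeQuotient n (coreIntegral g (2 * g + κ) P) (Complex.cos x, nome τ)) := by
  have h1 : ∫ y in (-Real.pi)..Real.pi, integrand g κ ψ x τ y =
      ∫ y in (-Real.pi)..Real.pi, theta1SqHalfPow (g + κ) x τ *
        coreIntegrand g (2 * g + κ) P (Complex.cos x, nome τ) y := by
    refine intervalIntegral.integral_congr fun y hy => ?_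
    rw [uIcc_of_le (by linarith [Real.pi_pos])] at hy
    exact integrand_eq hg hψ hτ x hy
  rw [transform, h1, intervalIntegral.integral_const_mul, nomeQuotient_of_ne (nome_ne_zero τ),
    coreIntegral]
  ring

theorem theta1SqHalfPow_pi_sub (s : ℝ) (x : ℝ) :
    theta1SqHalfPow s (Real.pi - x) τ = theta1SqHalfPow s x τ := by
  have h : Complex.cos (2 * ((Real.pi - x : ℝ) : ℂ)) = Complex.cos (2 * x) := by
    push_cast
    rw [mul_sub, Complex.cos_two_pi_sub]
  simp only [theta1SqHalfPow, logTheta1DivSin, h, Real.sin_pi_sub]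

theorem differentiable_nome : Differentiable ℂ nome := fun τ => (hasDerivAt_nome τ).differentiableAt

/-- The power (sin² x)^{a/2} is extended as exp((a/2) log sin² x); near real x with sin x ≠ 0 the
square stays in the slit plane. -/
theorem isJointlyAnalytic_of_eq {a : ℝ} {Q : ℂ × ℂ → ℂ} (hQ : DifferentiableOn ℂ Q kernelDomain)
    (hψ : ∀ (x : ℝ) (τ : ℂ), 0 < τ.im →
      ψ x τ = theta1SqHalfPow a x τ * Q (Complex.cos x, nome τ)) : IsJointlyAnalytic ψ := by
  have hn : Continuous nome := differentiable_nome.continuous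
  set W : Set (ℂ × ℂ) := {p | ‖p.2‖ < 1 ∧ ‖p.2‖ * Real.exp |(2 * p.1).im| < 1} with hW
  have hWo : IsOpen W :=
    IsOpen.and (isOpen_lt (by fun_prop) (by fun_prop)) (isOpen_lt (by fun_prop) (by fun_prop))
  set U : Set (ℂ × ℂ) := {p | Complex.sin p.1 ^ 2 ∈ Complex.slitPlane} ∩
    ((fun p : ℂ × ℂ => (p.1, nome p.2)) ⁻¹' W ∩
      (fun p : ℂ × ℂ => (Complex.cos p.1, nome p.2)) ⁻¹' kernelDomain) with hU
  have hnd : Differentiable ℂ fun p : ℂ × ℂ => nome p.2 := differentiable_nome.comp differentiable_snd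
  have hd1 : Differentiable ℂ fun p : ℂ × ℂ => (p.1, nome p.2) := differentiable_fst.prodMk hnd
  have hd2 : Differentiable ℂ fun p : ℂ × ℂ => (Complex.cos p.1, nome p.2) :=
    (Complex.differentiable_cos.comp differentiable_fst).prodMk hnd
  have hd3 : Differentiable ℂ fun p : ℂ × ℂ => Complex.sin p.1 ^ 2 :=
    (Complex.differentiable_sin.comp differentiable_fst).pow 2
  refine ⟨U, fun p => Complex.exp ((a / 2 : ℝ) * Complex.log (Complex.sin p.1 ^ 2)) *
    Complex.exp (a * weightLog p.1 (nome p.2)) * Q (Complex.cos p.1, nome p.2), ?_, ?_, ?_⟩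
  · exact (Complex.isOpen_slitPlane.preimage hd3.continuous).inter
      ((hWo.preimage hd1.continuous).inter (isOpen_kernelDomain.preimage hd2.continuous))
  · refine DifferentiableOn.mul (DifferentiableOn.mul ?_ ?_) ?_
    · exact ((hd3.differentiableOn.clog fun p hp => hp.1).const_mul _).cexp
    · exact ((differentiableOn_weightLog.comp hd1.differentiableOn fun p hp => hp.2.1).const_mul _).cexp
    · exact hQ.comp hd2.differentiableOn fun p hp => hp.2.2
  · intro x hx hx0 τ hτ
    have hs := sin_ne_zero_of_mem_Ioo hx hx0
    have hq := norm_nome_lt_one hτ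
    have hs2 : 0 < Real.sin x ^ 2 := by positivity
    have e1 : Complex.sin x ^ 2 = ((Real.sin x ^ 2 : ℝ) : ℂ) := by push_cast; rfl
    refine ⟨⟨?_, ?_, cos_mem_kernelDomain x hq⟩, ?_⟩
    · simp only [mem_ofPred_eq, e1]
      exact Complex.ofReal_mem_slitPlane.2 hs2
    · exact norm_mul_exp_abs_im_two_mul hq x
    · rw [hψ x τ hτ, theta1SqHalfPow, logTheta1DivSin_eq_weightLog hτ]
      simp only [e1]
      rw [← Complex.ofReal_log hs2.le, ← Complex.ofReal_mul, ← Complex.ofReal_exp,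
        Real.rpow_def_of_pos hs2, mul_comm (a / 2)]

end Transform

end Lame

/-! ### The main theorem -/

theorem theorem2 (κ g : ℝ) (hg : 0 ≤ g) (hgκ : 0 < 2 * g + κ) (n : ℕ)
    -- vacuous if `-1 < g + κ`
    (hlow : ∀ m ℓ : ℕ, m + 2 * ℓ ≤ n → Even (m + n) → ¬ Lame.IsResonance κ g n m ℓ)
    (ψ : ℝ → ℂ → ℂ)
    (hform : Lame.HasGegenbauerForm n g ψ)
    -- normalization of the undetermined resonant terms of the wrong parity
    (hpar : (∃ m ℓ : ℕ, m ≤ n + 2 * ℓ ∧ Odd (m + n) ∧ Lame.IsResonance κ g n m ℓ) →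
      Lame.HasParity n ψ)
    (hsol : Lame.IsSolution κ g (Lame.energy n g) ψ) :
    (∀ (x : ℝ) (τ : ℂ), 0 < τ.im →
      IntervalIntegrable (Lame.integrand g κ ψ x τ) MeasureTheory.volume
        (-Real.pi) Real.pi) ∧
    Lame.IsSolution κ (g + κ) (Lame.energy n (g + κ)) (Lame.transform n g κ ψ) ∧
    Lame.IsJointlyAnalytic (Lame.transform n g κ ψ) ∧
    Lame.HasGegenbauerForm n (g + κ) (Lame.transform n g κ ψ) ∧
    Lame.HasParity n (Lame.transform n g κ ψ) := by
  obtain ⟨P, Ω, p, hΩ, hP, hp0, hdeg, hsum', hψ⟩ := hform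
  have hsum : ∀ z ∈ Icc (-1 : ℝ) 1, ∀ q : ℂ, ‖q‖ < 1 →
      HasSum (fun ℓ : ℕ => (p ℓ).eval (z : ℂ) * q ^ (2 * ℓ)) (P ((z : ℂ), q)) :=
    fun z hz q hq => (hsum' z hz q hq).2
  have hmem : ∀ (y : ℝ) (q : ℂ), ‖q‖ < 1 → (Complex.cos y, q) ∈ Ω := fun y q hq => by
    obtain ⟨z, hz, hzy⟩ := Lame.cos_eq_ofReal_cos_mem y
    rw [← hzy]
    exact (hsum' z hz q hq).1
  -- Every q ≠ 0 in the disc is a nome and the weight has no zero there, so the Lamé equation can be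
  -- read as an equation for P in q.
  have hE : ∀ q : ℂ, ‖q‖ < 1 → q ≠ 0 → ∀ y ∈ Ioo (-Real.pi) Real.pi, y ≠ 0 →
      Lame.reducedOp κ g P y q = ((n : ℂ) + g) ^ 2 * P (Complex.cos y, q) :=
    fun q hq hq0 y hy hy0 => by
      obtain ⟨τ, hτ, rfl⟩ := Lame.exists_nome_eq hq hq0
      have h1 := (Lame.lame_eq_reducedOp (κ := κ) hΩ hP hmem hψ n hτ hy hy0).2.2
      rw [(hsol τ hτ y hy hy0).2.2, sub_self] at h1
      exact sub_eq_zero.1 ((mul_eq_zero.1 h1.symm).resolve_left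
        (Lame.weight_ne_zero _ (Lame.sin_ne_zero_of_mem_Ioo hy hy0)))
  have hE' : ∀ x ∈ Ioo 0 Real.pi, ∀ q : ℂ, ‖q‖ < 1 → q ≠ 0 →
      Lame.reducedOp κ g P x q = ((n : ℂ) + g) ^ 2 * P (Complex.cos x, q) :=
    fun x hx q hq hq0 => hE q hq hq0 x ⟨by linarith [hx.1, Real.pi_pos], hx.2⟩ hx.1.ne'
  have hpneg : ∀ ℓ z, (p ℓ).eval (-z) = (-1) ^ n * (p ℓ).eval z := by
    by_cases hres : ∃ m ℓ : ℕ, m ≤ n + 2 * ℓ ∧ Odd (m + n) ∧ Lame.IsResonance κ g n m ℓ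
    · refine Lame.eval_neg_of_reflection hsum hp0 fun z hz q hq hq0 => ?_
      obtain ⟨τ, hτ, rfl⟩ := Lame.exists_nome_eq hq hq0
      obtain ⟨x, hx, rfl⟩ := Lame.exists_cos_eq hz
      have hpi := Real.pi_pos
      have h1 := hpar hres x (Ioo_subset_Icc_self hx) τ hτ
      rw [hψ x ⟨by linarith [hx.1], hx.2.le⟩ τ hτ,
        hψ (Real.pi - x) ⟨by linarith [hx.2], by linarith [hx.1]⟩ τ hτ, Lame.theta1SqHalfPow_pi_sub,
        Complex.ofReal_sub, Complex.cos_pi_sub, mul_left_comm] at h1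
      rw [Complex.ofReal_cos]
      refine mul_left_cancel₀ ?_ h1
      rw [Lame.theta1SqHalfPow_eq_weight hτ]
      exact Lame.weight_ne_zero _ (Real.sin_pos_of_pos_of_lt_pi hx.1 hx.2).ne'
    · exact Lame.eval_neg_of_not_resonance hΩ hP hmem hsum hp0 hdeg hE' hres
  have hPneg : ∀ (y : ℝ) (q : ℂ), ‖q‖ < 1 → P (-Complex.cos y, q) = (-1) ^ n * P (Complex.cos y, q) ∧
      P (Complex.cos y, -q) = P (Complex.cos y, q) :=
    fun y q hq => Lame.map_neg_of_eval_neg hsum hpneg y hq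
  set R : ℂ × ℂ → ℂ := Lame.coreIntegral g (2 * g + κ) P with hR
  have hRd : DifferentiableOn ℂ R Lame.kernelDomain := Lame.differentiableOn_coreIntegral hg hP hmem
  have hRneg : ∀ q : ℂ, ‖q‖ < 1 → ∀ z, R (-z, q) = (-1) ^ n * R (z, q) := fun q hq z =>
    Lame.coreIntegral_neg (fun y => (hPneg y q hq).1) z
  have hball : ∀ᶠ q in 𝓝 (0 : ℂ), ‖q‖ < 1 := by
    filter_upwards [Metric.ball_mem_nhds (0 : ℂ) one_pos] with q hq using by simpa using hq
  -- With a = g + κ and b = g the parameters have the shape κ = a - b, c = a + b required by the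
  -- kernel function identity.
  have hκ : κ = (g + κ) - g := by ring
  have hc : 2 * g + κ = (g + κ) + g := by ring
  have hRE : ∀ (x : ℝ) (q : ℂ), Real.sin x ≠ 0 → ‖q‖ < 1 → q ≠ 0 →
      Lame.reducedOp κ (g + κ) R x q =
        (((n : ℂ) + g) ^ 2 + (g + κ : ℝ) ^ 2 - g ^ 2) * R (Complex.cos x, q) :=
    fun x q hx hq hq0 => by
      have h := Lame.reducedOp_coreIntegral_eq (a := g + κ) hg hΩ hP hmem hq hq0 hx
        (E := ((n : ℂ) + g) ^ 2) (by rw [← hκ]; exact hE q hq hq0)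
      rwa [← hκ, ← hc] at h
  choose r t hr1 ht1 ht2 hr2 hr3 using Lame.exists_taylorCoeff_coreIntegral (c := 2 * g + κ) hg hΩ hP
    hmem (p := fun j => if Even j then p (j / 2) else 0) fun j y => by
      obtain ⟨z, hz, hzy⟩ := Lame.cos_eq_ofReal_cos_mem y
      rw [← hzy, Lame.taylorCoeff_of_hasSum_even (hsum z hz)]
      split_ifs <;> simp
  have hrs := Lame.eq_zero_of_odd (n := n) hr3
    (by filter_upwards [hball] with q hq using hRneg q hq)
    (by filter_upwards [hball] with q hq using
      Lame.coreIntegral_neg_neg fun y => (hPneg y q hq).2)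
  have hlead := Lame.leading_coefficients (a := g + κ) (M := Lame.normConst n g κ) hg
    (by rwa [← hκ]) hr1 (fun j => (hrs j).1) (fun j => (hrs j).2) (fun j hj => by
      have := Lame.gegenbauerOp_taylorCoeff (κ := κ) Lame.isOpen_kernelDomain hRd
        (fun y q hq => Lame.cos_mem_kernelDomain y hq) (fun j z _ => hr3 j z)
        (fun x hx q hq hq0 => hRE x q (Real.sin_pos_of_pos_of_lt_pi hx.1 hx.2).ne' hq hq0) hj
      rwa [← hκ]) (by
      -- The z^n coefficient of r_n is the integral of C_n^{(g)} against a polynomial of degree at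
      -- most n, so only the known top coefficient of that polynomial matters.
      rw [hr2, if_pos Even.zero, Nat.zero_div, hp0, Lame.gegenbauerIntegral_mul_gegenbauer hg (ht1 n),
        ht2, Lame.normConst_mul hg hgκ])
  set Q : ℂ × ℂ → ℂ := fun p => Lame.normConst n g κ * Lame.nomeQuotient n R p with hQ
  have hQd : DifferentiableOn ℂ Q Lame.kernelDomain :=
    (Lame.differentiableOn_nomeQuotient Lame.isOpen_kernelDomain hRd fun z _ i hi => by
      rw [hr3, hlead.1 i hi, Polynomial.eval_zero]).const_mul _
  have hT : ∀ (x : ℝ) (τ : ℂ), 0 < τ.im → Lame.transform n g κ ψ x τ =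
      Lame.theta1SqHalfPow (g + κ) x τ * Q (Complex.cos x, Lame.nome τ) := fun x τ hτ =>
    Lame.transform_eq hg hψ hτ x
  refine ⟨fun x τ hτ => Lame.intervalIntegrable_integrand hg hP.continuousOn hmem hψ hτ x, ?_,
    Lame.isJointlyAnalytic_of_eq hQd hT, ?_, ?_⟩
  · intro τ hτ x hx hx0
    obtain ⟨h1, h2, h3⟩ := Lame.lame_eq_reducedOp (κ := κ) Lame.isOpen_kernelDomain hQd
      (fun y q hq => Lame.cos_mem_kernelDomain y hq) (fun x _ τ hτ => hT x τ hτ) n hτ hx hx0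
    refine ⟨h1, h2, ?_⟩
    have hq := Lame.norm_nome_lt_one hτ
    have h4 := Lame.reducedOp_const_mul_nomeQuotient (n := n) (Lame.normConst n g κ : ℂ)
      Lame.isOpen_kernelDomain hRd (fun y => Lame.cos_mem_kernelDomain y hq) (Lame.nome_ne_zero τ)
      (hRE x _ (Lame.sin_ne_zero_of_mem_Ioo hx hx0) hq (Lame.nome_ne_zero τ))
    -- The eigenvalues agree: (n + g)² + (g + κ)² - g² + 2κn = (n + g + κ)².
    rw [← sub_eq_zero, h3, h4]
    simp only [hQ]
    push_cast
    ring
  · refine ⟨Q, Lame.kernelDomain, fun ℓ => Polynomial.C (Lame.normConst n g κ : ℂ) * r (n + 2 * ℓ),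
      Lame.isOpen_kernelDomain, hQd, hlead.2,
      fun ℓ => (Polynomial.natDegree_C_mul_le _ _).trans (hr1 _), fun z hz q hq =>
        ⟨Lame.ofReal_mem_kernelDomain hz hq, ?_⟩, fun x _ τ hτ => hT x τ hτ⟩
    have h1 : DifferentiableOn ℂ (fun q => R ((z : ℂ), q)) (Metric.ball 0 1) :=
      hRd.comp (f := fun q => ((z : ℂ), q)) (by fun_prop) fun q hq =>
        Lame.ofReal_mem_kernelDomain hz (by simpa using hq)
    have h2 := Lame.hasSum_nomeQuotient (n := n) h1 hq (fun j => hr3 j z)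
      (fun j hj => by rw [hlead.1 j hj, Polynomial.eval_zero])
      (fun j hj => by rw [(hrs j).2 hj, Polynomial.eval_zero])
    simpa only [Polynomial.eval_mul, Polynomial.eval_C, mul_assoc] using
      h2.mul_left (Lame.normConst n g κ : ℂ)
  · intro x _ τ hτ
    rw [hT _ _ hτ, hT _ _ hτ, Lame.theta1SqHalfPow_pi_sub, Complex.ofReal_sub, Complex.cos_pi_sub]
    simp only [hQ]
    rw [Lame.nomeQuotient_of_ne (Lame.nome_ne_zero τ), Lame.nomeQuotient_of_ne (Lame.nome_ne_zero τ),
      hRneg _ (Lame.norm_nome_lt_one hτ)]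
    ring
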